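/- Let $A$ be a regular two-dimensional local ring of characteristic $p>0$ with maximal ideal $\mathfrak m$, fraction field $K$ and algebraically closed residue field $k$. For primes $\mathfrak p\ne\mathfrak p'$ of $A$ with $\dim A/\mathfrak p=\dim A/\mathfrak p'=1$ put $(F_{\mathfrak p}.F_{\mathfrak p'})=\dim_k A/(\mathfrak p+\mathfrak p')$ (equivalently, the length of this quotient). Let $L/K$ be a cyclic extension of degree $p$ and $B$ the integral closure of $A$ in $L$. Let $\mathfrak p_1,\dots,\mathfrak p_d$ be the primes $\mathfrak p$ with $\dim A/\mathfrak p=1$ at which $L/K$ is ramified (a residue field extension that is not separable counts as ramification). Assume that $1\le d\le 2$, that the rings $A/\mathfrak p_i$ are regular and that $(F_{\mathfrak p_1}.F_{\mathfrak p_2})=1$ if $d=2$. Let $U_A$ be the set of primes $\mathfrak p\ne\mathfrak p_1,\dots,\mathfrak p_d$ such that $A/\mathfrak p$ is regular of dimension one. For $\mathfrak p\in U_A$ let $\mathfrak q$ be a prime of $B$ over $\mathfrak p$, let $K(\mathfrak p)=\operatorname{Frac}(A/\mathfrak p)$, $L(\mathfrak q)=\operatorname{Frac}(B/\mathfrak q)$,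 and let $G_{i}$ be the lower ramification subgroups of $\operatorname{Gal}(L(\mathfrak q)/K(\mathfrak p))$ with respect to the discrete valuation ring $A/\mathfrak p$. Put $h_{\mathfrak p}(L/K)=\max\{i: |G_i|=p\}$ if $L(\mathfrak q)/K(\mathfrak p)$ has ramification index $p$, and $h_{\mathfrak p}(L/K)=0$ otherwise. For $r\ge1$ let $T_r$ be the set of $\mathfrak p\in U_A$ with $(F_{\mathfrak p}.F_{\mathfrak p_1})=r$ and, if $d=2$, $(F_{\mathfrak p}.F_{\mathfrak p_2})=1$; put $h_r(L/K)=\sup\{h_{\mathfrak p}(L/K):\mathfrak p\in T_r\}$. Assume that $A$ is a G-ring, i.e. $\widehat A\otimes_A E$ is a regular ring for every prime $\mathfrak p$ of $A$ and every finite extension $E$ of $\operatorname{Frac}(A/\mathfrak p)$. Then all $h_r(L/K)$, $r\ge1$, are finite, and the sequence $(h_r(L/K)/r)_r$ converges. More precisely, let $(T,U)$ be generators of $\mathfrak m$ such that $T$ generates $\mathfrak p_1$ and, if $d=2$, $U$ generates $\mathfrak p_2$; let $v_i$ be the valuation of $K$ attached to $\mathfrak p_i$. Consider the elements $a$ of $A[T^{-1}]$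 (if $d=1$), respectively of $A[T^{-1},U^{-1}]$ (if $d=2$), such that $L=K(x)$ with $x^p-x=a$. Then $-v_1(a)$ has a minimum $m$ on the set of these $a$, $m$ is a non-negative integer, and $$\lim_{r\to\infty} h_r(L/K)/r=m.$$ Moreover, let $a$ be any such element with $-v_1(a)=m$; put $n=-v_2(a)$ if $d=2$ and $n=0$ if $d=1$. Then $n\ge 0$ and $T^mU^na\in A$. Let $\sum_{i\ge0}\theta_{i}U^i$ be the image of $T^mU^na$ in $k[[U]]=\widehat{A/(T)}$ (where $k$ is identified with the unique field of representatives of the completion). Let $j$ be the least $i\ge0$ such that $\theta_i\ne0$ and, in case $p\mid m$, also $i\not\equiv n \pmod p$; such an $i$ exists. Then for all $r>\max(1,j)$ $$h_r(L/K)=\begin{cases} rm+n-j, & p\nmid rm+n-j,\\ rm+n-j-1, & p\mid rm+n-j.\end{cases}$$ -/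

import Mathlib

open Filter Topology TensorProduct

noncomputable section

namespace SurfaceRam

universe u v w

/-! ### Lower ramification filtration of an extension of the fraction field of a local domain -/

section Jump

variable (R : Type*) (E : Type*) (F : Type*) [CommRing R] [IsLocalRing R] [Field E] [Field F]
  [Algebra R E] [Algebra R F] [Algebra E F] [IsScalarTower R E F]

instance galSMulComm : SMulCommClass Gal(F/E) R F where
  smul_comm g r x := by
    rw [Algebra.smul_def, Algebra.smul_def, smul_mul', IsScalarTower.algebraMap_apply R E F]
    congr 1
    exact g.commutes _

/-- The `i`-th lower ramification subgroup at `M`, a maximal ideal of the integral closure `C` of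
`R` in `F`: the `σ` in `Gal(F/E)` with `σ x - x ∈ M ^ (i + 1)` for all `x` in `C`. -/
def lowerRamificationGroup (M : Ideal (integralClosure R F)) (i : ℕ) : Subgroup Gal(F/E) :=
  (M ^ (i + 1)).inertia Gal(F/E)

open scoped Classical in
/-- For a discrete valuation ring `R` with fraction field `E` and a Galois extension `F/E` of
degree dividing the prime `p`: if the ramification index of `F/E` is `p`, this is
`max {i | |G_i| = p}` (in this case the integral closure has only one maximal ideal `M`);
otherwise it is `0`. -/
def ramificationJump (p : ℕ) : ℕ :=
  if (IsLocalRing.maximalIdeal R).ramificationIdxIn (integralClosure R F) = p then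
    sSup {i : ℕ | ∃ M : Ideal (integralClosure R F), M.IsMaximal ∧
      Nat.card (lowerRamificationGroup R E F M i) = p}
  else 0

end Jump

/-! ### Prime divisors, branch divisor, the jumps `h_P` and `h_r` -/

section Surface

variable (A : Type u) [CommRing A]

/-- The primes `P` with `dim A/P = 1`. -/
def Spec₁ : Set (PrimeSpectrum A) :=
  {P | ringKrullDim (A ⧸ P.asIdeal) = 1}

variable {A} in
/-- The intersection number of two prime divisors, as the length of `A/(P + Q)`. If the residue
field `k` embeds in the completion of `A`, this is `dim_k A/(P + Q)`. -/
def intersectionNumber (P Q : PrimeSpectrum A) : ℕ∞ :=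
  Module.length A (A ⧸ (P.asIdeal ⊔ Q.asIdeal))

variable (L : Type w) [Field L] [Algebra A L]

/-- The primes in `Spec₁ A` which are ramified in the integral closure `B` of `A` in `L`
(some prime of `B` above is not unramified: ramification index greater than one or inseparable
residue field extension). -/
def branchPrimes : Set (PrimeSpectrum A) :=
  {P | P ∈ Spec₁ A ∧ ∃ Q : PrimeSpectrum (integralClosure A L),
    Q.asIdeal.LiesOver P.asIdeal ∧ ¬ Algebra.IsUnramifiedAt A Q.asIdeal}

/-- The branch divisor is strictly normal crossing: at most two components, all regular, and any
two distinct ones have intersection number one. -/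
def IsNormalCrossing : Prop :=
  (branchPrimes A L).encard ≤ 2 ∧
  (∀ P ∈ branchPrimes A L, IsRegularLocalRing (A ⧸ P.asIdeal)) ∧
  ∀ P ∈ branchPrimes A L, ∀ Q ∈ branchPrimes A L, P ≠ Q → intersectionNumber P Q = 1

/-- The set `U_A`. -/
def regularCurves : Set (PrimeSpectrum A) :=
  {P | P ∈ Spec₁ A ∧ IsRegularLocalRing (A ⧸ P.asIdeal) ∧ P ∉ branchPrimes A L}

variable {A} in
/-- The set `T_r`, where `P₁` is the first component of the branch divisor. -/
def curvesOfContact (P₁ : PrimeSpectrum A) (r : ℕ) : Set (PrimeSpectrum A) :=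
  {P | P ∈ regularCurves A L ∧ intersectionNumber P P₁ = r ∧
    ∀ P₂ ∈ branchPrimes A L, P₂ ≠ P₁ → intersectionNumber P P₂ = 1}

variable {A} [IsLocalRing A]

/-- The ramification jump of the residue extension `Frac (B/Q)` over `Frac (A/P)`, where `B` is the
integral closure of `A` in `L` and `Q` is a prime of `B` over `P`. -/
def residueJump (p : ℕ) (P : PrimeSpectrum A) (Q : PrimeSpectrum (integralClosure A L))
    [Q.asIdeal.LiesOver P.asIdeal] : ℕ :=
  haveI : IsLocalRing (A ⧸ P.asIdeal) :=
    IsLocalRing.of_surjective' (Ideal.Quotient.mk P.asIdeal) Ideal.Quotient.mk_surjective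
  letI := FractionRing.liftAlgebra (A ⧸ P.asIdeal)
    (FractionRing (integralClosure A L ⧸ Q.asIdeal))
  ramificationJump (A ⧸ P.asIdeal) (FractionRing (A ⧸ P.asIdeal))
    (FractionRing (integralClosure A L ⧸ Q.asIdeal)) p

open scoped Classical in
/-- `h_P(L/K)`, computed at some prime `Q` over `P` (when `L/K` is Galois all of these are
conjugate, so that the value does not depend on the choice). -/
def jump (p : ℕ) (P : PrimeSpectrum A) : ℕ :=
  if h : ∃ Q : PrimeSpectrum (integralClosure A L), Q.asIdeal.LiesOver P.asIdeal then
    haveI := h.choose_spec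
    residueJump L p P h.choose
  else 0

/-- `h_r(L/K)`, the supremum of `h_P(L/K)` over `T_r`. -/
def supJump (p : ℕ) (P₁ : PrimeSpectrum A) (r : ℕ) : ℕ∞ :=
  ⨆ P ∈ curvesOfContact L P₁ r, (jump L p P : ℕ∞)

variable (A) in
/-- G-rings among Noetherian local rings: for every prime `P` and every finite extension `E` of the
fraction field of `A/P`, the ring `Â ⊗ E` is regular. -/
def IsLocalGRing : Prop :=
  ∀ (P : Ideal A) [P.IsPrime] (E : Type u) [Field E] [Algebra A E] [Algebra P.ResidueField E]
    [IsScalarTower A P.ResidueField E] [FiniteDimensional P.ResidueField E],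
    IsRegularRing (AdicCompletion (IsLocalRing.maximalIdeal A) A ⊗[A] E)

/-! ### Artin–Schreier generators and their leading coefficients -/

/-- `(T, U)` are local parameters adapted to the branch divisor: `T` generates `P₁`, and `U`
generates the other component if there is one. -/
def IsAdapted (P₁ : PrimeSpectrum A) (T U : A) : Prop :=
  Ideal.span {T, U} = IsLocalRing.maximalIdeal A ∧ Ideal.span {T} = P₁.asIdeal ∧
  ∀ P₂ ∈ branchPrimes A L, P₂ ≠ P₁ → Ideal.span {U} = P₂.asIdeal

/-- `v(a) = z`, where `v` is the valuation of `K` attached to the prime divisor of the prime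
element `T` of `A`. -/
def HasOrder {K : Type v} [Field K] [Algebra A K] (T : A) (a : K) (z : ℤ) : Prop :=
  ∃ b s : A, ¬ T ∣ b ∧ ¬ T ∣ s ∧ a * algebraMap A K s = algebraMap A K T ^ z * algebraMap A K b

/-- `a` is the right hand side of an Artin–Schreier equation `x ^ p - x = a` with `L = K(x)`;
moreover `a ∈ A[T⁻¹]` if the branch divisor has one component, and `a ∈ A[T⁻¹, U⁻¹]` if it has
two. -/
def IsArtinSchreier {K : Type v} [Field K] [Algebra A K] [Algebra K L] (p : ℕ) (T U : A)
    (a : K) : Prop :=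
  (∃ x : L, IntermediateField.adjoin K {x} = ⊤ ∧ x ^ p - x = algebraMap K L a) ∧
  a ∈ Algebra.adjoin A {y : K | y = (algebraMap A K T)⁻¹ ∨
    ((branchPrimes A L).encard = 2 ∧ y = (algebraMap A K U)⁻¹)}

/-- A section of level `N`: a map from the residue field to `A` lifting the residue map, which is a
ring homomorphism modulo `𝔪 ^ N`. When the residue field is perfect of characteristic `p`, there is
exactly one embedding of it as a field of representatives in `A/𝔪 ^ N`, namely the canonical one. -/
def IsSection (N : ℕ) (lam : IsLocalRing.ResidueField A → A) : Prop :=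
  (∀ x, IsLocalRing.residue A (lam x) = x) ∧
  ∃ σ : IsLocalRing.ResidueField A →+* A ⧸ IsLocalRing.maximalIdeal A ^ N,
    ∀ x, Ideal.Quotient.mk _ (lam x) = σ x

/-- `θ j` is the coefficient of `U ^ j` in the image of `c` in the completion `k[[U]]` of
`A/(T)`. -/
def IsExpansionMod (T U c : A) (θ : ℕ → IsLocalRing.ResidueField A) : Prop :=
  ∀ N : ℕ, ∃ lam : IsLocalRing.ResidueField A → A, IsSection N lam ∧
    c - ∑ j ∈ Finset.range N, lam (θ j) * U ^ j ∈ Ideal.span {T, U ^ N}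

end Surface

end SurfaceRam

end

/-!
Along a regular curve `P` away from the branch divisor the residue extension `L(Q)/K(P)` is
generated by a root of `ξ ^ p - ξ = ā`, where `a` is an Artin–Schreier generator of `L/K` without
pole along `P` and `ā` is its restriction (`exists_residue_generator`). Since `A/P` is a discrete
valuation ring with algebraically closed residue field, the jump `h_P` is read off from `ā`: it is
at most the pole order of any `ā - (y ^ p - y)`, equal to it if that order is positive and prime to
`p`, and always zero or prime to `p` (`ramificationJump_eq`, `ramificationJump_le`,
`jump_eq_and_le`). The theorem is thus a computation of pole orders, uniform over all curves of
contact `r`.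

A generator with poles only along the branch divisor exists because, for `E = T` or `E = T U`, the
ideal of traces of integral elements contains a power of `E`. At a prime not containing `E` the
inertia group is trivial (purity is not needed: every nonzero prime other than the maximal one has
height one, and the maximal ideal contains `E`), and then Dedekind independence of the residues of
the conjugates produces an integral element whose trace is nonzero there (`exists_generator`).
As `A` is factorial, a generator takes the normal form `a = c / (T ^ m U ^ n)`, and the
poles are genuine along each branch component (`exists_isNormalForm`).

Let `a` have minimal `m`, let `θ` be the coefficients of `c` modulo `T`, and let `P` meet `T = 0`
with multiplicity `r > max 1 j`. Then `t = Ū` is a uniformizer of `A/P` and `T̄ = ε t ^ r` with a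
unit `ε`, so that `ā = c̄ / (ε ^ m t ^ (r m + n))`, and `c̄` agrees with `∑ θ_i t ^ i` below degree
`r`. The terms with `i < j` that occur have `p ∣ m` and `i ≡ n` modulo `p`. They are `p`-th
powers, for `k` is perfect, and replacing them by their `p`-th roots produces poles of order less
than `r m + n - j`. What remains has a pole of order exactly `r m + n - j`
(`exists_leading_form`, `exists_correction`). If `p` does not divide this number, it is the jump for
every such curve. If `p` divides it, the jump is at most `r m + n - j - 1`; in that case `p ∤ m`,
and the coefficient of order `r m + n - j - 1` left after removing the leading one depends on `ε`
through `ε ^ m`. It does not vanish on at least one of the curves `T = U ^ r` and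
`T = (1 + U) U ^ r` (`exists_unit_parameter`, `exists_jump_eq_of_dvd`), so the bound is attained.
The limit of `h_r / r` follows.

It remains to see that `j` exists. If not, `p ∣ m` and all exponents in the expansion of `c` modulo
`T` are congruent to `n` modulo `p`, so that `c U ^ ((p - 1) n)` becomes a `p`-th power in `Â/T`.
Here the G-ring hypothesis enters. If this element were not a `p`-th power in `Frac (A/T)`,
adjoining a `p`-th root would give a finite extension `E` for which `Â ⊗ E` has a nonzero nilpotent
element, whereas regular local rings are domains and regular rings are therefore reduced
(`exists_pow_eq_of_isLocalGRing`). Hence it is a `p`-th power modulo `T` already in `A`, and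
subtracting some `y ^ p - y` from `a` lowers the pole along `T`, contrary to the
choice of `m` (`exists_lt_of_eq_pow_add_mul`).
-/

namespace SurfaceRam

/-! ### Regular local rings -/

section Regular

open IsLocalRing

/-- A regular system of parameters can be chosen to contain a given element outside the square of
the maximal ideal; hence dividing by it lowers the number of generators. -/
theorem spanFinrank_maximalIdeal_quotient_le {R : Type*} [CommRing R] [IsLocalRing R]
    [IsNoetherianRing R] {x : R} (hx : x ∈ maximalIdeal R) (hx2 : x ∉ maximalIdeal R ^ 2)
    {n : ℕ} (hn : (maximalIdeal R).spanFinrank = n + 1) [IsLocalRing (R ⧸ Ideal.span {x})] :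
    (maximalIdeal (R ⧸ Ideal.span {x})).spanFinrank ≤ n := by
  classical
  obtain ⟨s, hs, hspan⟩ := Submodule.FG.exists_span_finset_card_eq_spanFinrank
    ((maximalIdeal R).fg_of_isNoetherianRing)
  have hspan : Ideal.span (s : Set R) = maximalIdeal R := hspan
  have hx' := hx
  rw [← hspan, Submodule.mem_span_finset] at hx'
  obtain ⟨f, -, hf⟩ := hx'
  obtain ⟨i, hi, hu⟩ : ∃ i ∈ s, IsUnit (f i) := by
    by_contra! h
    refine hx2 (hf ▸ Ideal.sum_mem _ fun i hi => ?_)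
    rw [pow_two, smul_eq_mul]
    exact Ideal.mul_mem_mul ((mem_maximalIdeal _).2 (h i hi)) (hspan ▸ Ideal.subset_span hi)
  have himem : i ∈ Ideal.span (insert x (s.erase i : Set R)) := by
    have h1 : f i * i = x - ∑ j ∈ s.erase i, f j * j := by
      rw [← hf, ← Finset.add_sum_erase s _ hi]; simp
    obtain ⟨v, hv⟩ := hu
    have h2 : ↑v⁻¹ * (x - ∑ j ∈ s.erase i, f j * j) = i := by
      rw [← h1, ← hv]; simp
    have h3 : ↑v⁻¹ * (x - ∑ j ∈ s.erase i, f j * j) ∈ Ideal.span (insert x (s.erase i : Set R)) :=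
      Ideal.mul_mem_left _ _ (Ideal.sub_mem _ (Ideal.subset_span (by simp))
      (Ideal.sum_mem _ fun j hj => Ideal.mul_mem_left _ _
          (Ideal.subset_span (Or.inr (Finset.mem_coe.2 hj)))))
    rwa [h2] at h3
  have hmax : Ideal.span (insert x (s.erase i : Set R)) = maximalIdeal R := by
    apply le_antisymm
    · rw [Ideal.span_le]
      rintro y (rfl | hy)
      · exact hx
      · rw [← hspan]; exact Ideal.subset_span (Finset.erase_subset _ _ hy)
    · rw [← hspan, Ideal.span_le]
      intro y hy
      by_cases h : y = i
      · exact h ▸ himem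
      · exact Ideal.subset_span (Or.inr (by simp [h]; exact hy))
  have hq : maximalIdeal (R ⧸ Ideal.span {x}) =
      Ideal.span (Ideal.Quotient.mk (Ideal.span {x}) '' (s.erase i : Set R)) := by
    rw [← IsLocalRing.map_maximalIdeal_of_surjective _ (Ideal.Quotient.mk_surjective
      (I := Ideal.span {x})), ← hmax, Ideal.map_span, Set.image_insert_eq]
    have : Ideal.Quotient.mk (Ideal.span {x}) x = 0 :=
      Ideal.Quotient.eq_zero_iff_mem.2 (Ideal.mem_span_singleton_self x)
    rw [this, Ideal.span_insert_zero]
  rw [hq]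
  have hfin : (Ideal.Quotient.mk (Ideal.span {x}) '' (s.erase i : Set R)).Finite :=
    (Finset.finite_toSet _).image _
  refine (Submodule.spanFinrank_span_le_ncard_of_finite hfin).trans ?_
  refine (Set.ncard_image_le (Finset.finite_toSet _)).trans ?_
  rw [Set.ncard_coe_finset, Finset.card_erase_of_mem hi]
  omega

/-- Regular local rings are domains, by induction on the dimension. Prime avoidance gives `x` in the
maximal ideal outside its square and outside all minimal primes. Then `(x)` is prime, since the
quotient is regular of smaller dimension, and a minimal prime below `(x)` equals its product
with `(x)`, hence vanishes by Nakayama's lemma. -/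
theorem isDomain_of_ringKrullDim_eq (n : ℕ) : ∀ (R : Type*) [CommRing R] [IsRegularLocalRing R],
    ringKrullDim R = n → IsDomain R := by
  induction n with
  | zero =>
    intro R _ _ h
    have h0 := IsRegularLocalRing.spanFinrank_maximalIdeal (R := R)
    rw [h] at h0
    have h1 : maximalIdeal R = ⊥ := (Submodule.spanFinrank_eq_zero_iff_eq_bot
      ((maximalIdeal R).fg_of_isNoetherianRing)).1 (by exact_mod_cast h0)
    exact (isField_iff_maximalIdeal_eq.2 h1).isDomain
  | succ n ih =>
    intro R _ _ h
    classical
    have h0 := IsRegularLocalRing.spanFinrank_maximalIdeal (R := R)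
    rw [h] at h0
    have h0 : (maximalIdeal R).spanFinrank = n + 1 := by exact_mod_cast h0
    have hfin := minimalPrimes.finite_of_isNoetherianRing R
    obtain ⟨x, hx, hx2, hxp⟩ : ∃ x ∈ maximalIdeal R, x ∉ maximalIdeal R ^ 2 ∧
        ∀ p ∈ minimalPrimes R, x ∉ p := by
      by_contra! hcon
      have hsub : (maximalIdeal R : Set R) ⊆
          ⋃ i ∈ ((insert (maximalIdeal R ^ 2) hfin.toFinset : Finset (Ideal R)) : Set (Ideal R)),
            ((id i : Ideal R) : Set R) := by
        intro x hx
        by_cases h2 : x ∈ maximalIdeal R ^ 2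
        · exact Set.mem_biUnion (by simp) h2
        · obtain ⟨p, hp, hxp⟩ := hcon x hx h2
          exact Set.mem_biUnion (by simp [hp]) hxp
      rw [Ideal.subset_union_prime (f := id) (maximalIdeal R ^ 2) (maximalIdeal R ^ 2)
        (by
          intro i hi h1 _
          simp only [Finset.mem_insert, Set.Finite.mem_toFinset, h1, false_or] at hi
          exact Ideal.IsMinimalPrime.isPrime hi)] at hsub
      obtain ⟨i, hi, hle⟩ := hsub
      simp only [Finset.mem_insert, Set.Finite.mem_toFinset] at hi
      rcases hi with rfl | hi
      · have : maximalIdeal R = ⊥ := by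
          refine Submodule.eq_bot_of_le_smul_of_le_jacobson_bot (maximalIdeal R) _
            ((maximalIdeal R).fg_of_isNoetherianRing) ?_ (IsLocalRing.maximalIdeal_le_jacobson _)
          simpa [pow_two] using hle
        rw [this] at h0
        simp at h0
      · have := Ideal.IsMinimalPrime.isPrime hi
        have heq : i = maximalIdeal R := le_antisymm (le_maximalIdeal this.ne_top) hle
        have hh : i.height = 0 := Ideal.height_eq_zero_iff.2 hi
        have := maximalIdeal_height_eq_ringKrullDim (R := R)
        rw [← heq, hh, h] at this
        exact absurd this (by norm_cast)
    have hne : Ideal.span {x} ≠ ⊤ := by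
      rw [Ne, Ideal.span_singleton_eq_top]; exact (mem_maximalIdeal x).1 hx
    have : Nontrivial (R ⧸ Ideal.span {x}) := Ideal.Quotient.nontrivial_iff.2 hne
    have : IsLocalRing (R ⧸ Ideal.span {x}) :=
      IsLocalRing.of_surjective' (Ideal.Quotient.mk _) Ideal.Quotient.mk_surjective
    have hle := spanFinrank_maximalIdeal_quotient_le hx hx2 h0
    have hdim := ringKrullDim_le_ringKrullDim_quotient_add_encard {x} (R := R)
      (by simpa [IsLocalRing.ringJacobson_eq_maximalIdeal] using hx)
    rw [h] at hdim
    have hdim2 : (n : WithBot ℕ∞) ≤ ringKrullDim (R ⧸ Ideal.span {x}) := by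
      have hd : ((n : WithBot ℕ∞) + 1) ≤ ringKrullDim (R ⧸ Ideal.span {x}) + 1 := by
        simpa using hdim
      exact ENat.WithBot.add_le_add_one_right_iff.1 hd
    have hreg : IsRegularLocalRing (R ⧸ Ideal.span {x}) :=
      IsRegularLocalRing.of_spanFinrank_maximalIdeal_le _ (le_trans (by exact_mod_cast hle) hdim2)
    have heq : ringKrullDim (R ⧸ Ideal.span {x}) = n := by
      refine le_antisymm ?_ hdim2
      rw [← hreg.spanFinrank_maximalIdeal]; exact_mod_cast hle
    have := ih _ heq
    have hprime : (Ideal.span {x}).IsPrime := (Ideal.Quotient.isDomain_iff_prime _).1 this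
    obtain ⟨p, hp, hpx⟩ := Ideal.exists_minimalPrimes_le (bot_le : ⊥ ≤ Ideal.span {x})
    have hpp : p.IsPrime := Ideal.IsMinimalPrime.isPrime hp
    have hbot : p = ⊥ := by
      refine Submodule.eq_bot_of_le_smul_of_le_jacobson_bot (Ideal.span {x}) _
        (p.fg_of_isNoetherianRing) ?_ ((le_maximalIdeal hne).trans
          (IsLocalRing.maximalIdeal_le_jacobson _))
      intro y hy
      obtain ⟨z, rfl⟩ := Ideal.mem_span_singleton'.1 (hpx hy)
      rw [mul_comm, smul_eq_mul]
      exact Ideal.mul_mem_mul (Ideal.mem_span_singleton_self x)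
        ((hpp.mem_or_mem hy).resolve_right (hxp p hp))
    rw [hbot] at hpp
    exact IsDomain.of_bot_isPrime R

theorem isDomain_of_isRegularLocalRing (R : Type*) [CommRing R] [IsRegularLocalRing R] :
    IsDomain R :=
  isDomain_of_ringKrullDim_eq _ R (IsRegularLocalRing.spanFinrank_maximalIdeal (R := R)).symm

theorem isReduced_of_isRegularRing (R : Type*) [CommRing R] [IsRegularRing R] : IsReduced R :=
  isReduced_ofLocalizationMaximal R fun J hJ => by
    have := isDomain_of_isRegularLocalRing (Localization.AtPrime J)
    infer_instance

theorem isDiscreteValuationRing_of_isRegularLocalRing (R : Type*) [CommRing R] [IsDomain R]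
    [IsRegularLocalRing R] (h : ringKrullDim R = 1) : IsDiscreteValuationRing R := by
  have h0 := IsRegularLocalRing.spanFinrank_maximalIdeal (R := R)
  rw [h] at h0
  have h1 : (maximalIdeal R).spanFinrank = 1 := by exact_mod_cast h0
  obtain ⟨hp, hne⟩ := (Submodule.spanFinrank_eq_one_iff _).1 h1
  have hnf : ¬ IsField R := fun hf => hne (isField_iff_maximalIdeal_eq.1 hf)
  exact ((IsDiscreteValuationRing.TFAE R hnf).out 0 4).2 hp

end Regular

/-! ### Two-dimensional regular local rings -/

section DimTwo

open IsLocalRing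

variable {A : Type*} [CommRing A] [IsRegularLocalRing A]

theorem exists_span_pair_eq (hdim : ringKrullDim A = 2) :
    ∃ T U : A, Ideal.span {T, U} = maximalIdeal A := by
  classical
  have h0 := IsRegularLocalRing.spanFinrank_maximalIdeal (R := A)
  rw [hdim] at h0
  obtain ⟨s, hs, hspan⟩ := Submodule.FG.exists_span_finset_card_eq_spanFinrank
    ((maximalIdeal A).fg_of_isNoetherianRing)
  have h2 : s.card = 2 := by rw [hs]; exact_mod_cast h0
  obtain ⟨T, U, -, rfl⟩ := Finset.card_eq_two.1 h2
  exact ⟨T, U, by simpa using hspan⟩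

theorem ne_zero_of_span_pair_eq (hdim : ringKrullDim A = 2) {T U : A}
    (h : Ideal.span {T, U} = maximalIdeal A) : T ≠ 0 := by
  rintro rfl
  have h0 := IsRegularLocalRing.spanFinrank_maximalIdeal (R := A)
  have h1 := Submodule.spanFinrank_span_le_ncard_of_finite (R := A) (Set.finite_singleton U)
  rw [Ideal.span_insert_zero] at h
  have h2 : (Submodule.span A {U}) = maximalIdeal A := h
  rw [h2, Set.ncard_singleton] at h1
  rw [hdim] at h0
  have : (maximalIdeal A).spanFinrank = 2 := by exact_mod_cast h0
  omega

variable [IsDomain A]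

theorem ringKrullDim_quotient_span_singleton (hdim : ringKrullDim A = 2) {x : A} (h0 : x ≠ 0)
    (hx : x ∈ maximalIdeal A) : ringKrullDim (A ⧸ Ideal.span {x}) = 1 := by
  have h := ringKrullDim_quotient_span_singleton_succ_eq_ringKrullDim_of_mem_nonZeroDivisors
    (mem_nonZeroDivisors_of_ne_zero h0) hx
  rw [hdim] at h
  have h2 : ringKrullDim (A ⧸ Ideal.span {x}) + 1 = 1 + 1 := by rw [h]; norm_num
  exact ENat.WithBot.add_one_cancel.1 h2

theorem ringKrullDim_quotient_eq_one (hdim : ringKrullDim A = 2) {P : Ideal A} [P.IsPrime]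
    (h0 : P ≠ ⊥) (hm : P ≠ maximalIdeal A) : ringKrullDim (A ⧸ P) = 1 := by
  obtain ⟨x, hx, hx0⟩ := Submodule.exists_mem_ne_zero_of_ne_bot h0
  have hxm : x ∈ maximalIdeal A := le_maximalIdeal (Ideal.IsPrime.ne_top ‹_›) hx
  have hle : ringKrullDim (A ⧸ P) ≤ 1 := by
    rw [← ringKrullDim_quotient_span_singleton hdim hx0 hxm]
    exact ringKrullDim_le_of_surjective (Ideal.Quotient.factor
      ((Ideal.span_singleton_le_iff_mem _).2 hx)) (Ideal.Quotient.factor_surjective _)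
  refine le_antisymm hle ?_
  by_contra! hlt
  have h0 : Ring.KrullDimLE 0 (A ⧸ P) := by
    rw [Ring.krullDimLE_iff]
    exact ENat.WithBot.lt_add_one_iff.1 (by simpa using hlt)
  have hf : IsField (A ⧸ P) := Ring.KrullDimLE.isField_of_isDomain
  exact hm (IsLocalRing.eq_maximalIdeal (Ideal.Quotient.maximal_of_isField _ hf))

theorem isRegularLocalRing_quotient_of_span_pair_eq (hdim : ringKrullDim A = 2) {T U : A}
    (h : Ideal.span {T, U} = maximalIdeal A) : IsRegularLocalRing (A ⧸ Ideal.span {T}) := by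
  have hT : T ∈ maximalIdeal A := h ▸ Ideal.subset_span (by simp)
  have hne : Ideal.span {T} ≠ ⊤ := by
    rw [Ne, Ideal.span_singleton_eq_top]; exact (mem_maximalIdeal T).1 hT
  have : Nontrivial (A ⧸ Ideal.span {T}) := Ideal.Quotient.nontrivial_iff.2 hne
  have : IsLocalRing (A ⧸ Ideal.span {T}) :=
    IsLocalRing.of_surjective' (Ideal.Quotient.mk _) Ideal.Quotient.mk_surjective
  apply IsRegularLocalRing.of_spanFinrank_maximalIdeal_le
  rw [ringKrullDim_quotient_span_singleton hdim (ne_zero_of_span_pair_eq hdim h) hT]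
  have hq : maximalIdeal (A ⧸ Ideal.span {T}) = Ideal.span {Ideal.Quotient.mk _ U} := by
    rw [← IsLocalRing.map_maximalIdeal_of_surjective _ (Ideal.Quotient.mk_surjective
      (I := Ideal.span {T})), ← h, Ideal.map_span, Set.image_insert_eq]
    have : Ideal.Quotient.mk (Ideal.span {T}) T = 0 :=
      Ideal.Quotient.eq_zero_iff_mem.2 (Ideal.mem_span_singleton_self _)
    rw [this, Ideal.span_insert_zero, Set.image_singleton]
  rw [hq]
  have h1 := Submodule.spanFinrank_span_le_ncard_of_finite (R := A ⧸ Ideal.span {T})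
    (Set.finite_singleton (Ideal.Quotient.mk (Ideal.span {T}) U))
  rw [Set.ncard_singleton] at h1
  exact_mod_cast h1

theorem prime_of_span_pair_eq (hdim : ringKrullDim A = 2) {T U : A}
    (h : Ideal.span {T, U} = maximalIdeal A) : Prime T := by
  have := isRegularLocalRing_quotient_of_span_pair_eq hdim h
  have := isDomain_of_isRegularLocalRing (A ⧸ Ideal.span {T})
  exact (Ideal.span_singleton_prime (ne_zero_of_span_pair_eq hdim h)).1
    ((Ideal.Quotient.isDomain_iff_prime _).1 this)

/-- A curve not containing `T` is cut out by one equation: its ideal `P` satisfies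
`P ∩ (T) = T P`, the image of `P` in the discrete valuation ring `A/(T)` is principal, and
Nakayama's lemma lifts the generator. -/
theorem isPrincipal_of_notMem (hdim : ringKrullDim A = 2) {T U : A}
    (h : Ideal.span {T, U} = maximalIdeal A) (P : Ideal A) [P.IsPrime] (hT : T ∉ P) :
    ∃ f, P = Ideal.span {f} := by
  have := isRegularLocalRing_quotient_of_span_pair_eq hdim h
  have := isDomain_of_isRegularLocalRing (A ⧸ Ideal.span {T})
  have hTm : T ∈ maximalIdeal A := h ▸ Ideal.subset_span (by simp)
  have : IsDiscreteValuationRing (A ⧸ Ideal.span {T}) :=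
    isDiscreteValuationRing_of_isRegularLocalRing _
      (ringKrullDim_quotient_span_singleton hdim (ne_zero_of_span_pair_eq hdim h) hTm)
  obtain ⟨g, hg⟩ := (IsPrincipalIdealRing.principal (P.map (Ideal.Quotient.mk (Ideal.span {T}))))
  have hgm : g ∈ P.map (Ideal.Quotient.mk (Ideal.span {T})) := by
    rw [hg]; exact Submodule.mem_span_singleton_self g
  obtain ⟨f, hf, rfl⟩ := (Ideal.mem_map_iff_of_surjective _ Ideal.Quotient.mk_surjective).1 hgm
  refine ⟨f, le_antisymm ?_ ((Ideal.span_singleton_le_iff_mem _).2 hf)⟩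
  refine Submodule.le_of_le_smul_of_le_jacobson_bot (I := Ideal.span {T})
    P.fg_of_isNoetherianRing (((Ideal.span_singleton_le_iff_mem _).2 hTm).trans
          (IsLocalRing.maximalIdeal_le_jacobson _)) ?_
  intro y hy
  have hy' : Ideal.Quotient.mk (Ideal.span {T}) y ∈ P.map (Ideal.Quotient.mk (Ideal.span {T})) :=
    Ideal.mem_map_of_mem _ hy
  rw [hg] at hy'
  obtain ⟨b, hb⟩ := Submodule.mem_span_singleton.1 hy'
  obtain ⟨a, rfl⟩ := Ideal.Quotient.mk_surjective b
  rw [smul_eq_mul, ← map_mul, Ideal.Quotient.mk_eq_mk_iff_sub_mem,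
    Ideal.mem_span_singleton'] at hb
  obtain ⟨c, hc⟩ := hb
  have hcP : c ∈ P := by
    refine (Ideal.IsPrime.mem_or_mem ‹P.IsPrime› (?_ : c * T ∈ P)).resolve_right hT
    rw [hc]; exact P.sub_mem (P.mul_mem_left _ hf) hy
  have : y = a * f + T * (-c) := by linear_combination hc
  rw [this]
  refine Submodule.add_mem_sup (Ideal.mul_mem_left _ _ (Ideal.mem_span_singleton_self f)) ?_
  exact Ideal.mul_mem_mul (Ideal.mem_span_singleton_self T) (P.neg_mem hcP)

theorem eq_span_or_eq_maximalIdeal_of_mem (hdim : ringKrullDim A = 2) {T U : A}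
    (h : Ideal.span {T, U} = maximalIdeal A) (P : Ideal A) [P.IsPrime] (hT : T ∈ P) :
    P = Ideal.span {T} ∨ P = maximalIdeal A := by
  have := isRegularLocalRing_quotient_of_span_pair_eq hdim h
  have := isDomain_of_isRegularLocalRing (A ⧸ Ideal.span {T})
  have hTm : T ∈ maximalIdeal A := h ▸ Ideal.subset_span (by simp)
  have : IsDiscreteValuationRing (A ⧸ Ideal.span {T}) :=
    isDiscreteValuationRing_of_isRegularLocalRing _
      (ringKrullDim_quotient_span_singleton hdim (ne_zero_of_span_pair_eq hdim h) hTm)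
  have hle : Ideal.span {T} ≤ P := (Ideal.span_singleton_le_iff_mem _).2 hT
  have hp : (P.map (Ideal.Quotient.mk (Ideal.span {T}))).IsPrime :=
    Ideal.isPrime_map_quotientMk_of_isPrime hle
  have hcomap : (P.map (Ideal.Quotient.mk (Ideal.span {T}))).comap (Ideal.Quotient.mk _) = P := by
    rw [Ideal.comap_map_of_surjective _ Ideal.Quotient.mk_surjective, ← RingHom.ker_eq_comap_bot,
      Ideal.mk_ker, sup_eq_left.2 hle]
  by_cases hb : P.map (Ideal.Quotient.mk (Ideal.span {T})) = ⊥
  · left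
    rw [hb, ← RingHom.ker_eq_comap_bot, Ideal.mk_ker] at hcomap
    exact hcomap.symm
  · right
    have hm := hp.isMaximal hb
    have := Ideal.comap_isMaximal_of_surjective (Ideal.Quotient.mk (Ideal.span {T}))
      Ideal.Quotient.mk_surjective (K := P.map (Ideal.Quotient.mk (Ideal.span {T})))
    rw [hcomap] at this
    exact IsLocalRing.eq_maximalIdeal this

/-- A two-dimensional regular local ring is factorial, by Kaplansky's criterion. -/
theorem uniqueFactorizationMonoid_of_ringKrullDim_eq_two (hdim : ringKrullDim A = 2) :
    UniqueFactorizationMonoid A := by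
  obtain ⟨T, U, h⟩ := exists_span_pair_eq hdim
  refine UniqueFactorizationMonoid.iff_exists_prime_mem_of_isPrime.2 fun P hP hPp => ?_
  by_cases hT : T ∈ P
  · exact ⟨T, hT, prime_of_span_pair_eq hdim h⟩
  · obtain ⟨f, rfl⟩ := isPrincipal_of_notMem hdim h P hT
    have hf : f ≠ 0 := by rintro rfl; simp at hP
    exact ⟨f, Ideal.mem_span_singleton_self f, (Ideal.span_singleton_prime hf).1 hPp⟩

theorem mem_Spec₁_iff (hdim : ringKrullDim A = 2) (P : PrimeSpectrum A) :
    P ∈ Spec₁ A ↔ P.asIdeal ≠ ⊥ ∧ P.asIdeal ≠ maximalIdeal A := by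
  constructor
  · intro h
    change ringKrullDim _ = 1 at h
    refine ⟨fun h0 => ?_, fun hm => ?_⟩
    · rw [h0, ringKrullDim_eq_of_ringEquiv (RingEquiv.quotientBot A), hdim] at h
      exact absurd h (by norm_num)
    · have hm' : P.asIdeal.IsMaximal := hm ▸ inferInstance
      let := Ideal.Quotient.field P.asIdeal
      rw [ringKrullDim_eq_zero_of_isField (Field.toIsField _)] at h
      exact absurd h (by norm_num)
  · rintro ⟨h0, hm⟩
    exact ringKrullDim_quotient_eq_one hdim h0 hm

theorem exists_eq_span_of_mem_Spec₁ (hdim : ringKrullDim A = 2) {P : PrimeSpectrum A}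
    (hP : P ∈ Spec₁ A) : ∃ f, Prime f ∧ P.asIdeal = Ideal.span {f} := by
  obtain ⟨T, U, h⟩ := exists_span_pair_eq hdim
  obtain ⟨h0, hm⟩ := (mem_Spec₁_iff hdim P).1 hP
  obtain ⟨f, hf⟩ : ∃ f, P.asIdeal = Ideal.span {f} := by
    by_cases hT : T ∈ P.asIdeal
    · exact ⟨T, (eq_span_or_eq_maximalIdeal_of_mem hdim h _ hT).resolve_right hm⟩
    · exact isPrincipal_of_notMem hdim h _ hT
  have hf0 : f ≠ 0 := by rintro rfl; simp [hf] at h0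
  exact ⟨f, (Ideal.span_singleton_prime hf0).1 (hf ▸ P.2), hf⟩

end DimTwo

/-! ### Artin–Schreier extensions of fields -/

section ArtinSchreierField

open Polynomial IntermediateField

theorem isIntegral_of_pow_sub_self {E F : Type*} [CommRing E] [Nontrivial E] [CommRing F]
    [Algebra E F] {p : ℕ} [Fact p.Prime] {x : F} {α : E} (hx : x ^ p - x = algebraMap E F α) :
    IsIntegral E x := by
  have hp := (Fact.out : p.Prime).one_lt
  refine ⟨X ^ p - (X + C α), monic_X_pow_sub ?_, ?_⟩
  · refine (degree_X_add_C α).trans_lt ?_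
    exact_mod_cast hp
  · simp [← hx]

variable {E F : Type*} [Field E] [Field F] [Algebra E F] {p : ℕ} [Fact p.Prime]
  {x : F} {α : E}

theorem finiteDimensional_of_pow_sub_self (hx : x ^ p - x = algebraMap E F α)
    (hgen : E⟮x⟯ = ⊤) : FiniteDimensional E F := by
  have h := adjoin.finiteDimensional (isIntegral_of_pow_sub_self hx)
  rw [hgen] at h
  exact (IntermediateField.topEquiv (F := E) (E := F)).toLinearEquiv.finiteDimensional

theorem finrank_le_of_pow_sub_self (hx : x ^ p - x = algebraMap E F α)
    (hgen : E⟮x⟯ = ⊤) : Module.finrank E F ≤ p := by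
  have hp := (Fact.out : p.Prime).one_lt
  have h := adjoin.finrank (isIntegral_of_pow_sub_self hx)
  rw [hgen, IntermediateField.finrank_top'] at h
  rw [h]
  have hm : (X ^ p - (X + C α) : E[X]).Monic :=
    monic_X_pow_sub ((degree_X_add_C α).trans_lt (by exact_mod_cast hp))
  have h2 := natDegree_le_of_dvd (minpoly.dvd E x (p := X ^ p - (X + C α)) (by simp [← hx]))
    hm.ne_zero
  refine h2.trans ?_
  rw [natDegree_sub_eq_left_of_natDegree_lt]
  · simp
  · rw [natDegree_X_add_C]; simpa using hp

theorem isGalois_of_pow_sub_self [CharP E p] (hx : x ^ p - x = algebraMap E F α)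
    (hgen : E⟮x⟯ = ⊤) : IsGalois E F := by
  have hp := (Fact.out : p.Prime).one_lt
  have := finiteDimensional_of_pow_sub_self hx hgen
  have : CharP F p := charP_of_injective_algebraMap (algebraMap E F).injective p
  let f : E[X] := X ^ p - X - C α
  have hroot : aeval x f = 0 := by simp [f, hx]
  have hm : f ≠ 0 := by
    have : (X ^ p - (X + C α) : E[X]).Monic :=
      monic_X_pow_sub ((degree_X_add_C α).trans_lt (by exact_mod_cast hp))
    have h2 := this.ne_zero
    rwa [← sub_sub] at h2
  have hsep : f.Separable := by
    rw [separable_def]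
    have : derivative f = -1 := by simp [f, derivative_X_pow]
    rw [this]
    exact ⟨0, -1, by simp⟩
  have hmap : f.map (algebraMap E F) = (X ^ p - X : F[X]).comp (X - C x) := by
    simp only [f, Polynomial.map_sub, Polynomial.map_pow, map_X, map_C, ← hx, sub_comp, pow_comp,
      X_comp]
    rw [sub_pow_char]
    simp only [map_sub, map_pow]
    ring
  have hsplit : (f.map (algebraMap E F)).Splits := by
    rw [hmap]
    have h0 : ((X ^ p - X : (ZMod p)[X]).map (ZMod.castHom (dvd_refl p) F)).Splits :=
      (GaloisField.splits_zmod_X_pow_sub_X p).map _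
    have h1 : ((X ^ p - X : (ZMod p)[X]).map (ZMod.castHom (dvd_refl p) F)) = X ^ p - X := by
      simp
    rw [h1] at h0
    exact h0.comp_X_sub_C x
  have : f.IsSplittingField E F := by
    refine ⟨hsplit, ?_⟩
    have h1 : Algebra.adjoin E {x} = ⊤ := by
      rw [← IntermediateField.adjoin_simple_toSubalgebra_of_isAlgebraic
        (isIntegral_of_pow_sub_self hx).isAlgebraic, hgen]; rfl
    rw [eq_top_iff, ← h1]
    refine Algebra.adjoin_mono ?_
    rw [Set.singleton_subset_iff, mem_rootSet]
    exact ⟨hm, hroot⟩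
  exact IsGalois.of_separable_splitting_field hsep

/-- `σ x - x` is fixed by Frobenius. -/
theorem aut_apply_sub_pow [CharP E p] (hx : x ^ p - x = algebraMap E F α) (σ : Gal(F/E)) :
    (σ x - x) ^ p = σ x - x := by
  have : CharP F p := charP_of_injective_algebraMap (algebraMap E F).injective p
  have h := congrArg σ hx
  rw [map_sub, map_pow, σ.commutes, ← hx] at h
  rw [sub_pow_char]
  linear_combination h

theorem aut_eq_one_of_apply_eq (hx : x ^ p - x = algebraMap E F α)
    (hgen : E⟮x⟯ = ⊤) (σ : Gal(F/E)) (h : σ x = x) : σ = 1 := by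
  have h1 : Algebra.adjoin E {x} = ⊤ := by
    rw [← IntermediateField.adjoin_simple_toSubalgebra_of_isAlgebraic
      (isIntegral_of_pow_sub_self hx).isAlgebraic, hgen]; rfl
  have : (σ : F →ₐ[E] F) = AlgHom.id E F := AlgHom.ext_of_adjoin_eq_top h1 (by
    intro y hy; rw [Set.mem_singleton_iff.1 hy]; exact h)
  ext y
  exact congrArg (fun f : F →ₐ[E] F => f y) this

end ArtinSchreierField

/-! ### The ramification jump of an Artin–Schreier extension of a discrete valuation ring -/

section DVR

open IsLocalRing IntermediateField

variable {R E F : Type*} [CommRing R] [Field E] [Field F]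
  [Algebra R E] [Algebra R F] [Algebra E F] [IsScalarTower R E F]
  {p : ℕ}

theorem exists_ne_one_of_card_eq {G : Type*} [Group G] {p : ℕ} [Fact p.Prime] {H : Subgroup G}
    (h : Nat.card H = p) : ∃ σ ∈ H, σ ≠ 1 := by
  have hp := (Fact.out : p.Prime)
  have : Finite H := Nat.finite_of_card_ne_zero (h ▸ hp.ne_zero)
  have hne : Nontrivial H := Finite.one_lt_card_iff_nontrivial.1 (h ▸ hp.one_lt)
  obtain ⟨⟨σ, hσ⟩, hσ1⟩ := exists_ne (1 : H)
  exact ⟨σ, hσ, fun h => hσ1 (Subtype.ext h)⟩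

theorem mem_lowerRamificationGroup_iff (M : Ideal (integralClosure R F)) (i : ℕ) (σ : Gal(F/E)) :
    σ ∈ lowerRamificationGroup R E F M i ↔ ∀ c : integralClosure R F, σ • c - c ∈ M ^ (i + 1) :=
  Iff.rfl

variable [IsDomain R] [IsDiscreteValuationRing R] [IsFractionRing R E] [Fact p.Prime] [CharP R p]
  {x : F} {α : E}

/-- If the right hand side is integral, the jump is zero: a nontrivial automorphism moves the
integral element `x` by a unit. -/
theorem ramificationJump_eq_zero (hx : x ^ p - x = algebraMap E F α) (hgen : E⟮x⟯ = ⊤)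
    {r : R} (hr : algebraMap R E r = α) : ramificationJump R E F p = 0 := by
  have : CharP E p := charP_of_injective_algebraMap (IsFractionRing.injective R E) p
  have : sSup {i : ℕ | ∃ M : Ideal (integralClosure R F), M.IsMaximal ∧
      Nat.card (lowerRamificationGroup R E F M i) = p} = 0 := by
    suffices h : {i : ℕ | ∃ M : Ideal (integralClosure R F), M.IsMaximal ∧
      Nat.card (lowerRamificationGroup R E F M i) = p} = ∅ by rw [h]; simp
    rw [Set.eq_empty_iff_forall_notMem]
    rintro i ⟨M, hM, hc⟩
    obtain ⟨σ, hσ, hσ1⟩ := exists_ne_one_of_card_eq hc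
    have hσ1 : σ x ≠ x := fun h => hσ1 (aut_eq_one_of_apply_eq hx hgen σ h)
    have hint : IsIntegral R x := isIntegral_of_pow_sub_self (α := r) (p := p) (by
      rw [hx, ← hr, IsScalarTower.algebraMap_apply R E F])
    have hmem := (mem_lowerRamificationGroup_iff M i σ).1 hσ ⟨x, hint⟩
    have hM' : σ • (⟨x, hint⟩ : integralClosure R F) - ⟨x, hint⟩ ∈ M :=
      Ideal.pow_le_self (Nat.succ_ne_zero i) hmem
    have hpow : (σ • (⟨x, hint⟩ : integralClosure R F) - ⟨x, hint⟩) ^ (p - 1) = 1 := by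
      apply Subtype.ext
      have h1 := aut_apply_sub_pow hx σ
      have h2 : (σ x - x) ^ (p - 1) * (σ x - x) = 1 * (σ x - x) := by
        rw [← pow_succ, Nat.sub_add_cancel (Fact.out : p.Prime).one_lt.le, h1, one_mul]
      exact mul_right_cancel₀ (sub_ne_zero.2 hσ1) h2
    refine hM.ne_top ((Ideal.eq_top_iff_one _).2 ?_)
    rw [← hpow]
    exact Ideal.pow_mem_of_mem _ hM' _ (Nat.sub_pos_of_lt (Fact.out : p.Prime).one_lt)
  unfold ramificationJump
  split_ifs <;> simp [this]

end DVR

/-! ### Total ramification at poles of order prime to the characteristic -/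

section TotallyRamified

open IsLocalRing IntermediateField

variable {R E F : Type*} [CommRing R] [IsDomain R] [IsDiscreteValuationRing R] [Field E] [Field F]
  [Algebra R E] [Algebra R F] [Algebra E F] [IsScalarTower R E F] [IsFractionRing R E]
  {p : ℕ} [Fact p.Prime]

/-- Every maximal ideal of the integral closure contracts to the maximal ideal. -/
theorem algebraMap_mem_of_mem_maximalIdeal {r : R} (hr : r ∈ maximalIdeal R)
    (M : Ideal (integralClosure R F)) [M.IsMaximal] :
    algebraMap R (integralClosure R F) r ∈ M := by
  have h : (M.comap (algebraMap R (integralClosure R F))).IsMaximal :=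
    Ideal.isMaximal_comap_of_isIntegral_of_isMaximal M
  rw [← IsLocalRing.eq_maximalIdeal h] at hr
  exact hr

/-- Construction of a uniformizer of the integral closure. With `u = t ^ n α` a unit and
`z = t ^ n x`, the element `u + z` is a unit, and a product `π = x ^ a t ^ b` with
`p b = n a + 1` satisfies `π ^ p = t (u + z) ^ a`; moreover `x⁻¹` is a unit times `π ^ n`. -/
theorem exists_uniformizer [CharP R p] {x : F} {α : E} (hx : x ^ p - x = algebraMap E F α) {t u : R}
    (ht : Irreducible t) (hu : IsUnit u) {n : ℕ} (hpn : ¬ p ∣ n)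
    (hα : α * algebraMap R E t ^ n = algebraMap R E u) :
    ∃ (π e g : integralClosure R F) (a b : ℕ), IsUnit e ∧ IsUnit g ∧ ¬ p ∣ a ∧ x ≠ 0 ∧
      π ^ p = algebraMap R _ t * e ∧ x * ((π ^ n * g : integralClosure R F) : F) = 1 ∧
      (π : F) = x ^ a * algebraMap R F t ^ b := by
  have hp := (Fact.out : p.Prime)
  have hn : n ≠ 0 := by rintro rfl; simp at hpn
  have hinj : Function.Injective (algebraMap R F) := by
    rw [IsScalarTower.algebraMap_eq R E F]
    exact (algebraMap E F).injective.comp (IsFractionRing.injective R E)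
  set τ := algebraMap R F t with hτ
  have hτ0 : τ ≠ 0 := fun h => ht.ne_zero (hinj (by rw [← hτ, h, map_zero]))
  set υ := algebraMap R F u with hυ
  have hυ0 : υ ≠ 0 := fun h => hu.ne_zero (hinj (by rw [← hυ, h, map_zero]))
  have hα' : τ ^ n * (x ^ p - x) = υ := by
    rw [hx, hτ, hυ, IsScalarTower.algebraMap_apply R E F, IsScalarTower.algebraMap_apply R E F,
      ← hα, map_mul, map_pow, mul_comm]
  have hx0 : x ≠ 0 := by
    rintro rfl
    rw [zero_pow hp.ne_zero, sub_zero, mul_zero] at hα'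
    exact hυ0 hα'.symm
  -- the integral element `z = t ^ n x`
  have hz : (τ ^ n * x) ^ p = τ ^ (n * (p - 1)) * (υ + τ ^ n * x) := by
    have : n * p = n * (p - 1) + n := by
      conv_lhs => rw [← Nat.sub_add_cancel hp.one_lt.le]
      ring
    rw [← hα', mul_pow, ← pow_mul, this, pow_add]
    ring
  have hzint : IsIntegral R (τ ^ n * x) := by
    refine ⟨Polynomial.X ^ p - (Polynomial.C (t ^ (n * (p - 1))) * Polynomial.X +
      Polynomial.C (t ^ (n * (p - 1)) * u)), Polynomial.monic_X_pow_sub ?_, ?_⟩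
    · refine (Polynomial.degree_linear_le).trans_lt (by exact_mod_cast hp.one_lt)
    · simp only [Polynomial.eval₂_sub, Polynomial.eval₂_pow, Polynomial.eval₂_X,
        Polynomial.eval₂_add, Polynomial.eval₂_mul, Polynomial.eval₂_C, hz, map_mul, map_pow]
      ring
  let z : integralClosure R F := ⟨τ ^ n * x, hzint⟩
  let v : integralClosure R F := algebraMap R _ u + z
  have hzC : z ^ p = algebraMap R _ t ^ (n * (p - 1)) * v := Subtype.ext hz
  have hv : IsUnit v := by
    by_contra h
    obtain ⟨M, hM, hvM⟩ := exists_max_ideal_of_mem_nonunits h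
    have htM := algebraMap_mem_of_mem_maximalIdeal
      ((mem_maximalIdeal t).2 ht.not_isUnit) M
    have hzM : z ∈ M := by
      refine hM.isPrime.mem_of_pow_mem p ?_
      rw [hzC]
      refine Ideal.mul_mem_right _ _ (Ideal.pow_mem_of_mem _ htM _ ?_)
      exact Nat.mul_pos (Nat.pos_of_ne_zero hn) (Nat.sub_pos_of_lt hp.one_lt)
    have : algebraMap R (integralClosure R F) u ∈ M := by
      have := M.sub_mem hvM hzM
      simpa [v] using this
    exact hM.ne_top (Ideal.eq_top_of_isUnit_mem _ this (hu.map _))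
  have hv' : (v : F) = τ ^ n * x ^ p := by
    change υ + τ ^ n * x = _
    rw [← hα']; ring
  -- the exponents of the uniformizer
  obtain ⟨a, b, hab, ha⟩ : ∃ a b : ℕ, p * b = n * a + 1 ∧ ¬ p ∣ a := by
    have hcop : Nat.Coprime n p := (Nat.coprime_comm.1 ((Nat.Prime.coprime_iff_not_dvd hp).2 hpn))
    obtain ⟨c, -, hc⟩ := Nat.exists_mul_mod_eq_one_of_coprime hcop hp.one_lt
    refine ⟨c * (p - 1), ?_⟩
    have h1 : p ∣ n * (c * (p - 1)) + 1 := by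
      have h2 := Nat.div_add_mod (n * c) p
      rw [hc] at h2
      obtain ⟨m, hm⟩ : ∃ m, n * c = p * m + 1 := ⟨n * c / p, h2.symm⟩
      have h3 : n * (c * (p - 1)) + 1 = p * (m * (p - 1) + 1) := by
        obtain ⟨q, hq⟩ : ∃ q, p = q + 1 := ⟨p - 1, by have := hp.one_lt; omega⟩
        have h4 : p - 1 = q := by omega
        rw [← mul_assoc, hm, h4, hq]; ring
      exact ⟨_, h3⟩
    obtain ⟨b, hb⟩ := h1
    refine ⟨b, hb.symm, fun hd => ?_⟩
    have : p ∣ 1 := (Nat.dvd_add_right (hd.mul_left n)).1 ⟨b, hb⟩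
    exact hp.one_lt.ne' (Nat.dvd_one.1 this)
  have hπ : (x ^ a * τ ^ b) ^ p = τ * (v : F) ^ a := by
    rw [hv', mul_pow, ← pow_mul, ← pow_mul, mul_comm b p, hab, mul_pow, ← pow_mul, ← pow_mul]
    ring
  have hπint : IsIntegral R (x ^ a * τ ^ b) := by
    refine IsIntegral.of_pow hp.pos ?_
    rw [hπ]
    exact isIntegral_algebraMap.mul (v.2.pow a)
  let π : integralClosure R F := ⟨x ^ a * τ ^ b, hπint⟩
  have hπ0 : (π : F) ≠ 0 := mul_ne_zero (pow_ne_zero _ hx0) (pow_ne_zero _ hτ0)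
  obtain ⟨v', hv'1⟩ := hv.exists_right_inv
  have hvv : (v : F) * (v' : F) = 1 := congrArg Subtype.val hv'1
  have hgp : ((x * (π : F) ^ n)⁻¹) ^ p = (v' : F) ^ (1 + a * n) := by
    have h1 : (x * (π : F) ^ n) ^ p = (v : F) ^ (1 + a * n) := by
      have h2 : ((π : F) ^ n) ^ p = (τ * (v : F) ^ a) ^ n := by
        rw [← hπ, ← pow_mul, ← pow_mul, mul_comm]
      rw [mul_pow, h2, mul_pow, ← pow_mul, pow_add, pow_one, hv']
      ring
    rw [inv_pow, h1]
    exact inv_eq_of_mul_eq_one_right (by rw [← mul_pow, hvv, one_pow])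
  have hgint : IsIntegral R ((x * (π : F) ^ n)⁻¹) := by
    refine IsIntegral.of_pow hp.pos ?_
    rw [hgp]; exact v'.2.pow _
  refine ⟨π, v ^ a, ⟨(x * (π : F) ^ n)⁻¹, hgint⟩, a, b, hv.pow a, ?_, ha, hx0, Subtype.ext hπ, ?_,
    rfl⟩
  · have : IsUnit ((⟨(x * (π : F) ^ n)⁻¹, hgint⟩ : integralClosure R F) ^ p) := by
      have h1 : (⟨(x * (π : F) ^ n)⁻¹, hgint⟩ : integralClosure R F) ^ p = v' ^ (1 + a * n) :=
        Subtype.ext hgp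
      rw [h1]
      exact (IsUnit.of_mul_eq_one_right v hv'1).pow _
    exact (isUnit_pow_iff hp.ne_zero).1 this
  · change x * ((π : F) ^ n * (x * (π : F) ^ n)⁻¹) = 1
    field_simp

/-- If the integral closure `C` has an element `π` whose `p`-th power is a uniformizer of `R` up to
a unit and the degree is at most `p`, then `C` is totally ramified: the fundamental identity
`∑ e f = [F : E]` leaves room for one maximal ideal only, generated by `π`. -/
theorem totallyRamified_of_pow_eq [FiniteDimensional E F] [Algebra.IsSeparable E F]
    (hrank : Module.finrank E F ≤ p) {t : R} (ht : Irreducible t)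
    {π e : integralClosure R F} (he : IsUnit e) (hπ : π ^ p = algebraMap R _ t * e) :
    (maximalIdeal R).ramificationIdxIn (integralClosure R F) = p ∧ Module.finrank E F = p ∧
    (Ideal.span {π}).IsMaximal ∧
    ∀ M : Ideal (integralClosure R F), M.IsMaximal → M = Ideal.span {π} := by
  have hp := (Fact.out : p.Prime)
  have : IsDedekindDomain (integralClosure R F) := integralClosure.isDedekindDomain R E F
  have : Module.Finite R (integralClosure R F) := IsIntegralClosure.finite R E F _
  have hinj : Function.Injective (algebraMap R F) := by
    rw [IsScalarTower.algebraMap_eq R E F]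
    exact (algebraMap E F).injective.comp (IsFractionRing.injective R E)
  have : FaithfulSMul R F := (faithfulSMul_iff_algebraMap_injective R F).2 hinj
  have : Module.IsTorsionFree R (integralClosure R F) := inferInstance
  have : IsFractionRing (integralClosure R F) F :=
    integralClosure.isFractionRing_of_finite_extension E F
  have hrank' : Module.finrank R (integralClosure R F) = Module.finrank E F :=
    (IsFractionRing.finrank_eq R E (integralClosure R F) F).symm
  have hspan : (maximalIdeal R).map (algebraMap R (integralClosure R F)) =
      Ideal.span {algebraMap R (integralClosure R F) t} := by
    rw [(IsDiscreteValuationRing.irreducible_iff_uniformizer t).1 ht, Ideal.map_span,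
      Set.image_singleton]
  have hspan' : (maximalIdeal R).map (algebraMap R (integralClosure R F)) =
      Ideal.span {π} ^ p := by
    rw [hspan, Ideal.span_singleton_pow, hπ, Ideal.span_singleton_mul_right_unit he]
  have ht0 : algebraMap R (integralClosure R F) t ≠ 0 := by
    rw [Ne, FaithfulSMul.algebraMap_eq_zero_iff]; exact ht.ne_zero
  have hne : (maximalIdeal R).map (algebraMap R (integralClosure R F)) ≠ ⊥ := by
    rw [hspan, Ne, Ideal.span_singleton_eq_bot]; exact ht0
  have hmem : ∀ M : Ideal (integralClosure R F), M.IsPrime → M.LiesOver (maximalIdeal R) →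
      π ∈ M := by
    intro M hM hMo
    refine hM.mem_of_pow_mem p ?_
    rw [hπ]
    refine M.mul_mem_right _ ?_
    have : t ∈ M.comap (algebraMap R (integralClosure R F)) := by
      have h1 := hMo.over
      rw [Ideal.under_def] at h1
      rw [← h1]; exact (mem_maximalIdeal t).2 ht.not_isUnit
    exact this
  have hdvd : ∀ M : Ideal (integralClosure R F), M.IsPrime → M.LiesOver (maximalIdeal R) →
      ∀ k, M ^ k ∣ (maximalIdeal R).map (algebraMap R (integralClosure R F)) →
        k ≤ M.ramificationIdx R := by
    intro M hM hMo k hk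
    rw [Ideal.IsDedekindDomain.ramificationIdx_eq_multiplicity (maximalIdeal R) M hne]
    refine FiniteMultiplicity.le_multiplicity_of_pow_dvd ?_ hk
    refine FiniteMultiplicity.of_not_isUnit ?_ hne
    rw [Ideal.isUnit_iff]; exact hM.ne_top
  have hep : ∀ M : Ideal (integralClosure R F), M.IsPrime → M.LiesOver (maximalIdeal R) →
      p ≤ M.ramificationIdx R := by
    intro M hM hMo
    refine hdvd M hM hMo p ?_
    rw [hspan']
    exact pow_dvd_pow_of_dvd (Ideal.dvd_span_singleton.2 (hmem M hM hMo)) p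
  have hfin : Fintype ((maximalIdeal R).primesOver (integralClosure R F)) :=
    (Algebra.QuasiFinite.finite_primesOver _).fintype
  have hsum := Ideal.sum_ramification_inertia_eq_finrank (maximalIdeal R) (integralClosure R F)
  rw [hrank'] at hsum
  have hterm : ∀ q : (maximalIdeal R).primesOver (integralClosure R F),
      p ≤ q.1.ramificationIdx R * q.1.inertiaDeg R := fun q =>
    (hep q.1 q.2.1 q.2.2).trans (Nat.le_mul_of_pos_right _ (by
      have := q.2.1; exact Ideal.inertiaDeg_pos _ _))
  have hcard : Fintype.card ((maximalIdeal R).primesOver (integralClosure R F)) ≤ 1 := by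
    have h1 := Finset.card_nsmul_le_sum Finset.univ _ p (fun q _ => hterm q)
    rw [hsum, smul_eq_mul] at h1
    exact Nat.le_of_mul_le_mul_right ((h1.trans hrank).trans (one_mul p).ge) hp.pos
  have hsub := Fintype.card_le_one_iff.1 hcard
  have hle : ∀ M : Ideal (integralClosure R F), M.IsPrime → M.LiesOver (maximalIdeal R) →
      M.ramificationIdx R = p ∧ Module.finrank E F = p := by
    intro M hM hMo
    have h1 : M.ramificationIdx R * M.inertiaDeg R ≤ Module.finrank E F := by
      rw [← hsum]
      exact Finset.single_le_sum (f := fun q : (maximalIdeal R).primesOver (integralClosure R F) =>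
        q.1.ramificationIdx R * q.1.inertiaDeg R) (fun _ _ => Nat.zero_le _)
        (Finset.mem_univ ⟨M, hM, hMo⟩)
    have h2 := hterm ⟨M, hM, hMo⟩
    have h3 := hep M hM hMo
    have h4 : 0 < M.inertiaDeg R := Ideal.inertiaDeg_pos _ _
    have h5 := Nat.le_mul_of_pos_right (M.ramificationIdx R) h4
    dsimp only at h2
    omega
  have hover : ∀ M : Ideal (integralClosure R F), M.IsMaximal → M.LiesOver (maximalIdeal R) := by
    intro M hM
    refine ⟨?_⟩
    have h : (M.comap (algebraMap R (integralClosure R F))).IsMaximal :=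
      Ideal.isMaximal_comap_of_isIntegral_of_isMaximal M
    rw [Ideal.under_def, IsLocalRing.eq_maximalIdeal h]
  have huniq : ∀ M M' : Ideal (integralClosure R F), M.IsMaximal → M'.IsMaximal → M = M' :=
    fun M M' hM hM' => congrArg Subtype.val
      (hsub ⟨M, hM.isPrime, hover M hM⟩ ⟨M', hM'.isPrime, hover M' hM'⟩)
  obtain ⟨M, hM⟩ := Ideal.exists_maximal (integralClosure R F)
  have hMπ : M = Ideal.span {π} := by
    obtain ⟨J, hJ⟩ := Ideal.dvd_span_singleton.2 (hmem M hM.isPrime (hover M hM))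
    by_cases hJt : J = ⊤
    · rw [hJ, hJt, Ideal.mul_top]
    · exfalso
      obtain ⟨M', hM', hJM'⟩ := Ideal.exists_le_maximal J hJt
      rw [huniq M' M hM' hM] at hJM'
      have h1 : M ^ (2 * p) ∣ (maximalIdeal R).map (algebraMap R (integralClosure R F)) := by
        rw [hspan', pow_mul, hJ, pow_two]
        exact pow_dvd_pow_of_dvd (mul_dvd_mul_left _ (Ideal.dvd_iff_le.2 hJM')) p
      have h2 := hdvd M hM.isPrime (hover M hM) _ h1
      rw [(hle M hM.isPrime (hover M hM)).1] at h2
      have := hp.pos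
      omega
  refine ⟨?_, (hle M hM.isPrime (hover M hM)).2, hMπ ▸ hM, fun M' hM' => ?_⟩
  · have hex : ∃ P : Ideal (integralClosure R F), P.IsPrime ∧ P.LiesOver (maximalIdeal R) :=
      ⟨M, hM.isPrime, hover M hM⟩
    rw [Ideal.ramificationIdxIn, dif_pos hex]
    exact (hle _ hex.choose_spec.1 hex.choose_spec.2).1
  · rw [← hMπ]; exact huniq _ _ hM' hM

/-- When the residue field is algebraically closed, the residue field of the integral closure does
not grow. -/
theorem exists_sub_algebraMap_mem [IsAlgClosed (ResidueField R)] (M : Ideal (integralClosure R F))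
    [M.IsMaximal] (c : integralClosure R F) : ∃ r : R, c - algebraMap R _ r ∈ M := by
  let f : ResidueField R →+* integralClosure R F ⧸ M :=
    Ideal.Quotient.lift (maximalIdeal R)
      ((Ideal.Quotient.mk M).comp (algebraMap R (integralClosure R F))) (fun r hr => by
        rw [RingHom.comp_apply, Ideal.Quotient.eq_zero_iff_mem]
        exact algebraMap_mem_of_mem_maximalIdeal hr M)
  have hf : f.IsIntegral := by
    refine RingHom.IsIntegral.tower_top (residue R) f ?_
    have h1 : f.comp (residue R) =
        (Ideal.Quotient.mk M).comp (algebraMap R (integralClosure R F)) := by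
      ext r; rfl
    rw [h1]
    refine RingHom.IsIntegral.trans _ _ ?_ (RingHom.isIntegral_of_surjective _
      Ideal.Quotient.mk_surjective)
    exact algebraMap_isIntegral_iff.2 inferInstance
  obtain ⟨s, hs⟩ := (IsAlgClosed.ringHom_bijective_of_isIntegral f hf).2 (Ideal.Quotient.mk M c)
  obtain ⟨r, rfl⟩ := Ideal.Quotient.mk_surjective s
  refine ⟨r, ?_⟩
  rw [← Ideal.Quotient.mk_eq_mk_iff_sub_mem, ← hs]
  rfl

/-- A nontrivial automorphism moves the uniformizer `π` by exactly `π ^ (n + 1)`. -/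
theorem exists_smul_sub_eq [CharP R p] {x : F} {α : E} (hx : x ^ p - x = algebraMap E F α)
    (hgen : E⟮x⟯ = ⊤) {t : R} {n a b : ℕ} (hpn : n ≠ 0)
    {π g : integralClosure R F} (hM : ∀ M : Ideal (integralClosure R F), M.IsMaximal → π ∈ M)
    (hg : IsUnit g) (ha : ¬ p ∣ a) (hxg : x * ((π ^ n * g : integralClosure R F) : F) = 1)
    (hπ : (π : F) = x ^ a * algebraMap R F t ^ b) (σ : Gal(F/E)) (hσ : σ ≠ 1) :
    ∃ e : integralClosure R F, IsUnit e ∧ σ • π - π = π ^ (n + 1) * e := by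
  have hp := (Fact.out : p.Prime)
  have : CharP E p := charP_of_injective_algebraMap (IsFractionRing.injective R E) p
  have : CharP F p := charP_of_injective_algebraMap (algebraMap E F).injective p
  have : CharP (integralClosure R F) p :=
    ⟨fun m => by rw [← CharP.cast_eq_zero_iff F p m, ← Subtype.val_inj]; rfl⟩
  have hk := aut_apply_sub_pow hx σ
  have hk0 : σ x - x ≠ 0 := fun h => hσ (aut_eq_one_of_apply_eq hx hgen σ (sub_eq_zero.1 h))
  have hkint : IsIntegral R (σ x - x) := by
    refine isIntegral_of_pow_sub_self (α := 0) (p := p) ?_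
    rw [hk, sub_self, map_zero]
  let k : integralClosure R F := ⟨σ x - x, hkint⟩
  have hku : IsUnit k := by
    refine IsUnit.of_mul_eq_one (k ^ (p - 2)) (Subtype.ext ?_)
    change (σ x - x) * (σ x - x) ^ (p - 2) = 1
    have h1 : (σ x - x) * (σ x - x) ^ (p - 2) * (σ x - x) = 1 * (σ x - x) := by
      rw [← pow_succ', ← pow_succ, one_mul]
      conv_rhs => rw [← hk]
      congr 1
      have := hp.two_le
      omega
    exact mul_right_cancel₀ hk0 h1
  set w : integralClosure R F := π ^ n * g with hw
  have hwx : (w : F) * x = 1 := by rw [mul_comm]; exact hxg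
  have hsmul : σ • π = π * (1 + k * w) ^ a := by
    apply Subtype.ext
    change σ (π : F) = (π : F) * (1 + (σ x - x) * (w : F)) ^ a
    have h1 : x * (1 + (σ x - x) * (w : F)) = σ x := by linear_combination (σ x - x) * hwx
    rw [hπ, map_mul, map_pow, map_pow, IsScalarTower.algebraMap_apply R E F, σ.commutes]
    conv_lhs => rw [← h1, mul_pow]
    ring
  have hgeom := mul_geom_sum (1 + k * w) a
  have hsum : IsUnit (∑ i ∈ Finset.range a, (1 + k * w) ^ i) := by
    by_contra h
    obtain ⟨M, hMm, hvM⟩ := exists_max_ideal_of_mem_nonunits h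
    have hwM : w ∈ M := M.mul_mem_right _ (Ideal.pow_mem_of_mem _ (hM M hMm) _
      (Nat.pos_of_ne_zero hpn))
    have haM : (a : integralClosure R F) ∈ M := by
      rw [← Ideal.Quotient.eq_zero_iff_mem] at hvM hwM ⊢
      simpa [hwM] using hvM
    -- `a` is prime to `p`, hence invertible
    have hpM : ((p : ℕ) : integralClosure R F) ∈ M := by simp
    have h1 : ((Nat.gcd a p : ℕ) : integralClosure R F) ∈ M := by
      have h2 := Nat.gcd_eq_gcd_ab a p
      have h3 : ((Nat.gcd a p : ℕ) : integralClosure R F) =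
          (a : integralClosure R F) * (Nat.gcdA a p : ℤ) + (p : integralClosure R F) *
          (Nat.gcdB a p : ℤ) := by exact_mod_cast congrArg (Int.cast : ℤ → integralClosure R F) h2
      rw [h3]
      exact M.add_mem (M.mul_mem_right _ haM) (M.mul_mem_right _ hpM)
    have h4 : Nat.gcd a p = 1 := Nat.coprime_comm.1 ((Nat.Prime.coprime_iff_not_dvd hp).2 ha)
    rw [h4, Nat.cast_one] at h1
    exact hMm.ne_top ((Ideal.eq_top_iff_one _).2 h1)
  refine ⟨g * k * ∑ i ∈ Finset.range a, (1 + k * w) ^ i, (hg.mul hku).mul hsum, ?_⟩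
  rw [hsmul]
  linear_combination (-π) * hgeom + (π * k * ∑ i ∈ Finset.range a, (1 + k * w) ^ i) * hw

/-- The jump of a totally ramified Artin–Schreier extension is the pole order of the right hand
side, if that is prime to `p`. -/
theorem ramificationJump_eq [CharP R p] [IsAlgClosed (ResidueField R)] {x : F} {α : E}
    (hx : x ^ p - x = algebraMap E F α) (hgen : E⟮x⟯ = ⊤) {t u : R}
    (ht : Irreducible t) (hu : IsUnit u) {n : ℕ} (hpn : ¬ p ∣ n)
    (hα : α * algebraMap R E t ^ n = algebraMap R E u) : ramificationJump R E F p = n := by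
  have hp := (Fact.out : p.Prime)
  have : CharP E p := charP_of_injective_algebraMap (IsFractionRing.injective R E) p
  have hn : n ≠ 0 := by rintro rfl; simp at hpn
  have := finiteDimensional_of_pow_sub_self hx hgen
  have := isGalois_of_pow_sub_self hx hgen
  obtain ⟨π, e, g, a, b, he, hg, ha, hx0, hπ, hxg, hπx⟩ :=
    exists_uniformizer hx ht hu hpn hα
  obtain ⟨hram, hfr, hmax, huniq⟩ :=
    totallyRamified_of_pow_eq (finrank_le_of_pow_sub_self hx hgen) ht he hπ
  have hmem : ∀ M : Ideal (integralClosure R F), M.IsMaximal → π ∈ M := fun M hM => by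
    rw [huniq M hM]; exact Ideal.mem_span_singleton_self π
  have hmove := exists_smul_sub_eq hx hgen hn hmem hg ha hxg hπx
  have hπ0 : π ≠ 0 := by
    rintro rfl
    rw [zero_pow hn, zero_mul] at hxg
    simp at hxg
  have hπu : ¬ IsUnit π := fun h => hmax.ne_top (Ideal.span_singleton_eq_top.2 h)
  rw [ramificationJump, if_pos hram]
  refine IsGreatest.csSup_eq ⟨⟨Ideal.span {π}, hmax, ?_⟩, ?_⟩
  · have htop : lowerRamificationGroup R E F (Ideal.span {π}) n = ⊤ := by
      rw [eq_top_iff]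
      rintro σ -
      rw [mem_lowerRamificationGroup_iff]
      by_cases hσ : σ = 1
      · intro c; rw [hσ, one_smul, sub_self]; exact Ideal.zero_mem _
      obtain ⟨e', -, he'⟩ := hmove σ hσ
      -- Modulo elements of `R`, every `c` is a multiple of `π`, which gains one power of `π`.
      have key : ∀ N ≤ n + 1, ∀ c : integralClosure R F, σ • c - c ∈ Ideal.span {π} ^ N := by
        intro N
        induction N with
        | zero => intro _ c; simp
        | succ N ih =>
          intro hN c
          obtain ⟨r, hr⟩ := exists_sub_algebraMap_mem (Ideal.span {π}) c
          obtain ⟨y, hy⟩ := Ideal.mem_span_singleton'.1 hr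
          have hc : c = algebraMap R _ r + y * π := by rw [hy]; ring
          have h1 : σ • c - c = (σ • π - π) * σ • y + π * (σ • y - y) := by
            rw [hc, smul_add, smul_algebraMap, smul_mul']
            ring
          rw [h1]
          refine Ideal.add_mem _ (Ideal.mul_mem_right _ _ ?_) ?_
          · rw [he', Ideal.span_singleton_pow]
            exact Ideal.mul_mem_right _ _ (Ideal.mem_span_singleton.2 (pow_dvd_pow _ hN))
          · rw [pow_succ']
            exact Ideal.mul_mem_mul (Ideal.mem_span_singleton_self π) (ih (by omega) y)
      exact key (n + 1) le_rfl
    rw [htop, ← hfr, ← IsGalois.card_aut_eq_finrank]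
    exact Nat.card_congr Subgroup.topEquiv.toEquiv
  · rintro i ⟨M, hM, hc⟩
    obtain ⟨σ, hσ, hσ1⟩ := exists_ne_one_of_card_eq hc
    obtain ⟨e', he', hmv⟩ := hmove σ hσ1
    have h1 := (mem_lowerRamificationGroup_iff M i σ).1 hσ π
    rw [huniq M hM, hmv, Ideal.span_singleton_pow, Ideal.mem_span_singleton,
      IsUnit.dvd_mul_right he', pow_dvd_pow_iff hπ0 hπu] at h1
    omega

/-- A right hand side with a pole of order at most `n` has jump at most `n`, and the jump is zero or
prime to `p`: poles of order divisible by `p` can be lowered, as the residue field is perfect. -/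
theorem ramificationJump_le [CharP R p] [IsAlgClosed (ResidueField R)] {t : R}
    (ht : Irreducible t) (n : ℕ) : ∀ {x : F} {α : E} (_ : x ^ p - x = algebraMap E F α)
    (_ : E⟮x⟯ = ⊤) {u : R} (_ : α * algebraMap R E t ^ n = algebraMap R E u),
    ramificationJump R E F p ≤ n ∧
      (ramificationJump R E F p = 0 ∨ ¬ p ∣ ramificationJump R E F p) := by
  have hp := (Fact.out : p.Prime)
  have : CharP E p := charP_of_injective_algebraMap (IsFractionRing.injective R E) p
  have : CharP F p := charP_of_injective_algebraMap (algebraMap E F).injective p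
  have ht0 : algebraMap R E t ≠ 0 := fun h =>
    ht.ne_zero (IsFractionRing.injective R E (by rw [h, map_zero]))
  induction n with
  | zero =>
    intro x α hx hgen u hα
    rw [pow_zero, mul_one] at hα
    rw [ramificationJump_eq_zero hx hgen hα.symm]
    simp
  | succ n ih =>
    intro x α hx hgen u hα
    -- it suffices to lower the pole of some equivalent right hand side
    suffices h : ((¬ p ∣ n + 1) ∧ IsUnit u) ∨ ∃ (y : E) (v : R),
        (α - (y ^ p - y)) * algebraMap R E t ^ n = algebraMap R E v by
      rcases h with ⟨h1, h2⟩ | ⟨y, v, hv⟩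
      · rw [ramificationJump_eq hx hgen ht h2 h1 hα]
        exact ⟨le_rfl, Or.inr h1⟩
      · have hx' : (x - algebraMap E F y) ^ p - (x - algebraMap E F y) =
            algebraMap E F (α - (y ^ p - y)) := by
          rw [sub_pow_char, map_sub, ← hx, map_sub, map_pow]; ring
        have hgen' : E⟮x - algebraMap E F y⟯ = ⊤ := by
          rw [eq_top_iff, ← hgen, IntermediateField.adjoin_simple_le_iff]
          have h1 := add_mem (mem_adjoin_simple_self E (x - algebraMap E F y))
            (IntermediateField.algebraMap_mem E⟮x - algebraMap E F y⟯ y)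
          simpa using h1
        obtain ⟨h1, h2⟩ := ih hx' hgen' hv
        exact ⟨h1.trans (Nat.le_succ n), h2⟩
    by_cases hu : IsUnit u
    · by_cases hd : p ∣ n + 1
      · right
        obtain ⟨q, hq⟩ := hd
        have hq0 : q ≠ 0 := by rintro rfl; simp at hq
        obtain ⟨γ', hγ'⟩ := IsAlgClosed.exists_pow_nat_eq (residue R u) hp.pos
        obtain ⟨γ, rfl⟩ := IsLocalRing.residue_surjective γ'
        have hmem : u - γ ^ p ∈ maximalIdeal R := by
          rw [← IsLocalRing.residue_eq_zero_iff, map_sub, map_pow, hγ', sub_self]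
        rw [(IsDiscreteValuationRing.irreducible_iff_uniformizer t).1 ht,
          Ideal.mem_span_singleton'] at hmem
        obtain ⟨s, hs⟩ := hmem
        have hqn : q ≤ n := by
          have h2 := hp.two_le
          have : 2 * q ≤ n + 1 := hq ▸ Nat.mul_le_mul_right q h2
          omega
        refine ⟨algebraMap R E γ * ((algebraMap R E t) ^ q)⁻¹, s + γ * t ^ (n - q), ?_⟩
        have h3 : (algebraMap R E t) ^ n =
            (algebraMap R E t) ^ q * (algebraMap R E t) ^ (n - q) := by
          rw [← pow_add, Nat.add_sub_cancel' hqn]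
        have h4 : algebraMap R E u =
            algebraMap R E s * algebraMap R E t + algebraMap R E γ ^ p := by
          rw [← map_mul, hs, map_sub, map_pow]; ring
        have h5 : (((algebraMap R E t) ^ q)⁻¹) ^ p * (algebraMap R E t) ^ (n + 1) = 1 := by
          rw [hq, inv_pow, ← pow_mul, mul_comm q p, inv_mul_cancel₀ (pow_ne_zero _ ht0)]
        have h6 : ((algebraMap R E t) ^ q)⁻¹ * (algebraMap R E t) ^ n =
            (algebraMap R E t) ^ (n - q) := by
          rw [h3, inv_mul_cancel_left₀ (pow_ne_zero _ ht0)]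
        refine mul_right_cancel₀ ht0 ?_
        rw [map_add, map_mul, map_pow, mul_pow]
        rw [pow_succ] at hα h5
        linear_combination hα + h4 - (algebraMap R E γ) ^ p * h5 +
          (algebraMap R E γ) * (algebraMap R E t) * h6
      · exact Or.inl ⟨hd, hu⟩
    · right
      have hmem : u ∈ maximalIdeal R := (mem_maximalIdeal u).2 hu
      rw [(IsDiscreteValuationRing.irreducible_iff_uniformizer t).1 ht,
          Ideal.mem_span_singleton'] at hmem
      obtain ⟨s, hs⟩ := hmem
      refine ⟨0, s, mul_right_cancel₀ ht0 ?_⟩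
      rw [zero_pow hp.ne_zero, ← map_mul, hs, ← hα]
      ring

end TotallyRamified

/-! ### Artin–Schreier generators, integral closures and ramification -/

section Extension

open IntermediateField

variable {A K L : Type*} [CommRing A] [Field K] [Algebra A K]
  [Field L] [Algebra K L] [Algebra A L] [IsScalarTower A K L] {p : ℕ} [Fact p.Prime]

theorem algebraMap_mul_pow_eq {x : L} {a : K} {D c : A} (hx : x ^ p - x = algebraMap K L a)
    (hc : algebraMap A K D * a = algebraMap A K c) :
    (algebraMap A L D * x) ^ p = algebraMap A L (D ^ (p - 1)) * (algebraMap A L D * x) +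
      algebraMap A L (D ^ (p - 1) * c) := by
  have hp := (Fact.out : p.Prime)
  have hDL : algebraMap A L D * (x ^ p - x) = algebraMap A L c := by
    rw [hx, IsScalarTower.algebraMap_apply A K L, ← map_mul, hc,
      ← IsScalarTower.algebraMap_apply A K L]
  have hpp : p = (p - 1) + 1 := (Nat.sub_add_cancel hp.one_lt.le).symm
  rw [map_mul, ← hDL, map_pow, mul_pow]
  conv_lhs => rw [hpp, pow_succ (algebraMap A L D)]
  rw [← hpp]
  ring

theorem isIntegral_algebraMap_mul {x : L} {a : K} {D c : A} (hx : x ^ p - x = algebraMap K L a)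
    (hc : algebraMap A K D * a = algebraMap A K c) : IsIntegral A (algebraMap A L D * x) := by
  have hp := (Fact.out : p.Prime)
  rcases subsingleton_or_nontrivial A with hA | hA
  · have : (1 : L) = 0 := by rw [← map_one (algebraMap A L), Subsingleton.elim (1 : A) 0, map_zero]
    exact absurd this one_ne_zero
  refine ⟨Polynomial.X ^ p - (Polynomial.C (D ^ (p - 1)) * Polynomial.X +
    Polynomial.C (D ^ (p - 1) * c)), Polynomial.monic_X_pow_sub ?_, ?_⟩
  · exact (Polynomial.degree_linear_le).trans_lt (by exact_mod_cast hp.one_lt)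
  · simp only [Polynomial.eval₂_sub, Polynomial.eval₂_pow, Polynomial.eval₂_X,
      Polynomial.eval₂_add, Polynomial.eval₂_mul, Polynomial.eval₂_C, algebraMap_mul_pow_eq hx hc]
    ring

variable [IsIntegrallyClosed A] [IsFractionRing A K] [IsGalois K L]

/-- At an unramified prime the inertia group is trivial: an automorphism trivial modulo `Q`
is trivial modulo all powers of `Q`. -/
theorem aut_eq_one_of_isUnramifiedAt [IsDomain A] [IsNoetherianRing A] [FiniteDimensional K L]
    (Q : Ideal (integralClosure A L))
    [Q.IsPrime] (hQ : Algebra.IsUnramifiedAt A Q) (σ : Gal(L/K))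
    (hσ : ∀ b : integralClosure A L, σ • b - b ∈ Q) : σ = 1 := by
  have : IsNoetherianRing (integralClosure A L) := IsIntegralClosure.isNoetherianRing A K L _
  have hmap : ∀ y : Q.primeCompl, IsUnit (((Algebra.ofId _ (Localization.AtPrime Q)).restrictScalars
      A).comp (MulSemiringAction.toAlgHom A (integralClosure A L) σ) y) := by
    rintro ⟨y, hy⟩
    refine IsLocalization.map_units (M := Q.primeCompl) _ ⟨σ • y, fun h => hy ?_⟩
    have := Q.sub_mem h (hσ y)
    simpa using this
  let φ : Localization.AtPrime Q →ₐ[A] Localization.AtPrime Q := IsLocalization.liftAlgHom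
    (M := Q.primeCompl) (f := ((Algebra.ofId _ (Localization.AtPrime Q)).restrictScalars A).comp
      (MulSemiringAction.toAlgHom A (integralClosure A L) σ)) hmap
  have hφ : ∀ b : integralClosure A L, φ (algebraMap _ _ b) = algebraMap _ _ (σ • b) := fun b =>
    IsLocalization.lift_eq hmap b
  have h1 : φ = AlgHom.id A _ := by
    refine Algebra.FormallyUnramified.ext_of_iInf _
      (Ideal.iInf_pow_eq_bot_of_isLocalRing _ (IsLocalRing.maximalIdeal.isMaximal _).ne_top) ?_
    intro y
    have h2 : ((Ideal.Quotient.mk (IsLocalRing.maximalIdeal (Localization.AtPrime Q))).comp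
        (φ : Localization.AtPrime Q →+* Localization.AtPrime Q)) =
        (Ideal.Quotient.mk (IsLocalRing.maximalIdeal (Localization.AtPrime Q))) := by
      refine IsLocalization.ringHom_ext Q.primeCompl (RingHom.ext fun b => ?_)
      change Ideal.Quotient.mk _ (φ (algebraMap _ _ b)) = Ideal.Quotient.mk _ (algebraMap _ _ b)
      rw [hφ, Ideal.Quotient.mk_eq_mk_iff_sub_mem, ← map_sub,
        IsLocalization.AtPrime.to_map_mem_maximal_iff _ Q]
      exact hσ b
    exact congrArg (fun h => h y) h2
  have h3 : ∀ b : integralClosure A L, σ • b = b := fun b => by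
    have h4 := hφ b
    rw [h1] at h4
    exact (IsLocalization.injective (Localization.AtPrime Q) Q.primeCompl_le_nonZeroDivisors
      h4).symm
  have : IsFractionRing (integralClosure A L) L :=
    integralClosure.isFractionRing_of_finite_extension K L
  ext y
  obtain ⟨b, s, -, rfl⟩ := IsFractionRing.div_surjective (A := integralClosure A L) y
  have h5 : ∀ b : integralClosure A L, σ (algebraMap _ L b) = algebraMap _ L b := fun b =>
    congrArg Subtype.val (h3 b)
  rw [map_div₀, h5, h5]; rfl

variable [CharP A p]

/-- The discriminant of `1, z, …, z ^ (p - 1)`, where `z = D x`, is a power of `D` up to sign; hence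
a power of `D` is a common denominator for the coordinates of all integral elements. -/
theorem exists_pow_smul_mem_adjoin (hdeg : Module.finrank K L = p) {x : L} {a : K} {D c : A}
    (hD : D ≠ 0) (hx : x ^ p - x = algebraMap K L a) (hgen : K⟮x⟯ = ⊤)
    (hc : algebraMap A K D * a = algebraMap A K c) :
    ∃ N : ℕ, ∀ b : L, IsIntegral A b →
      D ^ N • b ∈ Algebra.adjoin A {algebraMap A L D * x} := by
  have hp := (Fact.out : p.Prime)
  have : CharP K p := charP_of_injective_algebraMap (IsFractionRing.injective A K) p
  have hfin : FiniteDimensional K L := finiteDimensional_of_pow_sub_self hx hgen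
  set z := algebraMap A L D * x with hz
  set d := algebraMap A K D with hd
  have hd0 : d ≠ 0 := fun h => hD (IsFractionRing.injective A K (by rw [← hd, h, map_zero]))
  have hdL : algebraMap A L D = algebraMap K L d := IsScalarTower.algebraMap_apply A K L D
  have hzp : z ^ p = algebraMap A L (D ^ (p - 1)) * z + algebraMap A L (D ^ (p - 1) * c) :=
    algebraMap_mul_pow_eq hx hc
  have hzint : IsIntegral A z := isIntegral_algebraMap_mul hx hc
  have hgenz : K⟮z⟯ = ⊤ := by
    rw [eq_top_iff, ← hgen, adjoin_simple_le_iff]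
    have h1 : x = algebraMap K L d⁻¹ * z := by
      rw [hz, hdL, ← mul_assoc, ← map_mul, inv_mul_cancel₀ hd0, map_one, one_mul]
    rw [h1]
    exact mul_mem (IntermediateField.algebraMap_mem _ _) (mem_adjoin_simple_self K z)
  have hzK : IsIntegral K z := hzint.tower_top
  have hadj : Algebra.adjoin K {z} = ⊤ := by
    rw [← IntermediateField.adjoin_simple_toSubalgebra_of_isAlgebraic hzK.isAlgebraic, hgenz]; rfl
  let pb := PowerBasis.ofAdjoinEqTop' hzK hadj
  have hpbgen : pb.gen = z := PowerBasis.ofAdjoinEqTop'_gen hzK hadj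
  let f : Polynomial K := Polynomial.X ^ p - (Polynomial.C (d ^ (p - 1)) * Polynomial.X +
      Polynomial.C (d ^ (p - 1) * algebraMap A K c))
  have hfm : f.Monic := Polynomial.monic_X_pow_sub
    ((Polynomial.degree_linear_le).trans_lt (by exact_mod_cast hp.one_lt))
  have hfdeg : f.natDegree = p := by
    rw [Polynomial.natDegree_sub_eq_left_of_natDegree_lt]
    · simp
    · refine (Polynomial.natDegree_linear_le).trans_lt ?_
      simpa using hp.one_lt
  have hmin : minpoly K z = f := by
    refine (minpoly.unique_of_degree_le_degree_minpoly K z hfm ?_ ?_).symm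
    · simp only [f, map_sub, map_pow, map_add, map_mul, Polynomial.aeval_X, Polynomial.aeval_C, hzp,
        hd, ← IsScalarTower.algebraMap_apply A K L]
      ring
    · have h1 := adjoin.finrank hzK
      rw [hgenz, IntermediateField.finrank_top', hdeg] at h1
      rw [Polynomial.degree_eq_natDegree hfm.ne_zero,
        Polynomial.degree_eq_natDegree (minpoly.ne_zero hzK), hfdeg, ← h1]
  have hder : f.derivative = Polynomial.C (-(d ^ (p - 1))) := by
    simp only [f, Polynomial.derivative_sub, Polynomial.derivative_X_pow, Polynomial.derivative_add,
      Polynomial.derivative_C_mul, Polynomial.derivative_C, Polynomial.derivative_X]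
    simp
  refine ⟨(p - 1) * p, fun b hb => ?_⟩
  have h1 := Algebra.discr_mul_isIntegral_mem_adjoin K (B := pb) (hpbgen ▸ hzint) hb
  rw [hpbgen, Algebra.discr_powerBasis_eq_norm, hpbgen, hmin, hder, Polynomial.aeval_C,
    Algebra.norm_algebraMap, hdeg] at h1
  have h2 : ∃ ε : A, ε * ε = 1 ∧ (-1 : K) ^ (Module.finrank K L * (Module.finrank K L - 1) / 2) *
      (-(d ^ (p - 1))) ^ p = algebraMap A K (ε * D ^ ((p - 1) * p)) := by
    refine ⟨(-1) ^ (Module.finrank K L * (Module.finrank K L - 1) / 2) * (-1) ^ p, ?_, ?_⟩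
    · rw [← pow_add, ← mul_pow]; simp
    · rw [neg_pow (d ^ (p - 1))]
      simp only [map_mul, map_pow, map_neg, map_one, ← pow_mul]
      ring
  obtain ⟨ε, hε, h2⟩ := h2
  rw [hdeg] at h2
  have h3 := Subalgebra.smul_mem _ h1 ε
  rw [h2, algebraMap_smul, ← mul_smul, ← mul_assoc, hε, one_mul] at h3
  exact h3

/-- Artin–Schreier extensions are unramified where the equation is integral: two lifts of an
infinitesimal deformation differ at `x` by some `δ` with `δ ^ p = δ` and `δ ^ 2 = 0`. -/
theorem isUnramifiedAt_of_notMem (hdeg : Module.finrank K L = p) {x : L} {a : K} {D c : A}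
    (hx : x ^ p - x = algebraMap K L a) (hgen : K⟮x⟯ = ⊤)
    (hc : algebraMap A K D * a = algebraMap A K c) (P : Ideal A)
    (hDP : D ∉ P) (Q : Ideal (integralClosure A L)) [Q.IsPrime] [Q.LiesOver P] :
    Algebra.IsUnramifiedAt A Q := by
  have hp := (Fact.out : p.Prime)
  have hD : D ≠ 0 := by rintro rfl; exact hDP P.zero_mem
  obtain ⟨N, hN⟩ := exists_pow_smul_mem_adjoin hdeg hD hx hgen hc
  set z := algebraMap A L D * x with hz
  have hzp : z ^ p = algebraMap A L (D ^ (p - 1)) * z + algebraMap A L (D ^ (p - 1) * c) :=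
    algebraMap_mul_pow_eq hx hc
  have hzint : IsIntegral A z := isIntegral_algebraMap_mul hx hc
  let zB : integralClosure A L := ⟨z, hzint⟩
  have hzB : zB ^ p = algebraMap A _ (D ^ (p - 1)) * zB + algebraMap A _ (D ^ (p - 1) * c) :=
    Subtype.ext hzp
  have hDQ : IsUnit (algebraMap A (Localization.AtPrime Q) D) := by
    rw [IsScalarTower.algebraMap_apply A (integralClosure A L)]
    refine IsLocalization.map_units (M := Q.primeCompl) _ ⟨algebraMap A _ D, fun h => hDP ?_⟩
    rw [Q.over_def P]; exact h
  rw [Algebra.IsUnramifiedAt, Algebra.FormallyUnramified.iff_comp_injective]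
  intro C _ _ I hI f g hfg
  rcases subsingleton_or_nontrivial C with hC | hC
  · exact AlgHom.ext fun y => Subsingleton.elim _ _
  have hCp : CharP C p := (CharP.charP_iff_prime_eq_zero hp).2 (by
    rw [← map_natCast (algebraMap A C), CharP.cast_eq_zero, map_zero])
  have hd : IsUnit (algebraMap A C D) := by
    have := hDQ.map f
    rwa [AlgHom.commutes] at this
  let F : integralClosure A L →ₐ[A] C := f.comp (IsScalarTower.toAlgHom A _ _)
  let G : integralClosure A L →ₐ[A] C := g.comp (IsScalarTower.toAlgHom A _ _)
  have hFG : F zB = G zB := by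
    have h1 : F zB - G zB ∈ I := by
      rw [← Ideal.Quotient.mk_eq_mk_iff_sub_mem]
      exact congrArg (fun h : Localization.AtPrime Q →ₐ[A] C ⧸ I => h (algebraMap _ _ zB)) hfg
    have h2 : (F zB - G zB) ^ p = 0 := by
      have h3 : (F zB - G zB) ^ 2 = 0 := by
        have := Ideal.pow_mem_pow h1 2
        rwa [hI] at this
      exact pow_eq_zero_of_le hp.two_le h3
    rw [sub_pow_char, ← map_pow, ← map_pow, hzB] at h2
    simp only [map_add, map_mul, AlgHom.commutes, map_pow] at h2
    rw [add_sub_add_right_eq_sub, ← mul_sub] at h2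
    exact sub_eq_zero.1 (((hd.pow (p - 1)).mul_right_eq_zero).1 h2)
  have hFG' : F = G := by
    ext b
    have h1 := hN b b.2
    have h2 : D ^ N • b ∈ Algebra.adjoin A {zB} := by
      have h3 : Algebra.adjoin A {z} = (Algebra.adjoin A {zB}).map (integralClosure A L).val := by
        rw [AlgHom.map_adjoin, Set.image_singleton]; rfl
      rw [h3] at h1
      obtain ⟨b', hb', h4⟩ := h1
      have : b' = D ^ N • b := Subtype.ext h4
      rwa [← this]
    have h3 : F (D ^ N • b) = G (D ^ N • b) := by
      have h4 : Algebra.adjoin A {zB} ≤ AlgHom.equalizer F G := by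
        rw [Algebra.adjoin_le_iff, Set.singleton_subset_iff]
        exact hFG
      exact h4 h2
    rw [map_smul, map_smul, Algebra.smul_def, Algebra.smul_def, map_pow] at h3
    exact (hd.pow N).mul_right_injective h3
  refine AlgHom.coe_ringHom_injective (IsLocalization.ringHom_ext Q.primeCompl ?_)
  exact RingHom.ext fun b => congrArg (fun h : integralClosure A L →ₐ[A] C => h b) hFG'

end Extension

/-! ### Generators over the complement of the branch divisor -/

section Generator

open IntermediateField

variable {A K L : Type*} [CommRing A] [Field K] [Algebra A K]
  [Field L] [Algebra K L] [Algebra A L] [IsScalarTower A K L] {p : ℕ} [Fact p.Prime]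

/-- Dedekind's independence of characters for the residue maps of the conjugates: the trace of the
integral closure is not contained in a prime with trivial inertia group. -/
theorem exists_sum_smul_notMem (Q : Ideal (integralClosure A L)) [Q.IsPrime]
    (hQ : ∀ σ : Gal(L/K), (∀ b : integralClosure A L, σ • b - b ∈ Q) → σ = 1)
    {σ : Gal(L/K)} (hσ : orderOf σ = p) :
    ∃ b : integralClosure A L, ∑ i ∈ Finset.range p, (σ ^ i) • b ∉ Q := by
  by_contra! hcon
  let χ : Fin p → (integralClosure A L →* integralClosure A L ⧸ Q) := fun i =>
    RingHom.toMonoidHom ((Ideal.Quotient.mk Q).comp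
      (MulSemiringAction.toRingHom Gal(L/K) (integralClosure A L) (σ ^ (i : ℕ))))
  have hχ : ∀ i b, χ i b = Ideal.Quotient.mk Q ((σ ^ (i : ℕ)) • b) := fun i b => rfl
  have hinj : Function.Injective χ := by
    intro i j hij
    have h1 : (σ ^ (i : ℕ)) * (σ ^ (j : ℕ))⁻¹ = 1 := by
      refine hQ _ fun b => ?_
      rw [← Ideal.Quotient.mk_eq_mk_iff_sub_mem]
      have h2 := congrArg (fun f => f ((σ ^ (j : ℕ))⁻¹ • b)) hij
      simp only [hχ] at h2
      rw [mul_smul, h2, smul_inv_smul]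
    exact Fin.ext (pow_injOn_Iio_orderOf (by simp [hσ]) (by simp [hσ]) (mul_inv_eq_one.1 h1))
  have hli := (linearIndependent_monoidHom (integralClosure A L)
    (integralClosure A L ⧸ Q)).comp χ hinj
  rw [Fintype.linearIndependent_iff] at hli
  have h0 := hli (fun _ => 1) (by
    funext b
    have h1 := Ideal.Quotient.eq_zero_iff_mem.2 (hcon b)
    rw [map_sum, Finset.sum_range] at h1
    simpa [hχ] using h1) ⟨0, (Fact.out : p.Prime).pos⟩
  exact Ideal.Quotient.zero_ne_one_iff.2 (Ideal.IsPrime.ne_top ‹_›) h0.symm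

/-- From an integral element whose trace is `D`, a generator `x` with `x ^ p - x ∈ A[D⁻¹]`. -/
theorem exists_generator_of_trace [IsIntegrallyClosed A] [IsFractionRing A K] [IsGalois K L]
    (hdeg : Module.finrank K L = p) [CharP A p]
    {σ : Gal(L/K)} (hσ : orderOf σ = p) {b : integralClosure A L} {D : A} (hD : D ≠ 0)
    (hb : ∑ i ∈ Finset.range p, (σ ^ i) • b = algebraMap A _ D) :
    ∃ (x : L) (a : K) (c : A), x ^ p - x = algebraMap K L a ∧ K⟮x⟯ = ⊤ ∧
      algebraMap A K (D ^ p) * a = algebraMap A K c := by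
  have hp := (Fact.out : p.Prime)
  have hfin : FiniteDimensional K L := Module.finite_of_finrank_pos (hdeg ▸ hp.pos)
  have : CharP K p := charP_of_injective_algebraMap (IsFractionRing.injective A K) p
  have : CharP L p := charP_of_injective_algebraMap (algebraMap K L).injective p
  have hcard : Nat.card Gal(L/K) = p := by rw [IsGalois.card_aut_eq_finrank, hdeg]
  have hzp : ∀ τ : Gal(L/K), τ ∈ Subgroup.zpowers σ := by
    intro τ
    have : Subgroup.zpowers σ = ⊤ := by
      rw [← Subgroup.card_eq_iff_eq_top, Nat.card_zpowers, hσ, hcard]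
    rw [this]; trivial
  set δ := algebraMap A L D with hδ
  have hinj : Function.Injective (algebraMap A L) := by
    rw [IsScalarTower.algebraMap_eq A K L]
    exact (algebraMap K L).injective.comp (IsFractionRing.injective A K)
  have hδ0 : δ ≠ 0 := fun h => hD (hinj (by rw [← hδ, h, map_zero]))
  have hσδ : σ δ = δ := by
    rw [hδ, IsScalarTower.algebraMap_apply A K L, σ.commutes]
  -- `S` is shifted by `-D` under `σ`, so `-S / D` is an Artin–Schreier generator.
  let S : integralClosure A L := ∑ i ∈ Finset.range p, (i : integralClosure A L) * (σ ^ i) • b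
  have hS : σ • S = S - algebraMap A _ D := by
    have h1 : σ • S = ∑ i ∈ Finset.range p,
        (((i + 1 : ℕ) : integralClosure A L) * (σ ^ (i + 1)) • b - (σ ^ (i + 1)) • b) := by
      rw [Finset.smul_sum]
      refine Finset.sum_congr rfl fun i _ => ?_
      rw [smul_mul', ← mul_smul, ← pow_succ']
      have : σ • (i : integralClosure A L) = i := by
        have := smul_algebraMap (R := ℕ) σ i (A := integralClosure A L)
        simpa using this
      rw [this]; push_cast; ring
    have hpow : σ ^ p = 1 := hσ ▸ pow_orderOf_eq_one σ
    have h3 : ∀ f : ℕ → integralClosure A L, f p = f 0 →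
        ∑ i ∈ Finset.range p, f (i + 1) = ∑ i ∈ Finset.range p, f i := by
      intro f hf
      have h4 := Finset.sum_range_succ f p
      rw [Finset.sum_range_succ', hf] at h4
      exact add_right_cancel h4
    have hpC : ((p : ℕ) : integralClosure A L) = 0 := by
      apply Subtype.ext
      change ((p : ℕ) : L) = 0
      exact CharP.cast_eq_zero L p
    rw [h1, Finset.sum_sub_distrib, h3 (fun i => (i : integralClosure A L) * (σ ^ i) • b)
      (by simp [hpC]), h3 (fun i => (σ ^ i) • b) (by simp [hpow]), hb]
  let x : L := -(S : L) / δ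
  have hx : σ x = x + 1 := by
    have h1 : σ (S : L) = (S : L) - δ := congrArg Subtype.val hS
    simp only [x]
    rw [map_div₀, map_neg, h1, hσδ]
    field_simp
    ring
  have hfix : ∀ τ : Gal(L/K), τ (x ^ p - x) = x ^ p - x := by
    intro τ
    have h1 : σ ∈ MulAction.stabilizer Gal(L/K) (x ^ p - x) := by
      rw [MulAction.mem_stabilizer_iff]
      change σ (x ^ p - x) = _
      rw [map_sub, map_pow, hx, add_pow_char, one_pow]
      ring
    exact (Subgroup.zpowers_le.2 h1) (hzp τ)
  obtain ⟨a, ha⟩ := IntermediateField.mem_bot.1 ((IsGalois.mem_bot_iff_fixed _).2 hfix)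
  have hgen : K⟮x⟯ = ⊤ := by
    have := IntermediateField.isSimpleOrder_of_finrank_prime K L (hdeg ▸ hp)
    refine (eq_bot_or_eq_top K⟮x⟯).resolve_left fun h => ?_
    have h1 : x ∈ (⊥ : IntermediateField K L) := h ▸ mem_adjoin_simple_self K x
    have h2 := (IsGalois.mem_bot_iff_fixed _).1 h1 σ
    rw [hx] at h2
    simp at h2
  have hint : IsIntegral A (algebraMap A K (D ^ p) * a) := by
    have h1 : IsIntegral A (algebraMap K L (algebraMap A K (D ^ p) * a)) := by
      have h2 : algebraMap K L (algebraMap A K (D ^ p) * a) =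
          (δ * x) ^ p - δ ^ (p - 1) * (δ * x) := by
        rw [map_mul, ha, ← IsScalarTower.algebraMap_apply, map_pow, ← hδ, mul_pow]
        have hpp : δ ^ p = δ ^ (p - 1) * δ := by
          rw [← pow_succ, Nat.sub_add_cancel hp.one_lt.le]
        rw [mul_sub, hpp]; ring
      have h3 : δ * x = -(S : L) := by simp only [x]; field_simp
      rw [h2, h3]
      exact (S.2.neg.pow p).sub ((isIntegral_algebraMap.pow _).mul S.2.neg)
    exact (isIntegral_algebraMap_iff (algebraMap K L).injective).1 h1
  obtain ⟨c, hc⟩ := IsIntegrallyClosed.isIntegral_iff.1 hint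
  exact ⟨x, a, c, ha.symm, hgen, hc.symm⟩

/-- If `L/K` is unramified at all primes not containing `E`, there is an Artin–Schreier generator
over `A[E⁻¹]`: the ideal of traces contains a power of `E`. -/
theorem exists_generator [IsDomain A] [IsNoetherianRing A] [IsIntegrallyClosed A]
    [IsFractionRing A K] [IsGalois K L] (hdeg : Module.finrank K L = p) [CharP A p] {E : A}
    (hE0 : E ≠ 0)
    (hE : ∀ P : PrimeSpectrum A, P.asIdeal ≠ ⊥ → E ∉ P.asIdeal →
      ∀ Q : PrimeSpectrum (integralClosure A L), Q.asIdeal.LiesOver P.asIdeal →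
        Algebra.IsUnramifiedAt A Q.asIdeal) :
    ∃ (x : L) (a : K) (c : A) (N : ℕ), x ^ p - x = algebraMap K L a ∧ K⟮x⟯ = ⊤ ∧
      algebraMap A K (E ^ N) * a = algebraMap A K c := by
  have hp := (Fact.out : p.Prime)
  have hfin : FiniteDimensional K L := Module.finite_of_finrank_pos (hdeg ▸ hp.pos)
  have hcard : Nat.card Gal(L/K) = p := by rw [IsGalois.card_aut_eq_finrank, hdeg]
  have hinj : Function.Injective (algebraMap A L) := by
    rw [IsScalarTower.algebraMap_eq A K L]
    exact (algebraMap K L).injective.comp (IsFractionRing.injective A K)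
  have : FaithfulSMul A L := (faithfulSMul_iff_algebraMap_injective A L).2 hinj
  have hfr : IsFractionRing (integralClosure A L) L :=
    integralClosure.isFractionRing_of_finite_extension K L
  obtain ⟨σ, hσ1⟩ : ∃ σ : Gal(L/K), σ ≠ 1 := by
    have hne : Nontrivial Gal(L/K) := Finite.one_lt_card_iff_nontrivial.1 (hcard ▸ hp.one_lt)
    exact exists_ne 1
  have hσ : orderOf σ = p := by
    have h1 : orderOf σ ∣ p := hcard ▸ orderOf_dvd_natCard σ
    exact ((Nat.dvd_prime hp).1 h1).resolve_left (fun h => hσ1 (orderOf_eq_one_iff.1 h))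
  -- the ideal of traces of integral elements
  let I : Ideal A :=
    { carrier := {d | ∃ b : integralClosure A L, ∑ i ∈ Finset.range p, (σ ^ i) • b =
        algebraMap A _ d}
      zero_mem' := ⟨0, by simp⟩
      add_mem' := by
        rintro d d' ⟨b, hb⟩ ⟨b', hb'⟩
        exact ⟨b + b', by simp [smul_add, Finset.sum_add_distrib, hb, hb']⟩
      smul_mem' := by
        rintro e d ⟨b, hb⟩
        refine ⟨algebraMap A _ e * b, ?_⟩
        simp only [smul_mul', smul_algebraMap, ← Finset.mul_sum, hb, smul_eq_mul, map_mul] }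
  have hrad : E ∈ I.radical := by
    rw [Ideal.radical_eq_sInf, Ideal.mem_sInf]
    rintro P ⟨hIP, hP⟩
    by_contra hEP
    have hint : Algebra.IsIntegral A (integralClosure A L) := inferInstance
    obtain ⟨Q, hQ, hQP⟩ : ∃ Q : Ideal (integralClosure A L), Q.IsPrime ∧ Q.LiesOver P := by
      obtain ⟨Q, hQ⟩ := Ideal.nonempty_primesOver (S := integralClosure A L) P
      exact ⟨Q, hQ.1, hQ.2⟩
    have hinertia : ∀ τ : Gal(L/K), (∀ b : integralClosure A L, τ • b - b ∈ Q) → τ = 1 := by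
      intro τ hτ
      by_cases hP0 : P = ⊥
      · have hQ0 : Q = ⊥ := by
          refine Ideal.eq_bot_of_comap_eq_bot (R := A) ?_
          rw [← Ideal.under_def, ← hQP.over, hP0]
        have h5 : ∀ b : integralClosure A L, τ (algebraMap _ L b) = algebraMap _ L b := by
          intro b
          have h6 := hτ b
          rw [hQ0, Ideal.mem_bot, sub_eq_zero] at h6
          exact congrArg Subtype.val h6
        ext y
        obtain ⟨b, s, -, rfl⟩ := IsFractionRing.div_surjective (A := integralClosure A L) y
        rw [map_div₀, h5, h5]; rfl
      · exact aut_eq_one_of_isUnramifiedAt Q (hE ⟨P, hP⟩ hP0 hEP ⟨Q, hQ⟩ hQP) τ hτ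
    obtain ⟨b, hb⟩ := exists_sum_smul_notMem Q hinertia hσ
    have hfix : ∀ τ : Gal(L/K), τ ((∑ i ∈ Finset.range p, (σ ^ i) • b : integralClosure A L) : L) =
        ((∑ i ∈ Finset.range p, (σ ^ i) • b : integralClosure A L) : L) := by
      intro τ
      have hzp : Subgroup.zpowers σ = ⊤ := by
        rw [← Subgroup.card_eq_iff_eq_top, Nat.card_zpowers, hσ, hcard]
      have h1 : σ ∈ MulAction.stabilizer Gal(L/K)
          (∑ i ∈ Finset.range p, (σ ^ i) • b : integralClosure A L) := by
        rw [MulAction.mem_stabilizer_iff, Finset.smul_sum]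
        simp_rw [← mul_smul, ← pow_succ']
        have h4 := Finset.sum_range_succ (fun i => (σ ^ i) • b) p
        rw [Finset.sum_range_succ', ← hσ, pow_orderOf_eq_one, pow_zero, hσ] at h4
        exact add_right_cancel h4
      have h2 : τ ∈ MulAction.stabilizer Gal(L/K)
          (∑ i ∈ Finset.range p, (σ ^ i) • b : integralClosure A L) := by
        have h3 := Subgroup.zpowers_le.2 h1
        rw [hzp] at h3
        exact h3 trivial
      exact congrArg Subtype.val (MulAction.mem_stabilizer_iff.1 h2)
    obtain ⟨a, ha⟩ := IntermediateField.mem_bot.1 ((IsGalois.mem_bot_iff_fixed _).2 hfix)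
    have hai : IsIntegral A a := (isIntegral_algebraMap_iff (algebraMap K L).injective).1
      (ha ▸ (∑ i ∈ Finset.range p, (σ ^ i) • b : integralClosure A L).2)
    obtain ⟨d, hd⟩ := IsIntegrallyClosed.isIntegral_iff.1 hai
    have hdb : ∑ i ∈ Finset.range p, (σ ^ i) • b = algebraMap A (integralClosure A L) d := by
      apply Subtype.ext
      rw [← ha, ← hd, ← IsScalarTower.algebraMap_apply]
      rfl
    have hdP : d ∈ P := hIP ⟨b, hdb⟩
    refine hb (hdb ▸ ?_)
    rw [hQP.over] at hdP
    exact hdP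
  obtain ⟨N, b, hb⟩ := hrad
  obtain ⟨x, a, c, h1, h2, h3⟩ := exists_generator_of_trace hdeg hσ (pow_ne_zero N hE0) hb
  exact ⟨x, a, c, N * p, h1, h2, by rw [pow_mul]; exact h3⟩

end Generator

/-! ### The residue extension of an Artin–Schreier extension -/

section Residue

open IntermediateField

/-- If `B` is `A[z]` up to powers of `D`, where `z / D` is an Artin–Schreier root of `c / D`, the
extension of residue fields at a prime not containing `D` is generated by an Artin–Schreier root
of the residue class of `c / D`. -/
theorem exists_residue_generator {A B : Type*} [CommRing A] [CommRing B] [Algebra A B]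
    (P : Ideal A) (Q : Ideal B) [P.IsPrime] [Q.IsPrime] [Q.LiesOver P]
    {E F : Type*} [Field E] [Field F] [Algebra (A ⧸ P) E] [Algebra (B ⧸ Q) F]
    [IsFractionRing (A ⧸ P) E] [IsFractionRing (B ⧸ Q) F]
    [Algebra E F] [Algebra (A ⧸ P) F] [IsScalarTower (A ⧸ P) E F]
    [IsScalarTower (A ⧸ P) (B ⧸ Q) F]
    {p : ℕ} (hp : 1 ≤ p) {D c : A} (hD : D ∉ P) {z : B}
    (hz : z ^ p = algebraMap A B (D ^ (p - 1)) * z + algebraMap A B (D ^ (p - 1) * c))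
    {N : ℕ} (hN : ∀ b : B, D ^ N • b ∈ Algebra.adjoin A {z}) :
    ∃ ξ : F, ξ ^ p - ξ = algebraMap E F (algebraMap _ E (Ideal.Quotient.mk P c) /
      algebraMap _ E (Ideal.Quotient.mk P D)) ∧ E⟮ξ⟯ = ⊤ := by
  let f : B →+* F := (algebraMap (B ⧸ Q) F).comp (Ideal.Quotient.mk Q)
  let g : A →+* E := (algebraMap (A ⧸ P) E).comp (Ideal.Quotient.mk P)
  have hfg : ∀ a, f (algebraMap A B a) = algebraMap E F (g a) := by
    intro a
    change algebraMap (B ⧸ Q) F (Ideal.Quotient.mk Q (algebraMap A B a)) =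
      algebraMap E F (algebraMap (A ⧸ P) E (Ideal.Quotient.mk P a))
    rw [← IsScalarTower.algebraMap_apply, IsScalarTower.algebraMap_apply (A ⧸ P) (B ⧸ Q) F]
    rfl
  have hg0 : g D ≠ 0 := by
    intro h
    exact hD (Ideal.Quotient.eq_zero_iff_mem.1 (IsFractionRing.injective (A ⧸ P) E
      (h.trans (map_zero _).symm)))
  have hδ0 : algebraMap E F (g D) ≠ 0 := by simpa using hg0
  refine ⟨f z / algebraMap E F (g D), ?_, ?_⟩
  · change _ = algebraMap E F (g c / g D)
    have h1 := congrArg f hz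
    simp only [map_add, map_mul, map_pow, hfg] at h1
    rw [div_pow, h1, map_div₀]
    obtain ⟨q, rfl⟩ : ∃ q, p = q + 1 := ⟨p - 1, by omega⟩
    simp only [Nat.add_sub_cancel]
    field_simp
    ring
  · rw [eq_top_iff]
    have hzmem : f z ∈ E⟮f z / algebraMap E F (g D)⟯ := by
      have h1 := mul_mem (mem_adjoin_simple_self E (f z / algebraMap E F (g D)))
        (_root_.algebraMap_mem (E⟮f z / algebraMap E F (g D)⟯) (g D))
      rwa [div_mul_cancel₀ _ hδ0] at h1
    have hmem : ∀ b : B, f b ∈ E⟮f z / algebraMap E F (g D)⟯ := by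
      intro b
      have h2 : ∀ y ∈ Algebra.adjoin A {z}, f y ∈ E⟮f z / algebraMap E F (g D)⟯ := by
        intro y hy
        induction hy using Algebra.adjoin_induction with
        | mem x hx => rw [Set.mem_singleton_iff.1 hx]; exact hzmem
        | algebraMap r => rw [hfg]; exact _root_.algebraMap_mem _ _
        | add x y _ _ h1 h2 => rw [map_add]; exact add_mem h1 h2
        | mul x y _ _ h1 h2 => rw [map_mul]; exact mul_mem h1 h2
      have h3 := h2 _ (hN b)
      rw [Algebra.smul_def, map_mul, hfg] at h3
      have h4 := mul_mem (inv_mem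
        (_root_.algebraMap_mem (E⟮f z / algebraMap E F (g D)⟯) (g (D ^ N)))) h3
      rwa [inv_mul_cancel_left₀] at h4
      rw [map_pow, map_pow]
      exact pow_ne_zero _ hδ0
    rintro w -
    obtain ⟨b, s, -, rfl⟩ := IsFractionRing.div_surjective (A := B ⧸ Q) w
    obtain ⟨b, rfl⟩ := Ideal.Quotient.mk_surjective b
    obtain ⟨s, rfl⟩ := Ideal.Quotient.mk_surjective s
    exact div_mem (hmem b) (hmem s)

/-- Bounds for the jump after replacing a generator `ξ` by `ξ - y`. -/
theorem ramificationJump_eq_and_le {R E F : Type*} [CommRing R] [IsDomain R]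
    [IsDiscreteValuationRing R] [Field E] [Field F] [Algebra R E] [Algebra R F] [Algebra E F]
    [IsScalarTower R E F] [IsFractionRing R E] {p : ℕ} [Fact p.Prime] [CharP R p]
    [IsAlgClosed (IsLocalRing.ResidueField R)] {ξ : F} {α : E}
    (hξ : ξ ^ p - ξ = algebraMap E F α) (hgen : E⟮ξ⟯ = ⊤) {t u : R} (ht : Irreducible t) {n : ℕ}
    (y : E) (hy : (α - (y ^ p - y)) * algebraMap R E t ^ n = algebraMap R E u) :
    (IsUnit u → ¬ p ∣ n → ramificationJump R E F p = n) ∧ ramificationJump R E F p ≤ n ∧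
      (ramificationJump R E F p = 0 ∨ ¬ p ∣ ramificationJump R E F p) := by
  have : CharP E p := charP_of_injective_algebraMap (IsFractionRing.injective R E) p
  have : CharP F p := charP_of_injective_algebraMap (algebraMap E F).injective p
  have h1 : (ξ - algebraMap E F y) ^ p - (ξ - algebraMap E F y) =
      algebraMap E F (α - (y ^ p - y)) := by
    rw [map_sub, ← hξ, sub_pow_char, map_sub, map_pow]
    ring
  have h2 : E⟮ξ - algebraMap E F y⟯ = ⊤ := by
    rw [eq_top_iff, ← hgen, adjoin_simple_le_iff]
    have h1 := add_mem (mem_adjoin_simple_self E (ξ - algebraMap E F y))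
      (_root_.algebraMap_mem (E⟮ξ - algebraMap E F y⟯) y)
    rwa [sub_add_cancel] at h1
  exact ⟨fun hu hn => ramificationJump_eq h1 h2 ht hu hn hy, ramificationJump_le ht n h1 h2 hy⟩

theorem isAlgClosed_residueField_quotient {A : Type*} [CommRing A] [IsLocalRing A]
    [IsAlgClosed (IsLocalRing.ResidueField A)] (P : Ideal A) [IsLocalRing (A ⧸ P)] :
    IsAlgClosed (IsLocalRing.ResidueField (A ⧸ P)) := by
  have : IsLocalHom (Ideal.Quotient.mk P) :=
    Ideal.Quotient.mk_surjective.isLocalHom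
  refine IsAlgClosed.of_ringEquiv (IsLocalRing.ResidueField A) _
    (RingEquiv.ofBijective (IsLocalRing.ResidueField.map (Ideal.Quotient.mk P))
      ⟨RingHom.injective _, fun y => ?_⟩)
  obtain ⟨y, rfl⟩ := IsLocalRing.residue_surjective y
  obtain ⟨y, rfl⟩ := Ideal.Quotient.mk_surjective y
  exact ⟨IsLocalRing.residue A y, IsLocalRing.ResidueField.map_residue _ _⟩

theorem charP_quotient {A : Type*} [CommRing A] {p : ℕ} [Fact p.Prime] [CharP A p] (P : Ideal A)
    [P.IsPrime] : CharP (A ⧸ P) p := by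
  rw [CharP.charP_iff_prime_eq_zero (Fact.out : p.Prime), ← map_natCast (Ideal.Quotient.mk P),
    CharP.cast_eq_zero, map_zero]

variable {A K L : Type*} [CommRing A] [IsDomain A] [IsLocalRing A] [Field K] [Algebra A K]
  [Field L] [Algebra K L] [Algebra A L] [IsScalarTower A K L] {p : ℕ} [Fact p.Prime]
  [IsIntegrallyClosed A] [IsFractionRing A K] [IsGalois K L] [CharP A p]
  [IsAlgClosed (IsLocalRing.ResidueField A)]

/-- The jump of the residue extension along a regular curve `P`, in terms of an Artin–Schreier
generator `c / D` and a correction `y ^ p - y` in the residue field of `P`; if the corrected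
generator has a pole of order `n` which is not divisible by `p`, the jump is `n`. -/
theorem jump_eq_and_le (hdeg : Module.finrank K L = p) {x : L} {a : K} {D c : A}
    (hx : x ^ p - x = algebraMap K L a) (hgen : K⟮x⟯ = ⊤)
    (hc : algebraMap A K D * a = algebraMap A K c) (P : PrimeSpectrum A)
    [IsDiscreteValuationRing (A ⧸ P.asIdeal)] (hDP : D ∉ P.asIdeal)
    {t u : A ⧸ P.asIdeal} (ht : Irreducible t) {n : ℕ} (y : FractionRing (A ⧸ P.asIdeal))
    (hy : (algebraMap _ _ (Ideal.Quotient.mk P.asIdeal c) /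
      algebraMap _ _ (Ideal.Quotient.mk P.asIdeal D) - (y ^ p - y)) *
        algebraMap _ (FractionRing (A ⧸ P.asIdeal)) t ^ n = algebraMap _ _ u) :
    (IsUnit u → ¬ p ∣ n → jump L p P = n) ∧
      jump L p P ≤ n ∧ (jump L p P = 0 ∨ ¬ p ∣ jump L p P) := by
  have hp := (Fact.out : p.Prime)
  have hinj : Function.Injective (algebraMap A L) := by
    rw [IsScalarTower.algebraMap_eq A K L]
    exact (algebraMap K L).injective.comp (IsFractionRing.injective A K)
  have : FaithfulSMul A L := (faithfulSMul_iff_algebraMap_injective A L).2 hinj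
  have hex : ∃ Q : PrimeSpectrum (integralClosure A L), Q.asIdeal.LiesOver P.asIdeal := by
    obtain ⟨Q, hQ⟩ := Ideal.nonempty_primesOver (S := integralClosure A L) P.asIdeal
    exact ⟨⟨Q, hQ.1⟩, hQ.2⟩
  have hQ := hex.choose_spec
  set Q := hex.choose with hQdef
  have hj : jump L p P = residueJump L p P Q := by rw [jump, dif_pos hex]
  have hD : D ≠ 0 := by rintro rfl; exact hDP P.asIdeal.zero_mem
  obtain ⟨N, hN⟩ := exists_pow_smul_mem_adjoin hdeg hD hx hgen hc
  let z : integralClosure A L := ⟨algebraMap A L D * x, isIntegral_algebraMap_mul hx hc⟩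
  have hz : z ^ p = algebraMap A _ (D ^ (p - 1)) * z + algebraMap A _ (D ^ (p - 1) * c) :=
    Subtype.ext (algebraMap_mul_pow_eq hx hc)
  have hN' : ∀ b : integralClosure A L, D ^ N • b ∈ Algebra.adjoin A {z} := by
    intro b
    have h1 := hN b b.2
    have h2 : Algebra.adjoin A {algebraMap A L D * x} =
        (Algebra.adjoin A {z}).map (integralClosure A L).val := by
      rw [AlgHom.map_adjoin, Set.image_singleton]; rfl
    rw [h2] at h1
    obtain ⟨w, hw, hwb⟩ := h1
    have : w = D ^ N • b := Subtype.ext hwb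
    rwa [← this]
  let := FractionRing.liftAlgebra (A ⧸ P.asIdeal)
    (FractionRing (integralClosure A L ⧸ Q.asIdeal))
  have := FractionRing.isScalarTower_liftAlgebra (A ⧸ P.asIdeal)
    (FractionRing (integralClosure A L ⧸ Q.asIdeal))
  obtain ⟨ξ, hξ, hξgen⟩ := exists_residue_generator P.asIdeal Q.asIdeal
    (E := FractionRing (A ⧸ P.asIdeal))
    (F := FractionRing (integralClosure A L ⧸ Q.asIdeal)) hp.one_lt.le hDP hz hN'
  have : CharP (A ⧸ P.asIdeal) p := charP_quotient P.asIdeal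
  have : IsAlgClosed (IsLocalRing.ResidueField (A ⧸ P.asIdeal)) :=
    isAlgClosed_residueField_quotient P.asIdeal
  rw [hj]
  exact ramificationJump_eq_and_le hξ hξgen ht y hy

end Residue

/-! ### Sections of the residue map and power series expansions -/

section Section

open IsLocalRing

variable {A : Type*} [CommRing A] [IsLocalRing A] {p : ℕ} [Fact p.Prime] [CharP A p]

theorem maximalIdeal_pow_le_span_pair {T U : A} (h : Ideal.span {T, U} = maximalIdeal A) (N : ℕ) :
    maximalIdeal A ^ N ≤ Ideal.span {T, U ^ N} := by
  induction N with
  | zero => exact fun x _ => Ideal.mem_span_pair.2 ⟨0, x, by simp⟩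
  | succ N ih =>
    rw [pow_succ]
    refine Ideal.mul_le.2 fun x hx y hy => ?_
    obtain ⟨a, b, rfl⟩ := Ideal.mem_span_pair.1 (ih hx)
    obtain ⟨a', b', rfl⟩ := Ideal.mem_span_pair.1 (h ▸ hy : y ∈ Ideal.span {T, U})
    exact Ideal.mem_span_pair.2 ⟨a * (a' * T + b' * U) + b * U ^ N * a', b * b', by ring⟩

theorem pow_sub_pow_mem {a b : A} (h : residue A a = residue A b) (N : ℕ) :
    a ^ p ^ N - b ^ p ^ N ∈ maximalIdeal A ^ p ^ N := by
  rw [← sub_pow_char_pow]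
  refine Ideal.pow_mem_pow ?_ _
  rw [← residue_eq_zero_iff, map_sub, h, sub_self]

theorem charP_residueField : CharP (ResidueField A) p := by
  rw [CharP.charP_iff_prime_eq_zero (Fact.out : p.Prime), ← map_natCast (residue A),
    CharP.cast_eq_zero, map_zero]

variable (A p) [IsAlgClosed (ResidueField A)]

open scoped Classical in
/-- The canonical section of level `N` of the residue map: the `p ^ N`-th power of any lift of the
`p ^ N`-th root. -/
noncomputable def canonicalSection (N : ℕ) (x : ResidueField A) : A :=
  haveI : CharP (ResidueField A) p := charP_residueField
  Function.surjInv (residue_surjective (R := A))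
    ((iterateFrobeniusEquiv (ResidueField A) p N).symm x) ^ p ^ N

variable {A p}

theorem exists_canonicalSection_eq (N : ℕ) (x : ResidueField A) :
    ∃ y, residue A y ^ p ^ N = x ∧ canonicalSection A p N x = y ^ p ^ N := by
  have : CharP (ResidueField A) p := charP_residueField
  refine ⟨_, ?_, rfl⟩
  rw [Function.surjInv_eq residue_surjective, ← iterateFrobeniusEquiv_def,
    RingEquiv.apply_symm_apply]

theorem residue_canonicalSection (N : ℕ) (x : ResidueField A) :
    residue A (canonicalSection A p N x) = x := by
  obtain ⟨y, hy, h⟩ := exists_canonicalSection_eq (p := p) N x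
  rw [h, map_pow, hy]

/-- Any `p ^ N`-th power of a lift of a `p ^ N`-th root is congruent to the canonical section. -/
theorem canonicalSection_sub_mem (N : ℕ) {x : ResidueField A} {y : A}
    (hy : residue A y ^ p ^ N = x) :
    canonicalSection A p N x - y ^ p ^ N ∈ maximalIdeal A ^ p ^ N := by
  have : CharP (ResidueField A) p := charP_residueField
  obtain ⟨z, hz, h⟩ := exists_canonicalSection_eq (p := p) N x
  rw [h]
  exact pow_sub_pow_mem (iterateFrobenius_inj (ResidueField A) p N (hz.trans hy.symm)) N

theorem canonicalSection_succ_sub_mem (N : ℕ) (x : ResidueField A) :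
    canonicalSection A p N x - canonicalSection A p (N + 1) x ∈ maximalIdeal A ^ p ^ N := by
  obtain ⟨y, hy, h⟩ := exists_canonicalSection_eq (p := p) (N + 1) x
  rw [h, pow_succ', pow_mul]
  exact canonicalSection_sub_mem N (by rw [map_pow, ← pow_mul, ← pow_succ', hy])

theorem canonicalSection_zero (N : ℕ) :
    canonicalSection A p N 0 ∈ maximalIdeal A ^ p ^ N := by
  have hp := (Fact.out : p.Prime)
  have := canonicalSection_sub_mem (p := p) N (x := (0 : ResidueField A)) (y := 0)
    (by rw [map_zero, zero_pow (pow_ne_zero _ hp.ne_zero)])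
  rwa [zero_pow (pow_ne_zero _ hp.ne_zero), sub_zero] at this

/-- The canonical sections are compatible with `p`-th powers. -/
theorem canonicalSection_pow_sub_mem (N : ℕ) (x : ResidueField A) :
    canonicalSection A p N (x ^ p) - canonicalSection A p N x ^ p ∈ maximalIdeal A ^ p ^ N := by
  obtain ⟨y, hy, h⟩ := exists_canonicalSection_eq (p := p) N x
  have := canonicalSection_sub_mem (p := p) N (x := x ^ p) (y := y ^ p)
    (by rw [map_pow, ← pow_mul, mul_comm, pow_mul, hy])
  rwa [← pow_mul, mul_comm p, pow_mul, ← h] at this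

theorem isSection_canonicalSection (N : ℕ) : IsSection N (canonicalSection A p N) := by
  have hp := (Fact.out : p.Prime)
  have hle : maximalIdeal A ^ p ^ N ≤ maximalIdeal A ^ N :=
    Ideal.pow_le_pow_right (Nat.lt_pow_self hp.one_lt).le
  have key : ∀ {x : ResidueField A} {y : A}, residue A y ^ p ^ N = x →
      Ideal.Quotient.mk (maximalIdeal A ^ N) (canonicalSection A p N x) =
        Ideal.Quotient.mk _ (y ^ p ^ N) := fun h =>
    Ideal.Quotient.eq.2 (hle (canonicalSection_sub_mem N h))
  have : CharP (ResidueField A) p := charP_residueField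
  refine ⟨residue_canonicalSection N,
    { toFun := fun x => Ideal.Quotient.mk _ (canonicalSection A p N x)
      map_one' := ?_, map_zero' := ?_, map_mul' := ?_, map_add' := ?_ }, fun x => rfl⟩
  · rw [key (y := 1) (by simp)]; simp
  · intro x x'
    obtain ⟨y, hy, -⟩ := exists_canonicalSection_eq (p := p) N x
    obtain ⟨y', hy', -⟩ := exists_canonicalSection_eq (p := p) N x'
    rw [key hy, key hy', key (y := y * y') (by rw [map_mul, mul_pow, hy, hy']), mul_pow, map_mul]
  · exact Ideal.Quotient.eq_zero_iff_mem.2 (hle (canonicalSection_zero N))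
  · intro x x'
    obtain ⟨y, hy, -⟩ := exists_canonicalSection_eq (p := p) N x
    obtain ⟨y', hy', -⟩ := exists_canonicalSection_eq (p := p) N x'
    rw [key hy, key hy', key (y := y + y') (by rw [map_add, add_pow_char_pow, hy, hy']),
      add_pow_char_pow, map_add]

/-- Sequences constructed one term at a time. -/
theorem exists_seq_of_forall_update {α : Type*} [Inhabited α] (G : ℕ → (ℕ → α) → Prop)
    (hG : ∀ N θ θ', (∀ i < N, θ i = θ' i) → G N θ → G N θ') (h0 : ∀ θ, G 0 θ)
    (hstep : ∀ N θ, G N θ → ∃ x, G (N + 1) (Function.update θ N x)) : ∃ θ, ∀ N, G N θ := by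
  choose! x hx using hstep
  let Θ : ℕ → ℕ → α := fun N => N.rec (fun _ => default) fun N θ => Function.update θ N (x N θ)
  have hΘ : ∀ N, G N (Θ N) := by
    intro N
    induction N with
    | zero => exact h0 _
    | succ N ih => exact hx N _ ih
  have hst : ∀ i N, i < N → Θ N i = Θ (i + 1) i := by
    intro i N hN
    induction N with
    | zero => omega
    | succ N ih =>
      rcases Nat.lt_succ_iff_lt_or_eq.1 hN with h | rfl
      · rw [← ih h]
        exact Function.update_of_ne (by omega) _ _
      · rfl
  exact ⟨fun i => Θ (i + 1) i, fun N => hG N (Θ N) _ (fun i hi => hst i N hi) (hΘ N)⟩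

variable {T U : A}

variable (p) in
/-- Expansion of `c` modulo `T` as a power series in `U`. -/
theorem exists_expansion (h : Ideal.span {T, U} = maximalIdeal A) (c : A) :
    ∃ θ : ℕ → ResidueField A, ∀ N : ℕ,
      c - ∑ j ∈ Finset.range N, canonicalSection A p N (θ j) * U ^ j ∈ Ideal.span {T, U ^ N} := by
  have hp := (Fact.out : p.Prime)
  have : Inhabited (ResidueField A) := ⟨0⟩
  refine exists_seq_of_forall_update (fun N θ => c - ∑ j ∈ Finset.range N,
    canonicalSection A p N (θ j) * U ^ j ∈ Ideal.span {T, U ^ N}) ?_ ?_ ?_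
  · intro N θ θ' hθ hc
    rwa [Finset.sum_congr rfl fun j hj => by rw [← hθ j (Finset.mem_range.1 hj)]]
  · intro θ
    exact (Ideal.eq_top_iff_one (Ideal.span {T, U ^ 0})).2 (Ideal.subset_span (by simp)) ▸ trivial
  · intro N θ hθ
    obtain ⟨g, s, hgs⟩ := Ideal.mem_span_pair.1 hθ
    refine ⟨residue A s, ?_⟩
    rw [Finset.sum_range_succ, Function.update_self,
      Finset.sum_congr rfl fun j hj => by
        rw [Function.update_of_ne (Finset.mem_range.1 hj).ne (residue A s) θ]]
    have h1 : ∑ j ∈ Finset.range N, (canonicalSection A p N (θ j) -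
        canonicalSection A p (N + 1) (θ j)) * U ^ j ∈ Ideal.span {T, U ^ (N + 1)} := by
      refine Ideal.sum_mem _ fun j _ => Ideal.mul_mem_right _ _ ?_
      exact maximalIdeal_pow_le_span_pair h _ (Ideal.pow_le_pow_right
        (Nat.succ_le_of_lt (Nat.lt_pow_self hp.one_lt)) (canonicalSection_succ_sub_mem N (θ j)))
    have h2 : s - canonicalSection A p (N + 1) (residue A s) ∈ Ideal.span {T, U} := by
      rw [h, ← residue_eq_zero_iff, map_sub, residue_canonicalSection, sub_self]
    obtain ⟨g', s', hgs'⟩ := Ideal.mem_span_pair.1 h2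
    have h3 : c - (∑ j ∈ Finset.range N, canonicalSection A p (N + 1) (θ j) * U ^ j +
        canonicalSection A p (N + 1) (residue A s) * U ^ N) =
        ∑ j ∈ Finset.range N, (canonicalSection A p N (θ j) -
          canonicalSection A p (N + 1) (θ j)) * U ^ j + ((g + g' * U ^ N) * T +
            s' * U ^ (N + 1)) := by
      simp only [sub_mul, Finset.sum_sub_distrib]
      linear_combination (-1 : A) * hgs - U ^ N * hgs'
    rw [h3]
    exact Ideal.add_mem _ h1 (Ideal.mem_span_pair.2 ⟨_, _, rfl⟩)

/-- If all exponents in the expansion of `c` are congruent to `n` modulo `p`, the product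
`c U ^ ((p - 1) n)` is a `p`-th power modulo `T` and arbitrarily high powers of `U`. -/
theorem exists_sub_pow_mem (h : Ideal.span {T, U} = maximalIdeal A) {c : A} {n : ℕ}
    {θ : ℕ → ResidueField A}
    (hθ : ∀ N : ℕ,
      c - ∑ j ∈ Finset.range N, canonicalSection A p N (θ j) * U ^ j ∈ Ideal.span {T, U ^ N})
    (h0 : ∀ i, ¬ i ≡ n [MOD p] → θ i = 0) (N : ℕ) :
    ∃ γ, c * U ^ ((p - 1) * n) - γ ^ p ∈ Ideal.span {T, U ^ N} := by
  have hp := (Fact.out : p.Prime)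
  have hle : maximalIdeal A ^ p ^ N ≤ Ideal.span {T, U ^ N} :=
    (Ideal.pow_le_pow_right (Nat.lt_pow_self hp.one_lt).le).trans
      (maximalIdeal_pow_le_span_pair h N)
  have hroot : ∀ x : ResidueField A, ∃ y, y ^ p = x := fun x =>
    IsAlgClosed.exists_pow_nat_eq x hp.pos
  choose ρ hρ using hroot
  refine ⟨∑ j ∈ Finset.range N, if j ≡ n [MOD p] then canonicalSection A p N (ρ (θ j)) *
    U ^ ((j + (p - 1) * n) / p) else 0, ?_⟩
  have h1 : (c - ∑ j ∈ Finset.range N, canonicalSection A p N (θ j) * U ^ j) *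
      U ^ ((p - 1) * n) ∈ Ideal.span {T, U ^ N} := Ideal.mul_mem_right _ _ (hθ N)
  rw [sum_pow_char]
  have h2 : (∑ j ∈ Finset.range N, (canonicalSection A p N (θ j) * U ^ j * U ^ ((p - 1) * n) -
      (if j ≡ n [MOD p] then canonicalSection A p N (ρ (θ j)) *
        U ^ ((j + (p - 1) * n) / p) else 0) ^ p)) ∈ Ideal.span {T, U ^ N} := by
    refine Ideal.sum_mem _ fun j _ => ?_
    split_ifs with hj
    · have hdvd : p ∣ j + (p - 1) * n := by
        have h3 : j + (p - 1) * n ≡ n + (p - 1) * n [MOD p] := hj.add_right _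
        have h4 : n + (p - 1) * n = p * n := by
          obtain ⟨q, rfl⟩ : ∃ q, p = q + 1 := ⟨p - 1, by have := hp.pos; omega⟩
          simp only [Nat.add_sub_cancel]; ring
        rw [h4] at h3
        exact (Nat.modEq_zero_iff_dvd.1 (h3.trans (Nat.modEq_zero_iff_dvd.2 (dvd_mul_right _ _))))
      rw [mul_pow, ← pow_mul, Nat.div_mul_cancel hdvd, mul_assoc, ← pow_add, ← sub_mul]
      refine Ideal.mul_mem_right _ _ (hle ?_)
      have h5 := canonicalSection_pow_sub_mem (p := p) N (ρ (θ j))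
      rwa [hρ] at h5
    · rw [h0 j hj, zero_pow hp.ne_zero, sub_zero]
      exact Ideal.mul_mem_right _ _ (Ideal.mul_mem_right _ _ (hle (canonicalSection_zero N)))
  have h3 := Ideal.add_mem _ h1 h2
  convert h3 using 1
  rw [Finset.sum_sub_distrib, sub_mul, Finset.sum_mul]
  ring

end Section

/-! ### Descending `p`-th powers from the completion -/

section GRing

open IsLocalRing Polynomial

universe u

theorem isDiscreteValuationRing_quotient_of_span_pair_eq {A : Type*} [CommRing A]
    [IsRegularLocalRing A] [IsDomain A]
    (hdim : ringKrullDim A = 2) {T U : A} (h : Ideal.span {T, U} = maximalIdeal A) :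
    ∃ _ : IsDomain (A ⧸ Ideal.span {T}), IsDiscreteValuationRing (A ⧸ Ideal.span {T}) ∧
      Irreducible (Ideal.Quotient.mk (Ideal.span {T}) U) := by
  have := isRegularLocalRing_quotient_of_span_pair_eq hdim h
  have hdom := isDomain_of_isRegularLocalRing (A ⧸ Ideal.span {T})
  have hTm : T ∈ maximalIdeal A := h ▸ Ideal.subset_span (by simp)
  have hdvr : IsDiscreteValuationRing (A ⧸ Ideal.span {T}) :=
    isDiscreteValuationRing_of_isRegularLocalRing _
      (ringKrullDim_quotient_span_singleton hdim (ne_zero_of_span_pair_eq hdim h) hTm)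
  refine ⟨hdom, hdvr, (IsDiscreteValuationRing.irreducible_iff_uniformizer _).2 ?_⟩
  have h1 : (maximalIdeal A).map (Ideal.Quotient.mk (Ideal.span {T})) =
      maximalIdeal (A ⧸ Ideal.span {T}) := by
    refine eq_maximalIdeal ((Ideal.map_eq_top_or_isMaximal_of_surjective _
      Ideal.Quotient.mk_surjective (maximalIdeal.isMaximal A)).resolve_left fun h2 => ?_)
    have h3 := Ideal.comap_map_mk ((Ideal.span_singleton_le_iff_mem _).2 hTm)
    rw [h2, Ideal.comap_top] at h3
    exact (maximalIdeal.isMaximal A).ne_top h3.symm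
  rw [← h1, ← h, Ideal.map_span, Set.image_pair, Ideal.span_insert,
    Ideal.Quotient.mk_singleton_self, Ideal.span_singleton_eq_bot.2 rfl, bot_sup_eq]

theorem not_dvd_of_span_pair_eq {A : Type*} [CommRing A] [IsRegularLocalRing A] [IsDomain A]
    (hdim : ringKrullDim A = 2) {T U : A} (h : Ideal.span {T, U} = maximalIdeal A) : ¬ T ∣ U := by
  obtain ⟨_, _, hU⟩ := isDiscreteValuationRing_quotient_of_span_pair_eq hdim h
  intro hTU
  exact hU.ne_zero (Ideal.Quotient.eq_zero_iff_mem.2 (Ideal.mem_span_singleton.2 hTU))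

/-- Over the completion, an element of a field extension of the residue field at `P` which is equal
to an element of the completion already lies in the residue field. -/
theorem mem_range_of_tmul_eq {A : Type*} [CommRing A] [IsLocalRing A] [IsNoetherianRing A]
    (P : Ideal A) [P.IsPrime] {E : Type*} [Field E] [Algebra A E] [Algebra P.ResidueField E]
    [IsScalarTower A P.ResidueField E] (γ : AdicCompletion (maximalIdeal A) A) (z : E)
    (h : γ ⊗ₜ[A] (1 : E) = 1 ⊗ₜ[A] z) : ∃ w, algebraMap P.ResidueField E w = z := by
  by_contra hz
  have hzW : z ∉ Submodule.span P.ResidueField {(1 : E)} := by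
    intro h1
    obtain ⟨w, hw⟩ := Submodule.mem_span_singleton.1 h1
    exact hz ⟨w, by rw [Algebra.algebraMap_eq_smul_one, hw]⟩
  obtain ⟨ℓ, hℓz, hℓ1⟩ := Submodule.exists_le_ker_of_notMem hzW
  have hℓ1 : ℓ 1 = 0 := hℓ1 (Submodule.mem_span_singleton_self _)
  have h1 := congrArg ((ℓ.restrictScalars A).lTensor (AdicCompletion (maximalIdeal A) A)) h
  simp only [LinearMap.lTensor_tmul, LinearMap.coe_restrictScalars, hℓ1, tmul_zero] at h1
  have h2 := congrArg ((LinearMap.mulLeft A (ℓ z)⁻¹).lTensor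
    (AdicCompletion (maximalIdeal A) A)) h1
  simp only [LinearMap.lTensor_tmul, LinearMap.mulLeft_apply, inv_mul_cancel₀ hℓz, map_zero] at h2
  let ι : A ⧸ P →ₗ[A] P.ResidueField :=
    (IsScalarTower.toAlgHom A (A ⧸ P) P.ResidueField).toLinearMap
  have h3 : (1 : AdicCompletion (maximalIdeal A) A) ⊗ₜ[A] (1 : A ⧸ P) = 0 := by
    refine Module.Flat.lTensor_preserves_injective_linearMap
      (M := AdicCompletion (maximalIdeal A) A) ι P.injective_algebraMap_quotient_residueField ?_
    rw [map_zero, LinearMap.lTensor_tmul, h2]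
    congr 1
    exact map_one (algebraMap (A ⧸ P) P.ResidueField)
  have h4 := congrArg (Algebra.TensorProduct.productMap
    (AdicCompletion.evalOneₐ (maximalIdeal A))
    (Ideal.Quotient.factorₐ A (le_maximalIdeal (Ideal.IsPrime.ne_top ‹P.IsPrime›)))) h3
  rw [Algebra.TensorProduct.productMap_apply_tmul, map_one, map_one, map_zero, one_mul] at h4
  exact one_ne_zero h4

/-- Over the completion of a G-ring `A`, an element of `A` which becomes a `p`-th power modulo `P`
is a `p`-th power in the residue field at `P`: otherwise the completion tensored with the
extension generated by a `p`-th root would not be reduced. -/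
theorem exists_pow_eq_of_isLocalGRing {A : Type u} [CommRing A] [IsLocalRing A]
    [IsNoetherianRing A] {p : ℕ} [Fact p.Prime] [CharP A p] (hG : IsLocalGRing A)
    (P : Ideal A) [P.IsPrime] {f T : A} (hT : T ∈ P)
    {γ g : AdicCompletion (maximalIdeal A) A}
    (hγ : γ ^ p - algebraMap A _ f = algebraMap A _ T * g) :
    ∃ w : P.ResidueField, w ^ p = algebraMap A _ f := by
  have hp := (Fact.out : p.Prime)
  by_contra! hw
  have : Fact (Irreducible (X ^ p - C (algebraMap A P.ResidueField f))) :=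
    ⟨X_pow_sub_C_irreducible_of_prime hp hw⟩
  let E := AdjoinRoot (X ^ p - C (algebraMap A P.ResidueField f))
  have hfin : FiniteDimensional P.ResidueField E :=
    (AdjoinRoot.powerBasis this.out.ne_zero).finite
  have hreg := hG P E
  have hred := isReduced_of_isRegularRing (AdicCompletion (maximalIdeal A) A ⊗[A] E)
  let z : E := AdjoinRoot.root _
  have hz : z ^ p = algebraMap A E f := by
    have h1 := AdjoinRoot.eval₂_root (X ^ p - C (algebraMap A P.ResidueField f))
    rw [eval₂_sub, eval₂_pow, eval₂_X, eval₂_C, sub_eq_zero] at h1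
    rw [IsScalarTower.algebraMap_apply A P.ResidueField E]
    exact h1
  have hTE : algebraMap A E T = 0 := by
    rw [IsScalarTower.algebraMap_apply A P.ResidueField E,
      Ideal.algebraMap_residueField_eq_zero.2 hT, map_zero]
  have hpC : ((p : ℕ) : AdicCompletion (maximalIdeal A) A ⊗[A] E) = 0 := by
    rw [← map_natCast (algebraMap A (AdicCompletion (maximalIdeal A) A ⊗[A] E)),
      CharP.cast_eq_zero, map_zero]
  have hsub : (γ ⊗ₜ[A] (1 : E) - 1 ⊗ₜ[A] z) ^ p = 0 := by
    rcases subsingleton_or_nontrivial (AdicCompletion (maximalIdeal A) A ⊗[A] E) with hS | hS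
    · exact Subsingleton.elim _ _
    have : CharP (AdicCompletion (maximalIdeal A) A ⊗[A] E) p :=
      (CharP.charP_iff_prime_eq_zero hp).2 hpC
    have h1 : ∀ a : A, algebraMap A (AdicCompletion (maximalIdeal A) A) a ⊗ₜ[A] (1 : E) =
        1 ⊗ₜ[A] algebraMap A E a := fun a =>
      (Algebra.TensorProduct.algebraMap_apply' a).symm.trans
        (Algebra.TensorProduct.algebraMap_apply a) |>.symm
    have h2 : (algebraMap A (AdicCompletion (maximalIdeal A) A) T * g) ⊗ₜ[A] (1 : E) = 0 := by
      rw [← one_mul (1 : E), ← Algebra.TensorProduct.tmul_mul_tmul, h1, hTE, tmul_zero, zero_mul]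
    rw [sub_pow_char, Algebra.TensorProduct.tmul_pow, Algebra.TensorProduct.tmul_pow, hz, one_pow,
      one_pow, sub_eq_iff_eq_add.1 hγ, add_tmul, h2, h1, zero_add, sub_self]
  obtain ⟨w, hw'⟩ :=
    mem_range_of_tmul_eq P γ z (sub_eq_zero.1 (pow_eq_zero_iff hp.ne_zero |>.1 hsub))
  refine hw w ((algebraMap P.ResidueField E).injective ?_)
  rw [map_pow, hw', hz, IsScalarTower.algebraMap_apply A P.ResidueField E]

/-- In a two-dimensional regular G-ring, a `p`-th power modulo `T` and all powers of `U` is a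
`p`-th power modulo `T`. -/
theorem exists_eq_pow_add_mul {A : Type u} [CommRing A] [IsDomain A] [IsRegularLocalRing A]
    (hdim : ringKrullDim A = 2) {p : ℕ} [Fact p.Prime] [CharP A p] (hG : IsLocalGRing A)
    {T U : A} (h : Ideal.span {T, U} = maximalIdeal A) {f : A}
    (hf : ∀ N : ℕ, ∃ γ, f - γ ^ p ∈ Ideal.span {T, U ^ N}) : ∃ b g, f = b ^ p + T * g := by
  have hp := (Fact.out : p.Prime)
  obtain ⟨_, hdvr, hU⟩ := isDiscreteValuationRing_quotient_of_span_pair_eq hdim h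
  have hspan : ∀ (x : A) (N : ℕ), x ∈ Ideal.span {T, U ^ N} ↔
      Ideal.Quotient.mk (Ideal.span {T}) U ^ N ∣ Ideal.Quotient.mk (Ideal.span {T}) x := by
    intro x N
    rw [Ideal.mem_span_pair]
    constructor
    · rintro ⟨a, b, rfl⟩
      refine ⟨Ideal.Quotient.mk _ b, ?_⟩
      simp [Ideal.Quotient.mk_singleton_self, mul_comm]
    · rintro ⟨b, hb⟩
      obtain ⟨b, rfl⟩ := Ideal.Quotient.mk_surjective b
      rw [← map_pow, ← map_mul, Ideal.Quotient.mk_eq_mk_iff_sub_mem,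
        Ideal.mem_span_singleton'] at hb
      obtain ⟨a, ha⟩ := hb
      exact ⟨a, b, by linear_combination ha⟩
  have hpA : CharP (A ⧸ Ideal.span {T}) p := by
    have : (Ideal.span {T}).IsPrime := (Ideal.Quotient.isDomain_iff_prime _).1 ‹_›
    exact charP_quotient _
  choose γ₀ hγ₀ using fun N => hf (p * N)
  have hstep : ∀ N, γ₀ (N + 1) - γ₀ N ∈ Ideal.span {T, U ^ N} := by
    intro N
    rw [hspan, ← IsIntegrallyClosed.pow_dvd_pow_iff hp.ne_zero, ← pow_mul, mul_comm N,
      ← map_pow _ (γ₀ (N + 1) - γ₀ N),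
      ← hspan, sub_pow_char]
    have h1 : f - γ₀ (N + 1) ^ p ∈ Ideal.span {T, U ^ (p * N)} := by
      refine (hspan _ _).2 (dvd_trans (pow_dvd_pow _ ?_) ((hspan _ _).1 (hγ₀ (N + 1))))
      exact Nat.mul_le_mul_left _ (Nat.le_succ _)
    have h2 := Ideal.sub_mem _ (hγ₀ N) h1
    convert h2 using 1
    ring
  choose a b hab using fun N => Ideal.mem_span_pair.1 (hstep N)
  let γ : ℕ → A := fun N => γ₀ 0 + ∑ i ∈ Finset.range N, b i * U ^ i
  have hγ : ∀ N, γ (N + 1) = γ N + b N * U ^ N := by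
    intro N
    simp only [γ, Finset.sum_range_succ]
    ring
  have hγT : ∀ N, ∃ s, γ N - γ₀ N = s * T := by
    intro N
    induction N with
    | zero => exact ⟨0, by simp [γ]⟩
    | succ N ih =>
      obtain ⟨s, hs⟩ := ih
      exact ⟨s - a N, by rw [hγ]; linear_combination hs + hab N⟩
  have hfγ : ∀ N, f - γ N ^ p ∈ Ideal.span {T, U ^ N} := by
    intro N
    obtain ⟨s, hs⟩ := hγT N
    have h1 : f - γ N ^ p = (f - γ₀ N ^ p) - (γ N - γ₀ N) ^ p := by rw [sub_pow_char]; ring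
    rw [h1]
    refine Ideal.sub_mem _ ?_ ?_
    · refine (hspan _ _).2 (dvd_trans (pow_dvd_pow _ ?_) ((hspan _ _).1 (hγ₀ N)))
      exact Nat.le_mul_of_pos_left _ hp.pos
    · rw [hs, mul_pow]
      refine Ideal.mul_mem_left _ _ (Ideal.pow_mem_of_mem _ (Ideal.subset_span (by simp)) _ hp.pos)
  choose g e hge using fun N => Ideal.mem_span_pair.1 (hfγ N)
  have hUp : Prime U :=
    prime_of_span_pair_eq hdim (by rw [Set.pair_comm, h] : Ideal.span {U, T} = _)
  have hUT : ¬ U ∣ T :=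
    not_dvd_of_span_pair_eq hdim (by rw [Set.pair_comm, h] : Ideal.span {U, T} = _)
  have hg : ∀ N, U ^ N ∣ g (N + 1) - g N := by
    intro N
    refine hUp.pow_dvd_of_dvd_mul_left N hUT (b := g (N + 1) - g N) ?_
    refine ⟨e N - e (N + 1) * U - b N ^ p * U ^ (N * (p - 1)), ?_⟩
    have h1 : (b N * U ^ N) ^ p = U ^ N * (b N ^ p * U ^ (N * (p - 1))) := by
      obtain ⟨q, hq⟩ : ∃ q, p = q + 1 := ⟨p - 1, by have := hp.pos; omega⟩
      rw [mul_pow, ← pow_mul, hq, Nat.add_sub_cancel]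
      ring
    have h2 : γ (N + 1) ^ p = γ N ^ p + (b N * U ^ N) ^ p := by rw [hγ, add_pow_char]
    rw [h1] at h2
    linear_combination hge (N + 1) - hge N - h2
  have hUm : ∀ N x, U ^ N ∣ x → x ∈ (maximalIdeal A ^ N • ⊤ : Submodule A A) := by
    intro N x hx
    rw [smul_eq_mul, Ideal.mul_top]
    exact Ideal.mem_of_dvd _ hx (Ideal.pow_mem_pow (h ▸ Ideal.subset_span (by simp)) _)
  let γc : AdicCompletion.AdicCauchySequence (maximalIdeal A) A :=
    AdicCompletion.AdicCauchySequence.mk _ _ γ fun N => SModEq.symm (SModEq.sub_mem.2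
      (hUm N _ (by rw [hγ]; exact ⟨b N, by ring⟩)))
  let gc : AdicCompletion.AdicCauchySequence (maximalIdeal A) A :=
    AdicCompletion.AdicCauchySequence.mk _ _ g fun N => SModEq.symm (SModEq.sub_mem.2
      (hUm N _ (hg N)))
  have key : AdicCompletion.mkₐ _ γc ^ p - algebraMap A _ f =
      algebraMap A _ T * AdicCompletion.mkₐ _ (-gc) := by
    refine AdicCompletion.ext_evalₐ fun N => ?_
    rw [map_sub, map_mul, map_pow, AdicCompletion.evalₐ_mkₐ, AdicCompletion.evalₐ_mkₐ,
      AlgHom.commutes, AlgHom.commutes]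
    change Ideal.Quotient.mk _ (γ N) ^ p - Ideal.Quotient.mk _ f =
      Ideal.Quotient.mk _ T * Ideal.Quotient.mk _ (-g N)
    rw [← map_pow, ← map_mul, ← map_sub, Ideal.Quotient.mk_eq_mk_iff_sub_mem]
    refine Ideal.mem_of_dvd _ (⟨-e N, ?_⟩ : U ^ N ∣ _)
      (Ideal.pow_mem_pow (h ▸ Ideal.subset_span (by simp)) _)
    linear_combination hge N
  have hPp : (Ideal.span {T}).IsPrime := (Ideal.Quotient.isDomain_iff_prime _).1 ‹_›
  obtain ⟨w, hw⟩ := exists_pow_eq_of_isLocalGRing hG (Ideal.span {T})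
    (Ideal.mem_span_singleton_self T) key
  have hwi : IsIntegral (A ⧸ Ideal.span {T}) w := by
    refine IsIntegral.of_pow hp.pos ?_
    rw [hw, IsScalarTower.algebraMap_apply A (A ⧸ Ideal.span {T})]
    exact isIntegral_algebraMap
  obtain ⟨v, hv⟩ := IsIntegrallyClosed.isIntegral_iff.1 hwi
  obtain ⟨b, rfl⟩ := Ideal.Quotient.mk_surjective v
  have h1 : Ideal.Quotient.mk (Ideal.span {T}) (b ^ p) = Ideal.Quotient.mk (Ideal.span {T}) f := by
    refine IsFractionRing.injective (A ⧸ Ideal.span {T}) (Ideal.span {T}).ResidueField ?_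
    rw [map_pow, map_pow, hv, hw, IsScalarTower.algebraMap_apply A (A ⧸ Ideal.span {T})]
    rfl
  rw [eq_comm, Ideal.Quotient.mk_eq_mk_iff_sub_mem, Ideal.mem_span_singleton] at h1
  obtain ⟨g, hg⟩ := h1
  exact ⟨b, g, by linear_combination hg⟩

end GRing

/-! ### Regular curves on a regular surface -/

section Curves

open IsLocalRing

variable {A : Type*} [CommRing A]

/-- The intersection number with a principal divisor is an order of vanishing. -/
theorem intersectionNumber_eq_ord {T : A} (P Q : PrimeSpectrum A)
    (hQ : Q.asIdeal = Ideal.span {T}) :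
    intersectionNumber P Q = Ring.ord (A ⧸ P.asIdeal) (Ideal.Quotient.mk P.asIdeal T) := by
  unfold intersectionNumber
  have h1 := (DoubleQuot.quotQuotEquivQuotSupₐ A P.asIdeal Q.asIdeal).toLinearEquiv.length_eq
  have h2 : Q.asIdeal.map (Ideal.Quotient.mkₐ A P.asIdeal) =
      Ideal.span {Ideal.Quotient.mk P.asIdeal T} := by
    rw [hQ, Ideal.map_span, Set.image_singleton]; rfl
  rw [h2] at h1
  rw [← h1, Ring.ord]
  exact Module.length_eq_of_surjective Ideal.Quotient.mk_surjective

theorem intersectionNumber_eq_of_mk_eq {T : A} {P Q : PrimeSpectrum A}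
    [IsDiscreteValuationRing (A ⧸ P.asIdeal)] (hQ : Q.asIdeal = Ideal.span {T})
    {t w : A ⧸ P.asIdeal} (ht : Irreducible t) (hw : IsUnit w) {r : ℕ}
    (h : Ideal.Quotient.mk P.asIdeal T = w * t ^ r) : intersectionNumber P Q = r := by
  rw [intersectionNumber_eq_ord P Q hQ, h, Ring.ord_mul_of_isUnit_left hw,
    Ring.ord_pow (mem_nonZeroDivisors_of_ne_zero ht.ne_zero), Ring.ord_of_irreducible ht]
  simp

theorem exists_mk_eq_of_intersectionNumber_eq {T : A} {P Q : PrimeSpectrum A}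
    [IsDiscreteValuationRing (A ⧸ P.asIdeal)] (hQ : Q.asIdeal = Ideal.span {T})
    (hT : T ∉ P.asIdeal) {t : A ⧸ P.asIdeal} (ht : Irreducible t) {r : ℕ}
    (h : intersectionNumber P Q = r) :
    ∃ w, IsUnit w ∧ Ideal.Quotient.mk P.asIdeal T = w * t ^ r := by
  obtain ⟨k, w, hk⟩ := IsDiscreteValuationRing.eq_unit_mul_pow_irreducible
    (x := Ideal.Quotient.mk P.asIdeal T) (fun h0 => hT (Ideal.Quotient.eq_zero_iff_mem.1 h0)) ht
  rw [intersectionNumber_eq_of_mk_eq hQ ht w.isUnit hk] at h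
  obtain rfl : k = r := by exact_mod_cast h
  exact ⟨w, w.isUnit, hk⟩

theorem isDiscreteValuationRing_of_mem_Spec₁ {P : PrimeSpectrum A} (hP : P ∈ Spec₁ A)
    [IsRegularLocalRing (A ⧸ P.asIdeal)] : IsDiscreteValuationRing (A ⧸ P.asIdeal) :=
  isDiscreteValuationRing_of_isRegularLocalRing _ hP

/-- On a regular curve meeting the curve `T = 0` with multiplicity at least two, the other local
parameter `U` is a uniformizer. -/
theorem irreducible_mk_of_sq_dvd [IsLocalRing A] {T U : A} (h : Ideal.span {T, U} = maximalIdeal A)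
    (P : Ideal A) [P.IsPrime] [IsDiscreteValuationRing (A ⧸ P)] {t : A ⧸ P} (ht : Irreducible t)
    (hT : t ^ 2 ∣ Ideal.Quotient.mk P T) : Irreducible (Ideal.Quotient.mk P U) := by
  have h1 : Ideal.span {t} = Ideal.span {Ideal.Quotient.mk P T, Ideal.Quotient.mk P U} := by
    rw [← (IsDiscreteValuationRing.irreducible_iff_uniformizer _).1 ht,
      ← IsLocalRing.map_maximalIdeal_of_surjective _ (Ideal.Quotient.mk_surjective (I := P)), ← h,
      Ideal.map_span, Set.image_pair]
  obtain ⟨s, hs⟩ := hT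
  obtain ⟨a, b, hab⟩ := Ideal.mem_span_pair.1 (h1 ▸ Ideal.mem_span_singleton_self t)
  have hU : t ∣ Ideal.Quotient.mk P U := Ideal.mem_span_singleton.1
    (h1 ▸ Ideal.subset_span (by simp))
  obtain ⟨v, hv⟩ := hU
  rw [hs, hv] at hab
  have h2 : t * (a * t * s + b * v) = t * 1 := by linear_combination hab
  have h3 := mul_left_cancel₀ ht.ne_zero h2
  have hvu : IsUnit v := by
    by_contra hvn
    have hv' : v ∈ maximalIdeal (A ⧸ P) := hvn
    have ht' : t ∈ maximalIdeal (A ⧸ P) := ht.not_isUnit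
    refine (Ideal.ne_top_iff_one _).1 (maximalIdeal.isMaximal (A ⧸ P)).ne_top ?_
    rw [← h3]
    exact Ideal.add_mem _ (Ideal.mul_mem_right _ _ (Ideal.mul_mem_left _ _ ht'))
      (Ideal.mul_mem_left _ _ hv')
  rw [hv]
  exact (irreducible_mul_isUnit hvu).2 ht

variable [IsDomain A] [IsRegularLocalRing A]

theorem notMem_of_mem_Spec₁ (hdim : ringKrullDim A = 2) {P Q : PrimeSpectrum A}
    (hP : P ∈ Spec₁ A) (hQ : Q ∈ Spec₁ A) (hPQ : P ≠ Q) {T : A}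
    (hT : Q.asIdeal = Ideal.span {T}) : T ∉ P.asIdeal := by
  intro hTP
  obtain ⟨f, hf, hPf⟩ := exists_eq_span_of_mem_Spec₁ hdim hP
  obtain ⟨g, hg, hQg⟩ := exists_eq_span_of_mem_Spec₁ hdim hQ
  refine hPQ (PrimeSpectrum.ext ?_)
  have h1 : Q.asIdeal ≤ P.asIdeal := by rw [hT]; exact (Ideal.span_singleton_le_iff_mem _).2 hTP
  rw [hPf, hQg, Ideal.span_singleton_le_span_singleton] at h1
  rw [hPf, hQg, Ideal.span_singleton_eq_span_singleton]
  exact hf.associated_of_dvd hg h1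

/-- The regular curve with equation `T`, a member of a regular system of parameters. -/
theorem exists_curve_of_span_pair_eq (hdim : ringKrullDim A = 2) {T U : A}
    (h : Ideal.span {T, U} = maximalIdeal A) :
    ∃ P : PrimeSpectrum A, P.asIdeal = Ideal.span {T} ∧ P ∈ Spec₁ A ∧
      IsRegularLocalRing (A ⧸ P.asIdeal) ∧ IsDiscreteValuationRing (A ⧸ P.asIdeal) ∧
      Irreducible (Ideal.Quotient.mk P.asIdeal U) := by
  obtain ⟨hdom, hdvr, hirr⟩ := isDiscreteValuationRing_quotient_of_span_pair_eq hdim h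
  have hTm : T ∈ maximalIdeal A := h ▸ Ideal.subset_span (by simp)
  exact ⟨⟨Ideal.span {T}, (Ideal.Quotient.isDomain_iff_prime _).1 hdom⟩, rfl,
    ringKrullDim_quotient_span_singleton hdim (ne_zero_of_span_pair_eq hdim h) hTm,
    isRegularLocalRing_quotient_of_span_pair_eq hdim h, hdvr, hirr⟩

end Curves

/-! ### Normal forms of Artin–Schreier generators -/

section NormalForm

open IsLocalRing IntermediateField

variable {A : Type*} [CommRing A] {K : Type*} [Field K] [Algebra A K]
  {L : Type*} [Field L] [Algebra A L] {p : ℕ}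

variable (L) in
/-- `a = c / (T ^ m U ^ n)` with poles of exact order `m ≥ 1` along `T` and, if the branch divisor
has two components, `n ≥ 1` along `U`. For one component, `n = 0`. -/
structure IsNormalForm (T U : A) (a : K) (m n : ℕ) (c : A) : Prop where
  one_le : 1 ≤ m
  not_dvd : ¬ T ∣ c
  eq_zero : (branchPrimes A L).encard ≠ 2 → n = 0
  snd : (branchPrimes A L).encard = 2 → 1 ≤ n ∧ ¬ U ∣ c
  eq : algebraMap A K (T ^ m * U ^ n) * a = algebraMap A K c

/-- Elements of `A[T⁻¹]`, respectively `A[T⁻¹, U⁻¹]`, as fractions. -/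
theorem exists_eq_of_mem_adjoin {T U : A} (hT : algebraMap A K T ≠ 0) (hU : algebraMap A K U ≠ 0)
    {q : Prop} {a : K} (ha : a ∈ Algebra.adjoin A {y : K | y = (algebraMap A K T)⁻¹ ∨
      (q ∧ y = (algebraMap A K U)⁻¹)}) :
    ∃ (i j : ℕ) (c : A), (¬ q → j = 0) ∧ algebraMap A K (T ^ i * U ^ j) * a = algebraMap A K c := by
  induction ha using Algebra.adjoin_induction with
  | mem y hy =>
    rcases hy with rfl | ⟨hq, rfl⟩
    · exact ⟨1, 0, 1, fun _ => rfl, by simp [hT]⟩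
    · exact ⟨0, 1, 1, fun h => (h hq).elim, by simp [hU]⟩
  | algebraMap r => exact ⟨0, 0, r, fun _ => rfl, by simp⟩
  | add x y _ _ hx hy =>
    obtain ⟨i, j, c, hj, h⟩ := hx
    obtain ⟨i', j', c', hj', h'⟩ := hy
    refine ⟨i + i', j + j', c * (T ^ i' * U ^ j') + c' * (T ^ i * U ^ j),
      fun h => by rw [hj h, hj' h], ?_⟩
    rw [mul_add, map_add, map_mul _ c, map_mul _ c', ← h, ← h']
    simp only [map_mul, map_pow]
    ring
  | mul x y _ _ hx hy =>
    obtain ⟨i, j, c, hj, h⟩ := hx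
    obtain ⟨i', j', c', hj', h'⟩ := hy
    refine ⟨i + i', j + j', c * c', fun h => by rw [hj h, hj' h], ?_⟩
    rw [map_mul _ c, ← h, ← h']
    simp only [map_mul, map_pow]
    ring

theorem mem_adjoin_of_eq {T U : A} (hT : algebraMap A K T ≠ 0) (hU : algebraMap A K U ≠ 0)
    {q : Prop} {i j : ℕ} (hq : ¬ q → j = 0) {a : K} {c : A}
    (h : algebraMap A K (T ^ i * U ^ j) * a = algebraMap A K c) :
    a ∈ Algebra.adjoin A {y : K | y = (algebraMap A K T)⁻¹ ∨ (q ∧ y = (algebraMap A K U)⁻¹)} := by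
  have h1 : a = algebraMap A K c * (algebraMap A K T)⁻¹ ^ i * (algebraMap A K U)⁻¹ ^ j := by
    rw [← h, map_mul, map_pow, map_pow, inv_pow, inv_pow]
    field_simp
  have hS : ∀ {y : K}, (y = (algebraMap A K T)⁻¹ ∨ (q ∧ y = (algebraMap A K U)⁻¹)) →
      y ∈ Algebra.adjoin A {y : K | y = (algebraMap A K T)⁻¹ ∨ (q ∧ y = (algebraMap A K U)⁻¹)} :=
    fun h => Algebra.subset_adjoin h
  rw [h1]
  refine mul_mem (mul_mem (Subalgebra.algebraMap_mem _ _)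
    (Subalgebra.pow_mem _ (hS (Or.inl rfl)) _)) ?_
  by_cases hq' : q
  · exact Subalgebra.pow_mem _ (hS (Or.inr ⟨hq', rfl⟩)) _
  · rw [hq hq', pow_zero]; exact one_mem _

theorem HasOrder.unique [IsDomain A] [IsFractionRing A K] {T : A} (hT : Prime T) {a : K} {z z' : ℤ}
    (h : HasOrder T a z) (h' : HasOrder T a z') : z = z' := by
  have hinj := IsFractionRing.injective A K
  have hT0 : algebraMap A K T ≠ 0 := fun h => hT.ne_zero (hinj (h.trans (map_zero _).symm))
  have key : ∀ {z z' : ℤ}, HasOrder T a z → HasOrder T a z' → z ≤ z' := by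
    rintro z z' ⟨b, s, hb, hs, h⟩ ⟨b', s', hb', hs', h'⟩
    by_contra! hlt
    obtain ⟨k, hk⟩ : ∃ k : ℕ, z = z' + (k + 1 : ℕ) := ⟨(z - z' - 1).toNat, by omega⟩
    have h1 : algebraMap A K (T ^ (k + 1) * (b * s')) = algebraMap A K (b' * s) := by
      have h2 : algebraMap A K T ^ z' ≠ 0 := zpow_ne_zero _ hT0
      rw [hk, zpow_add₀ hT0, zpow_natCast] at h
      apply mul_left_cancel₀ h2
      simp only [map_mul, map_pow]
      linear_combination algebraMap A K s * h' - algebraMap A K s' * h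
    have h3 : T ∣ b' * s := ⟨T ^ k * (b * s'), by rw [← hinj h1]; ring⟩
    exact (hT.dvd_or_dvd h3).elim hb' hs
  exact le_antisymm (key h h') (key h' h)

theorem IsNormalForm.hasOrder [IsDomain A] [IsFractionRing A K] {T U : A} (hT : Prime T)
    (hTU : ¬ T ∣ U) {a : K} {m n : ℕ} {c : A} (h : IsNormalForm L T U a m n c) :
    HasOrder T a (-(m : ℤ)) := by
  have hT0 : algebraMap A K T ≠ 0 := fun h =>
    hT.ne_zero (IsFractionRing.injective A K (h.trans (map_zero _).symm))
  refine ⟨c, U ^ n, h.not_dvd, fun h1 => hTU (hT.dvd_of_dvd_pow h1), ?_⟩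
  rw [← h.eq, map_mul, map_pow, map_pow, zpow_neg, zpow_natCast]
  field_simp

theorem IsNormalForm.hasOrder_snd [IsDomain A] [IsFractionRing A K] {T U : A} (hU : Prime U)
    (hUT : ¬ U ∣ T) {a : K} {m n : ℕ} {c : A} (h : IsNormalForm L T U a m n c)
    (h2 : (branchPrimes A L).encard = 2) : HasOrder U a (-(n : ℤ)) := by
  have hU0 : algebraMap A K U ≠ 0 := fun h =>
    hU.ne_zero (IsFractionRing.injective A K (h.trans (map_zero _).symm))
  refine ⟨c, T ^ m, (h.snd h2).2, fun h1 => hUT (hU.dvd_of_dvd_pow h1), ?_⟩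
  rw [← h.eq, map_mul, map_pow, map_pow, zpow_neg, zpow_natCast]
  field_simp

section Branch

variable {P₁ : PrimeSpectrum A}

theorem mem_branchPrimes_iff_of_encard_ne (h2 : (branchPrimes A L).encard ≠ 2)
    (hle : (branchPrimes A L).encard ≤ 2) (hP₁ : P₁ ∈ branchPrimes A L) {P : PrimeSpectrum A}
    (hP : P ∈ branchPrimes A L) : P = P₁ := by
  by_contra hne
  refine h2 (le_antisymm hle ?_)
  rw [← Set.encard_pair hne]
  exact Set.encard_le_encard (Set.insert_subset hP (Set.singleton_subset_iff.2 hP₁))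

theorem exists_ne_of_encard_eq (h2 : (branchPrimes A L).encard = 2)
    (P₁ : PrimeSpectrum A) : ∃ P ∈ branchPrimes A L, P ≠ P₁ := by
  obtain ⟨x, y, hxy, hB⟩ := Set.encard_eq_two.1 h2
  by_cases hx : x = P₁
  · exact ⟨y, by simp [hB], fun h => hxy (hx.trans h.symm)⟩
  · exact ⟨x, by simp [hB], hx⟩

variable [Algebra K L] [IsIntegrallyClosed A] [IsFractionRing A K]
  [IsScalarTower A K L] [IsGalois K L] [Fact p.Prime] [CharP A p]

theorem notMem_branchPrimes (hdeg : Module.finrank K L = p) {x : L} {a : K} {D c : A}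
    (hx : x ^ p - x = algebraMap K L a) (hgen : K⟮x⟯ = ⊤)
    (hc : algebraMap A K D * a = algebraMap A K c) {P : PrimeSpectrum A} (hDP : D ∉ P.asIdeal) :
    P ∉ branchPrimes A L := by
  rintro ⟨-, Q, hQ, hQ'⟩
  exact hQ' (isUnramifiedAt_of_notMem hdeg hx hgen hc P.asIdeal hDP Q.asIdeal)

end Branch

variable [IsDomain A] [IsRegularLocalRing A] [Algebra K L] [IsFractionRing A K]
  [IsScalarTower A K L] [IsGalois K L] [Fact p.Prime] [CharP A p] {P₁ : PrimeSpectrum A} {T U : A}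

/-- The normal form exists since `A` is factorial. The poles are genuine because each component of
the branch divisor is ramified, while a generator regular along a component is unramified there. -/
theorem exists_isNormalForm (hdim : ringKrullDim A = 2) (hdeg : Module.finrank K L = p)
    (hP₁ : P₁ ∈ branchPrimes A L)
    (hTU : IsAdapted L P₁ T U) {a : K} (ha : IsArtinSchreier L p T U a) :
    ∃ m n c, IsNormalForm L T U a m n c := by
  have := uniqueFactorizationMonoid_of_ringKrullDim_eq_two hdim
  obtain ⟨hm, hT1, hU2⟩ := hTU
  have hm' : Ideal.span {U, T} = maximalIdeal A := by rw [Set.pair_comm, hm]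
  have hT := prime_of_span_pair_eq hdim hm
  have hU := prime_of_span_pair_eq hdim hm'
  have hTU := not_dvd_of_span_pair_eq hdim hm
  have hUT := not_dvd_of_span_pair_eq hdim hm'
  have hinj := IsFractionRing.injective A K
  have hT0 : algebraMap A K T ≠ 0 := fun h => hT.ne_zero (hinj (h.trans (map_zero _).symm))
  have hU0 : algebraMap A K U ≠ 0 := fun h => hU.ne_zero (hinj (h.trans (map_zero _).symm))
  obtain ⟨⟨x, hgen, hx⟩, ha⟩ := ha
  obtain ⟨i, j, c, hj, hc⟩ := exists_eq_of_mem_adjoin hT0 hU0 ha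
  have hc0 : c ≠ 0 := by
    rintro rfl
    have ha0 : a = 0 := by
      rw [map_zero, mul_eq_zero] at hc
      exact hc.resolve_left (by simp [hT0, hU0])
    refine notMem_branchPrimes hdeg hx hgen (D := 1) (c := 0) (by simp [ha0]) (P := P₁) ?_ hP₁
    exact (Ideal.ne_top_iff_one _).1 P₁.2.ne_top
  obtain ⟨α, c₁, hc₁, rfl⟩ := WfDvdMonoid.max_power_factor hc0 hT.irreducible
  obtain ⟨β, c₂, hc₂, rfl⟩ := WfDvdMonoid.max_power_factor (right_ne_zero_of_mul hc0) hU.irreducible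
  have hαi : α < i := by
    by_contra! hle
    obtain ⟨k, rfl⟩ := Nat.exists_eq_add_of_le hle
    refine notMem_branchPrimes hdeg hx hgen (D := U ^ j) (c := T ^ k * (U ^ β * c₂)) (P := P₁)
      (mul_left_cancel₀ (pow_ne_zero i hT0) ?_) ?_ hP₁
    · simp only [map_mul, map_pow] at hc ⊢
      rw [← mul_assoc, hc]; ring
    · rw [← hT1, Ideal.mem_span_singleton]
      exact fun h => hTU (hT.dvd_of_dvd_pow h)
  obtain ⟨m, rfl⟩ := Nat.exists_eq_add_of_lt hαi
  have hc' : algebraMap A K (T ^ (m + 1) * U ^ j) * a = algebraMap A K (U ^ β * c₂) := by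
    refine mul_left_cancel₀ (pow_ne_zero α hT0) ?_
    simp only [map_mul, map_pow] at hc ⊢
    rw [← hc]; ring
  by_cases h2 : (branchPrimes A L).encard = 2
  · obtain ⟨P₂, hP₂, hne⟩ := exists_ne_of_encard_eq h2 P₁
    have hβj : β < j := by
      by_contra! hle
      obtain ⟨k, rfl⟩ := Nat.exists_eq_add_of_le hle
      refine notMem_branchPrimes hdeg hx hgen (D := T ^ (m + 1)) (c := U ^ k * c₂) (P := P₂)
        (mul_left_cancel₀ (pow_ne_zero j hU0) ?_) ?_ hP₂
      · simp only [map_mul, map_pow] at hc' ⊢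
        linear_combination hc'
      · rw [← hU2 P₂ hP₂ hne, Ideal.mem_span_singleton]
        exact fun h => hUT (hU.dvd_of_dvd_pow h)
    obtain ⟨n, rfl⟩ := Nat.exists_eq_add_of_lt hβj
    refine ⟨m + 1, n + 1, c₂, by omega, fun h => hc₁ (h.mul_left _), fun h => (h h2).elim,
      fun _ => ⟨by omega, hc₂⟩, mul_left_cancel₀ (pow_ne_zero β hU0) ?_⟩
    simp only [map_mul, map_pow] at hc' ⊢
    rw [← hc']; ring
  · rw [hj h2] at hc'
    exact ⟨m + 1, 0, U ^ β * c₂, by omega, hc₁, fun _ => rfl, fun h => (h2 h).elim, hc'⟩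

/-- There is a generator with poles only along the branch divisor: the primes that contain neither
of its equations are unramified, the maximal ideal not being among them. -/
theorem exists_isArtinSchreier (hdim : ringKrullDim A = 2) (hdeg : Module.finrank K L = p)
    (hle : (branchPrimes A L).encard ≤ 2) (hP₁ : P₁ ∈ branchPrimes A L)
    (hTU : IsAdapted L P₁ T U) : ∃ a : K, IsArtinSchreier L p T U a := by
  have := uniqueFactorizationMonoid_of_ringKrullDim_eq_two hdim
  obtain ⟨hm, hT1, hU2⟩ := hTU
  have hm' : Ideal.span {U, T} = maximalIdeal A := by rw [Set.pair_comm, hm]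
  have hT := prime_of_span_pair_eq hdim hm
  have hU := prime_of_span_pair_eq hdim hm'
  have hinj := IsFractionRing.injective A K
  have hT0 : algebraMap A K T ≠ 0 := fun h => hT.ne_zero (hinj (h.trans (map_zero _).symm))
  have hU0 : algebraMap A K U ≠ 0 := fun h => hU.ne_zero (hinj (h.trans (map_zero _).symm))
  have hTm : T ∈ maximalIdeal A := hm ▸ Ideal.subset_span (by simp)
  obtain ⟨e, he, heB⟩ : ∃ e : ℕ, ((branchPrimes A L).encard ≠ 2 → e = 0) ∧
      ∀ P ∈ branchPrimes A L, T * U ^ e ∈ P.asIdeal := by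
    by_cases h2 : (branchPrimes A L).encard = 2
    · refine ⟨1, fun h => (h h2).elim, fun P hP => ?_⟩
      by_cases hPP : P = P₁
      · rw [hPP, ← hT1]
        exact Ideal.mul_mem_right _ _ (Ideal.mem_span_singleton_self T)
      · rw [← hU2 P hP hPP, pow_one]
        exact Ideal.mul_mem_left _ _ (Ideal.mem_span_singleton_self U)
    · refine ⟨0, fun _ => rfl, fun P hP => ?_⟩
      rw [mem_branchPrimes_iff_of_encard_ne h2 hle hP₁ hP, ← hT1]
      exact Ideal.mul_mem_right _ _ (Ideal.mem_span_singleton_self T)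
  obtain ⟨x, a, c, N, hx, hgen, hc⟩ := exists_generator (K := K) (L := L) hdeg (E := T * U ^ e)
    (mul_ne_zero hT.ne_zero (pow_ne_zero _ hU.ne_zero)) (by
      intro P hP0 hEP Q hQ
      by_contra hQ'
      refine hEP (heB P ⟨(mem_Spec₁_iff hdim P).2 ⟨hP0, fun h => hEP ?_⟩, Q, hQ, hQ'⟩)
      rw [h]
      exact Ideal.mul_mem_right _ _ hTm)
  refine ⟨a, ⟨x, hgen, hx⟩, mem_adjoin_of_eq hT0 hU0 (i := N) (j := e * N) (c := c)
    (fun h => by rw [he h, zero_mul]) ?_⟩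
  rw [← hc, mul_pow, pow_mul]

/-- If the leading coefficient of `a` along `T` is a `p`-th power up to a power of `U`, the pole of
`a` along `T` can be lowered by subtracting some `y ^ p - y`. -/
theorem exists_lt_of_eq_pow_add_mul (hdim : ringKrullDim A = 2) (hdeg : Module.finrank K L = p)
    (hP₁ : P₁ ∈ branchPrimes A L)
    (hTU : IsAdapted L P₁ T U) {a : K} (ha : IsArtinSchreier L p T U a) {m n : ℕ} {c : A}
    (h : IsNormalForm L T U a m n c) (hpm : p ∣ m) {b g : A}
    (hc : c * U ^ ((p - 1) * n) = b ^ p + T * g) :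
    ∃ (a' : K) (m' n' : ℕ) (c' : A), IsArtinSchreier L p T U a' ∧
      IsNormalForm L T U a' m' n' c' ∧ m' < m := by
  have hp := (Fact.out : p.Prime)
  have hTU' := hTU
  obtain ⟨hm, hT1, hU2⟩ := hTU'
  have hm' : Ideal.span {U, T} = maximalIdeal A := by rw [Set.pair_comm, hm]
  have hT := prime_of_span_pair_eq hdim hm
  have hU := prime_of_span_pair_eq hdim hm'
  have hTU0 := not_dvd_of_span_pair_eq hdim hm
  have hinj := IsFractionRing.injective A K
  have hT0 : algebraMap A K T ≠ 0 := fun h => hT.ne_zero (hinj (h.trans (map_zero _).symm))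
  have hU0 : algebraMap A K U ≠ 0 := fun h => hU.ne_zero (hinj (h.trans (map_zero _).symm))
  obtain ⟨q, hq⟩ := hpm
  have hq0 : 1 ≤ q := by
    rcases Nat.eq_zero_or_pos q with rfl | h0
    · have := h.one_le; omega
    · exact h0
  have hqm : q + 1 ≤ m := by
    rw [hq]
    have := Nat.mul_le_mul_right q hp.two_le
    omega
  -- With `m = p q`, the `p`-th power of `y = b / (T ^ q U ^ n)` cancels the leading term of `a`.
  obtain ⟨y, hy⟩ : ∃ y : K, algebraMap A K (T ^ q * U ^ n) * y = algebraMap A K b :=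
    ⟨algebraMap A K b / algebraMap A K (T ^ q * U ^ n), mul_div_cancel₀ _ (by
      rw [map_mul, map_pow, map_pow]; exact mul_ne_zero (pow_ne_zero _ hT0) (pow_ne_zero _ hU0))⟩
  have hyS := mem_adjoin_of_eq (q := (branchPrimes A L).encard = 2) hT0 hU0 h.eq_zero hy
  obtain ⟨⟨x, hgen, hx⟩, haS⟩ := ha
  have : CharP K p := charP_of_injective_algebraMap hinj p
  have : CharP L p := charP_of_injective_algebraMap (algebraMap K L).injective p
  have ha' : IsArtinSchreier L p T U (a - (y ^ p - y)) := by
    refine ⟨⟨x - algebraMap K L y, ?_, ?_⟩, sub_mem haS (sub_mem (pow_mem hyS p) hyS)⟩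
    · rw [eq_top_iff, ← hgen, adjoin_simple_le_iff]
      have h1 := add_mem (mem_adjoin_simple_self K (x - algebraMap K L y))
        (_root_.algebraMap_mem (K⟮x - algebraMap K L y⟯) y)
      rwa [sub_add_cancel] at h1
    · rw [map_sub, ← hx, sub_pow_char, map_sub, map_pow]
      ring
  obtain ⟨m', n', c', h'⟩ := exists_isNormalForm hdim hdeg hP₁ hTU ha'
  refine ⟨_, m', n', c', ha', h', ?_⟩
  by_contra! hle
  obtain ⟨s, hs⟩ : ∃ s : A, algebraMap A K (T ^ (m - 1) * U ^ (p * n)) * (a - (y ^ p - y)) =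
      algebraMap A K s := by
    refine ⟨g + b * T ^ (m - 1 - q) * U ^ ((p - 1) * n), mul_left_cancel₀ hT0 ?_⟩
    have hpn : p * n = (p - 1) * n + n := by
      obtain ⟨k, hk⟩ : ∃ k, p = k + 1 := ⟨p - 1, by have := hp.pos; omega⟩
      rw [hk, Nat.add_sub_cancel]; ring
    have h1 : algebraMap A K T ^ m * algebraMap A K U ^ n * a = algebraMap A K c := by
      rw [← h.eq, map_mul, map_pow, map_pow]
    have h2 : algebraMap A K T ^ m * algebraMap A K U ^ (p * n) * y ^ p = algebraMap A K b ^ p := by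
      rw [← hy, mul_pow, map_mul, map_pow, map_pow, mul_pow, ← pow_mul, ← pow_mul, hq,
        mul_comm q, mul_comm n]
    have h3 : algebraMap A K T ^ q * algebraMap A K U ^ n * y = algebraMap A K b := by
      rw [← hy, map_mul, map_pow, map_pow]
    have h4 := congrArg (algebraMap A K) hc
    obtain ⟨k, hk⟩ := Nat.exists_eq_add_of_le hqm
    have hk1 : m - 1 = q + k := by omega
    have hk2 : m - 1 - q = k := by omega
    simp only [map_mul, map_add, map_pow] at h4 ⊢
    rw [hk2, hk1]
    rw [hk] at h1 h2
    rw [hpn] at h2 ⊢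
    rw [pow_add _ ((p - 1) * n)] at h2 ⊢
    linear_combination algebraMap A K U ^ ((p - 1) * n) * h1 - h2 + h4 +
      algebraMap A K U ^ ((p - 1) * n) * algebraMap A K T ^ (k + 1) * h3
  obtain ⟨k, hk⟩ := Nat.exists_eq_add_of_le hle
  have h5 : algebraMap A K (T ^ (k + 1) * (s * U ^ n')) = algebraMap A K (c' * U ^ (p * n)) := by
    rw [map_mul _ c', ← h'.eq, map_mul, map_mul _ s, ← hs]
    have : m' = m - 1 + (k + 1) := by have := h.one_le; omega
    rw [this]
    simp only [map_mul, map_pow]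
    ring
  have h6 : T ∣ c' * U ^ (p * n) := ⟨T ^ k * (s * U ^ n'), by rw [← hinj h5]; ring⟩
  exact (hT.dvd_or_dvd h6).elim h'.not_dvd fun h => hTU0 (hT.dvd_of_dvd_pow h)

end NormalForm

/-! ### Restriction of a generator to a regular curve -/

section Restriction

open IsLocalRing

/-- Separating the terms of the expansion of `c` of degree less than `j` as `p`-th powers. -/
theorem exists_leading_form {A : Type*} [CommRing A] [IsLocalRing A] {p : ℕ} [Fact p.Prime]
    [CharP A p] [IsAlgClosed (ResidueField A)] {T U : A}
    (h : Ideal.span {T, U} = maximalIdeal A) {c : A} {θ : ℕ → ResidueField A}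
    (hθ : ∀ N : ℕ,
      c - ∑ j ∈ Finset.range N, canonicalSection A p N (θ j) * U ^ j ∈ Ideal.span {T, U ^ N})
    {j : ℕ} (hj : θ j ≠ 0) (q : ℕ → Prop) [DecidablePred q] (h0 : ∀ i < j, ¬ q i → θ i = 0) :
    ∃ (μ : ℕ → A) (l g : A), IsUnit l ∧
      c = ∑ i ∈ (Finset.range j).filter q, μ i ^ p * U ^ i + l * U ^ j + T * g := by
  have hp := (Fact.out : p.Prime)
  have hle : maximalIdeal A ^ p ^ (j + 1) ≤ Ideal.span {T, U ^ (j + 1)} :=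
    (Ideal.pow_le_pow_right (Nat.lt_pow_self hp.one_lt).le).trans
      (maximalIdeal_pow_le_span_pair h _)
  choose ρ hρ using fun x : ResidueField A => IsAlgClosed.exists_pow_nat_eq x hp.pos
  have h1 : ∑ i ∈ Finset.range j, (canonicalSection A p (j + 1) (θ i) * U ^ i -
      if q i then canonicalSection A p (j + 1) (ρ (θ i)) ^ p * U ^ i else 0) ∈
        Ideal.span {T, U ^ (j + 1)} := by
    refine Ideal.sum_mem _ fun i hi => ?_
    split_ifs with hqi
    · rw [← sub_mul]
      have h5 := canonicalSection_pow_sub_mem (p := p) (j + 1) (ρ (θ i))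
      rw [hρ] at h5
      exact Ideal.mul_mem_right _ _ (hle h5)
    · rw [h0 i (Finset.mem_range.1 hi) hqi, sub_zero]
      exact Ideal.mul_mem_right _ _ (hle (canonicalSection_zero _))
  obtain ⟨g, b, hgb⟩ := Ideal.mem_span_pair.1 (Ideal.add_mem _ (hθ (j + 1)) h1)
  refine ⟨fun i => canonicalSection A p (j + 1) (ρ (θ i)),
    canonicalSection A p (j + 1) (θ j) + b * U, g, ?_, ?_⟩
  · have hU : U ∈ maximalIdeal A := h ▸ Ideal.subset_span (by simp)
    rw [← residue_ne_zero_iff_isUnit, map_add, residue_canonicalSection, map_mul,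
      (residue_eq_zero_iff U).2 hU, mul_zero, add_zero]
    exact hj
  · rw [Finset.sum_range_succ, Finset.sum_sub_distrib] at hgb
    rw [Finset.sum_filter]
    linear_combination -hgb

variable {R E : Type*} [CommRing R] [Field E] [Algebra R E] {p : ℕ} [Fact p.Prime]

/-- Removing the `p`-th powers from the restriction of a generator leaves a pole of order
`r m + n - j`. -/
theorem exists_correction [IsLocalRing R] [CharP E p] {t ε l g : R} (ht : t ∈ maximalIdeal R)
    (ht0 : algebraMap R E t ≠ 0) (hε : IsUnit ε) (hl : IsUnit l) {m n r j : ℕ} (hm : 1 ≤ m)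
    (hr : j < r) {s : Finset ℕ} (hs : ∀ i ∈ s, i < j ∧ i ≡ n [MOD p] ∧ p ∣ m) (μ : ℕ → R)
    {c D : R} (hc : c = ∑ i ∈ s, μ i ^ p * t ^ i + l * t ^ j + ε * t ^ r * g)
    (hD : D = ε ^ m * t ^ (r * m + n)) :
    ∃ (y : E) (u : R), IsUnit u ∧ (algebraMap R E c / algebraMap R E D - (y ^ p - y)) *
      algebraMap R E t ^ (r * m + n - j) = algebraMap R E u := by
  have hp := (Fact.out : p.Prime)
  obtain ⟨η, hη⟩ := hε.exists_right_inv
  have hjN : j ≤ r * m + n := by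
    have := Nat.mul_le_mul_left r hm
    omega
  have hk : ∀ i ∈ s, p * ((r * m + n - i) / p) = r * m + n - i ∧
      (r * m + n - i) / p + 1 ≤ r * m + n - j := by
    intro i hi
    obtain ⟨hij, hin, hpm⟩ := hs i hi
    have h1 : p ∣ r * m + n - i := by
      refine (Nat.modEq_iff_dvd' (by omega)).1 (hin.trans ?_)
      have := ((Nat.modEq_zero_iff_dvd.2 (hpm.mul_left r)).add_right n).symm
      rwa [zero_add] at this
    refine ⟨Nat.mul_div_cancel' h1, ?_⟩
    have h2 := Nat.mul_div_cancel' h1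
    have h3 := Nat.mul_le_mul_right ((r * m + n - i) / p) hp.two_le
    have h4 : r * 2 ≤ r * m := Nat.mul_le_mul_left r (hp.two_le.trans (Nat.le_of_dvd hm hpm))
    omega
  set τ := algebraMap R E t with hτ
  let v : R := ∑ i ∈ s, μ i * η ^ (m / p) * t ^ (r * m + n - j - (r * m + n - i) / p - 1)
  have hημ : algebraMap R E η ^ m * algebraMap R E ε ^ m = 1 := by
    rw [← mul_pow, ← map_mul, mul_comm, hη, map_one, one_pow]
  have hε0 : algebraMap R E ε ≠ 0 := fun h => by
    rw [h, zero_pow (by omega), mul_zero] at hημ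
    exact zero_ne_one hημ
  -- `y` is the sum of the `p`-th roots of the terms to be removed.
  refine ⟨∑ i ∈ s, algebraMap R E (μ i * η ^ (m / p)) / τ ^ ((r * m + n - i) / p),
    η ^ m * (l + ε * t ^ (r - j) * g) + t * v, ?_, ?_⟩
  · have hrj : r - j = (r - j - 1) + 1 := by omega
    have hηu : IsUnit η := IsUnit.of_mul_eq_one ε (by rw [mul_comm, hη])
    have h1 : η ^ m * (l + ε * t ^ (r - j) * g) + t * v =
        η ^ m * l - -(t * (η ^ m * ε * t ^ (r - j - 1) * g + v)) := by
      rw [hrj, pow_succ]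
      simp only [Nat.add_sub_cancel]
      ring
    rw [h1, ← residue_ne_zero_iff_isUnit, map_sub, (residue_eq_zero_iff (-_)).2
      (neg_mem (Ideal.mul_mem_right _ _ ht)), sub_zero, residue_ne_zero_iff_isUnit]
    exact (hηu.pow m).mul hl
  · set y := ∑ i ∈ s, algebraMap R E (μ i * η ^ (m / p)) / τ ^ ((r * m + n - i) / p) with hy
    have h1 : y * τ ^ (r * m + n - j) = algebraMap R E (t * v) := by
      rw [hy, Finset.sum_mul, Finset.mul_sum, map_sum]
      refine Finset.sum_congr rfl fun i hi => ?_
      obtain ⟨k, hk'⟩ := Nat.exists_eq_add_of_le (hk i hi).2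
      rw [hk', show (r * m + n - i) / p + 1 + k - (r * m + n - i) / p - 1 = k by omega]
      simp only [map_mul, map_pow, ← hτ]
      field_simp
      ring
    have h2 : y ^ p * τ ^ (r * m + n) = algebraMap R E (η ^ m * ∑ i ∈ s, μ i ^ p * t ^ i) := by
      rw [hy, sum_pow_char, Finset.sum_mul, Finset.mul_sum, map_sum]
      refine Finset.sum_congr rfl fun i hi => ?_
      rw [div_pow, ← pow_mul, mul_comm _ p, (hk i hi).1]
      have h3 : r * m + n = (r * m + n - i) + i := by have := (hs i hi).1; omega
      have h4 : (η ^ (m / p)) ^ p = η ^ m := by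
        rw [← pow_mul, Nat.div_mul_cancel (hs i hi).2.2]
      conv_lhs => rw [h3, Nat.add_sub_cancel]
      rw [← map_pow, mul_pow, h4]
      simp only [map_mul, map_pow, ← hτ]
      rw [pow_add]
      field_simp
    have h5 : algebraMap R E c / algebraMap R E D * τ ^ (r * m + n) =
        algebraMap R E (η ^ m * c) := by
      rw [hD]
      simp only [map_mul, map_pow, ← hτ]
      rw [div_mul_eq_mul_div, div_eq_iff (mul_ne_zero (pow_ne_zero _ hε0) (pow_ne_zero _ ht0))]
      linear_combination (-algebraMap R E c * τ ^ (r * m + n)) * hημ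
    refine mul_right_cancel₀ (pow_ne_zero j ht0) ?_
    rw [mul_assoc, ← pow_add, Nat.sub_add_cancel hjN]
    have h6 : y * τ ^ (r * m + n) = algebraMap R E (t * v * t ^ j) := by
      rw [map_mul _ (t * v), ← h1, map_pow, mul_assoc, ← pow_add, Nat.sub_add_cancel hjN]
    have h7 : t ^ r = t ^ (r - j) * t ^ j := by rw [← pow_add, Nat.sub_add_cancel hr.le]
    have h10 : ∀ x : R, algebraMap R E x * τ ^ j = algebraMap R E (x * t ^ j) := fun x => by
      rw [map_mul, map_pow]
    rw [h10, sub_mul, sub_mul, h5, h2, h6, ← map_sub, ← map_sub]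
    congr 1
    rw [hc, h7]
    ring

/-- The correction when `p` divides `r m + n - j`: the leading coefficient is removed as well, and
the next coefficient is a unit. -/
theorem exists_correction_of_dvd {t ε g γ l₁ l₂ κ : R}
    (ht0 : algebraMap R E t ≠ 0) (hε : IsUnit ε) {m n r j : ℕ} (hr : j < r) (hm : 1 ≤ m)
    (hκ : ε ^ m = 1 + t * κ) (hdvd : p ∣ r * m + n - j)
    {c D : R} (hc : c = (γ ^ p + t * l₁ + ε * t ^ r * l₂) * t ^ j + ε * t ^ r * g)
    (hD : D = ε ^ m * t ^ (r * m + n))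
    (hu : IsUnit (l₁ + ε * t ^ (r - 1) * l₂ + ε * t ^ (r - j - 1) * g - γ ^ p * κ +
      ε ^ m * γ * t ^ (r * m + n - j - (r * m + n - j) / p - 1))) :
    ∃ (y : E) (u : R), IsUnit u ∧ (algebraMap R E c / algebraMap R E D - (y ^ p - y)) *
      algebraMap R E t ^ (r * m + n - j - 1) = algebraMap R E u := by
  have hp := (Fact.out : p.Prime)
  obtain ⟨η, hη⟩ := hε.exists_right_inv
  have hjN : j + 1 ≤ r * m + n := by
    have := Nat.mul_le_mul_left r hm
    omega
  obtain ⟨q, hq⟩ := hdvd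
  have hdiv : (r * m + n - j) / p = q := by rw [hq, Nat.mul_div_cancel_left _ hp.pos]
  rw [hdiv] at hu
  have hq1 : q + 1 ≤ r * m + n - j := by
    have h1 : 0 < q := Nat.pos_of_ne_zero (by rintro rfl; omega)
    have h2 := Nat.mul_le_mul_right q hp.two_le
    omega
  set w := l₁ + ε * t ^ (r - 1) * l₂ + ε * t ^ (r - j - 1) * g - γ ^ p * κ +
      ε ^ m * γ * t ^ (r * m + n - j - q - 1) with hw
  set τ := algebraMap R E t with hτ
  have hηε : η ^ m * ε ^ m = 1 := by rw [← mul_pow, mul_comm, hη, one_pow]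
  have hημ : algebraMap R E η ^ m * algebraMap R E ε ^ m = 1 := by
    rw [← map_pow, ← map_pow, ← map_mul, hηε, map_one]
  have hε0 : algebraMap R E ε ≠ 0 := fun h => by
    rw [h, zero_pow (by omega), mul_zero] at hημ
    exact zero_ne_one hημ
  have hηu : IsUnit η := IsUnit.of_mul_eq_one ε (by rw [mul_comm, hη])
  refine ⟨algebraMap R E γ / τ ^ q, η ^ m * w, (hηu.pow m).mul hu, ?_⟩
  have h2 : (algebraMap R E γ / τ ^ q) ^ p * τ ^ (r * m + n) =
      algebraMap R E (γ ^ p * t ^ j) := by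
    have h3 : r * m + n = q * p + j := by rw [mul_comm q, ← hq]; omega
    rw [h3, div_pow, ← pow_mul, pow_add, map_mul, map_pow, map_pow,
      ← hτ]
    field_simp
  have h6 : algebraMap R E γ / τ ^ q * τ ^ (r * m + n) =
      algebraMap R E (γ * t ^ (r * m + n - j - q - 1) * t ^ (j + 1)) := by
    have h3 : r * m + n = q + (r * m + n - j - q - 1) + (j + 1) := by omega
    conv_lhs => rw [h3]
    rw [pow_add, pow_add, map_mul, map_mul, map_pow, map_pow, ← hτ]
    field_simp
  have h5 : algebraMap R E c / algebraMap R E D * τ ^ (r * m + n) =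
      algebraMap R E (η ^ m * c) := by
    rw [hD]
    simp only [map_mul, map_pow, ← hτ]
    rw [div_mul_eq_mul_div, div_eq_iff (mul_ne_zero (pow_ne_zero _ hε0) (pow_ne_zero _ ht0))]
    linear_combination (-algebraMap R E c * τ ^ (r * m + n)) * hημ
  refine mul_right_cancel₀ (pow_ne_zero (j + 1) ht0) ?_
  rw [mul_assoc, ← pow_add, show r * m + n - j - 1 + (j + 1) = r * m + n by omega]
  have h7 : t ^ r = t ^ (r - j - 1) * t ^ (j + 1) := by rw [← pow_add]; congr 1; omega
  have h8 : t ^ r = t ^ (r - 1) * t := by rw [← pow_succ]; congr 1; omega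
  have h9 : c = (γ ^ p + t * l₁ + ε * (t ^ (r - 1) * t) * l₂) * t ^ j +
      ε * (t ^ (r - j - 1) * t ^ (j + 1)) * g := by rw [← h7, ← h8, hc]
  have h10 : ∀ x : R, algebraMap R E x * τ ^ (j + 1) = algebraMap R E (x * t ^ (j + 1)) :=
    fun x => by rw [map_mul, map_pow]
  rw [h10, sub_mul, sub_mul, h5, h2, h6, ← map_sub, ← map_sub]
  congr 1
  rw [h9, hw]
  linear_combination (γ ^ p * t ^ j - γ * t ^ (r * m + n - j - q - 1) * t ^ (j + 1)) * hηε -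
    γ ^ p * t ^ j * η ^ m * hκ

/-- One of the two units `1` and `1 + U` makes the second coefficient a unit: modulo the maximal
ideal `κ` is `0` for the first and `m` for the second, and the other terms agree. -/
theorem exists_unit_parameter {A : Type*} [CommRing A] [IsLocalRing A] {U l₁ l₂ g γ : A}
    (hU : U ∈ maximalIdeal A) {m r j s p : ℕ} (hm : (m : ResidueField A) ≠ 0)
    (hγ : IsUnit γ) :
    ∃ ε κ : A, IsUnit ε ∧ ε ^ m = 1 + U * κ ∧
      IsUnit (l₁ + ε * U ^ (r - 1) * l₂ + ε * U ^ (r - j - 1) * g - γ ^ p * κ +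
        ε ^ m * γ * U ^ s) := by
  have hU0 : residue A U = 0 := (residue_eq_zero_iff U).2 hU
  by_cases h0 : IsUnit (l₁ + 1 * U ^ (r - 1) * l₂ + 1 * U ^ (r - j - 1) * g - γ ^ p * 0 +
        1 ^ m * γ * U ^ s)
  · exact ⟨1, 0, isUnit_one, by simp, h0⟩
  have hκ : ∀ m : ℕ, ∃ κ, (1 + U) ^ m = 1 + U * κ ∧ residue A κ = m := by
    intro m
    induction m with
    | zero => exact ⟨0, by simp, by simp⟩
    | succ m ih =>
      obtain ⟨κ, h1, h2⟩ := ih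
      refine ⟨κ + 1 + U * κ, by rw [pow_succ, h1]; ring, ?_⟩
      rw [map_add, map_add, h2, map_mul, hU0]
      simp
  obtain ⟨κ, h1, h2⟩ := hκ m
  have hε : residue A (1 + U) = 1 := by rw [map_add, hU0, map_one, add_zero]
  refine ⟨1 + U, κ, residue_ne_zero_iff_isUnit _ |>.1 (by rw [hε]; exact one_ne_zero), h1, ?_⟩
  rw [← residue_ne_zero_iff_isUnit, not_not] at h0
  rw [← residue_ne_zero_iff_isUnit]
  intro h3
  simp only [map_add, map_sub, map_mul, map_pow, hε, h2, map_one, map_zero, hU0] at h0 h3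
  have h4 : residue A γ ^ p * m = 0 := by
    simp only [one_pow, one_mul] at h0 h3
    linear_combination h0 - h3
  exact (mul_ne_zero (pow_ne_zero _ ((residue_ne_zero_iff_isUnit γ).2 hγ)) hm) h4

end Restriction

/-! ### Jumps along the curves of given contact -/

section Contact

open IsLocalRing IntermediateField

variable {A : Type*} [CommRing A] [IsDomain A] [IsRegularLocalRing A]
  {L : Type*} [Field L] [Algebra A L] {P₁ : PrimeSpectrum A} {T U : A}

/-- Local equations of the branch components along a curve in `T_r`. -/
theorem exists_uniformizer_of_mem_curvesOfContact (hdim : ringKrullDim A = 2)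
    (hP₁ : P₁ ∈ branchPrimes A L) (hTU : IsAdapted L P₁ T U) {P : PrimeSpectrum A} {r : ℕ}
    (hP : P ∈ curvesOfContact L P₁ r) :
    ∃ _ : IsDiscreteValuationRing (A ⧸ P.asIdeal), ∃ t w : A ⧸ P.asIdeal, Irreducible t ∧
      IsUnit w ∧ Ideal.Quotient.mk P.asIdeal T = w * t ^ r ∧
      ((branchPrimes A L).encard = 2 →
        ∃ w', IsUnit w' ∧ Ideal.Quotient.mk P.asIdeal U = w' * t) := by
  obtain ⟨⟨hP1, hPreg, hPb⟩, hPr, hP2⟩ := hP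
  obtain ⟨-, hT1, hU2⟩ := hTU
  have hdvr := isDiscreteValuationRing_of_mem_Spec₁ hP1
  obtain ⟨t, ht⟩ := IsDiscreteValuationRing.exists_irreducible (A ⧸ P.asIdeal)
  have hT := notMem_of_mem_Spec₁ hdim hP1 hP₁.1 (fun h => hPb (h ▸ hP₁)) hT1.symm
  obtain ⟨w, hw, hw'⟩ := exists_mk_eq_of_intersectionNumber_eq hT1.symm hT ht hPr
  refine ⟨hdvr, t, w, ht, hw, hw', fun h2 => ?_⟩
  obtain ⟨P₂, hP₂, hne⟩ := exists_ne_of_encard_eq h2 P₁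
  have hU := notMem_of_mem_Spec₁ hdim hP1 hP₂.1 (fun h => hPb (h ▸ hP₂)) (hU2 P₂ hP₂ hne).symm
  obtain ⟨v, hv, hv'⟩ := exists_mk_eq_of_intersectionNumber_eq (r := 1) (hU2 P₂ hP₂ hne).symm hU ht
    (hP2 P₂ hP₂ hne)
  exact ⟨v, hv, by rw [hv', pow_one]⟩

/-- The curve `T = ε U ^ r` has contact of order `r` with the first component of the branch
divisor. -/
theorem exists_mem_curvesOfContact (hdim : ringKrullDim A = 2)
    (hTU : IsAdapted L P₁ T U) {r : ℕ} (hr : 1 ≤ r) {ε : A} (hε : IsUnit ε) :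
    ∃ P ∈ curvesOfContact L P₁ r, ∃ _ : IsDiscreteValuationRing (A ⧸ P.asIdeal),
      Irreducible (Ideal.Quotient.mk P.asIdeal U) ∧
      Ideal.Quotient.mk P.asIdeal T = Ideal.Quotient.mk P.asIdeal (ε * U ^ r) := by
  obtain ⟨hm, hT1, hU2⟩ := hTU
  have hm' : Ideal.span {T - ε * U ^ r, U} = maximalIdeal A := by
    obtain ⟨s, rfl⟩ : ∃ s, r = s + 1 := ⟨r - 1, by omega⟩
    rw [← hm]
    refine le_antisymm (Ideal.span_le.2 ?_) (Ideal.span_le.2 ?_)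
    · rintro x (rfl | rfl)
      · exact Ideal.mem_span_pair.2 ⟨1, -(ε * U ^ s), by ring⟩
      · exact Ideal.subset_span (by simp)
    · rintro x (rfl | rfl)
      · exact Ideal.mem_span_pair.2 ⟨1, ε * U ^ s, by ring⟩
      · exact Ideal.subset_span (by simp)
  obtain ⟨P, hP, hP1, hPreg, hdvr, hU⟩ := exists_curve_of_span_pair_eq hdim hm'
  have hTU' : Ideal.Quotient.mk P.asIdeal T = Ideal.Quotient.mk P.asIdeal (ε * U ^ r) := by
    rw [Ideal.Quotient.mk_eq_mk_iff_sub_mem, hP]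
    exact Ideal.mem_span_singleton_self _
  have hε' : IsUnit (Ideal.Quotient.mk P.asIdeal ε) := hε.map _
  have hUP : U ∉ P.asIdeal := fun h => hU.ne_zero (Ideal.Quotient.eq_zero_iff_mem.2 h)
  have hTP : T ∉ P.asIdeal := fun h => by
    rw [Ideal.Quotient.eq_zero_iff_mem.2 h, eq_comm, map_mul, map_pow] at hTU'
    exact (mul_ne_zero hε'.ne_zero (pow_ne_zero r hU.ne_zero)) hTU'
  refine ⟨P, ⟨⟨hP1, hPreg, fun hb => ?_⟩, ?_, fun P₂ hP₂ hne => ?_⟩, hdvr, hU, hTU'⟩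
  · by_cases h : P = P₁
    · exact hTP (by rw [h, ← hT1]; exact Ideal.mem_span_singleton_self T)
    · exact hUP (by rw [← hU2 P hb h]; exact Ideal.mem_span_singleton_self U)
  · exact intersectionNumber_eq_of_mk_eq hT1.symm hU hε' (by rw [hTU', map_mul, map_pow])
  · exact intersectionNumber_eq_of_mk_eq (r := 1) (hU2 P₂ hP₂ hne).symm hU isUnit_one (by simp)

variable {p : ℕ} [Fact p.Prime] [CharP A p] [IsAlgClosed (ResidueField A)]
  {K : Type*} [Field K] [Algebra A K] [IsFractionRing A K] [Algebra K L] [IsScalarTower A K L]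
  [IsGalois K L]

/-- A bound valid for all `r`, which gives the finiteness of `h_r`. -/
theorem jump_le_of_mem_curvesOfContact (hdim : ringKrullDim A = 2)
    (hdeg : Module.finrank K L = p) (hP₁ : P₁ ∈ branchPrimes A L) (hTU : IsAdapted L P₁ T U)
    {x : L} {a : K} (hx : x ^ p - x = algebraMap K L a) (hgen : K⟮x⟯ = ⊤) {m n : ℕ} {c : A}
    (h : IsNormalForm L T U a m n c) {P : PrimeSpectrum A} {r : ℕ}
    (hP : P ∈ curvesOfContact L P₁ r) : jump L p P ≤ r * m + n := by
  have hp := (Fact.out : p.Prime)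
  have := uniqueFactorizationMonoid_of_ringKrullDim_eq_two hdim
  obtain ⟨hdvr, t, w, ht, hw, hT, hU⟩ := exists_uniformizer_of_mem_curvesOfContact hdim hP₁ hTU hP
  obtain ⟨v, hv, hD⟩ : ∃ v, IsUnit v ∧ Ideal.Quotient.mk P.asIdeal (T ^ m * U ^ n) =
      v * t ^ (r * m + n) := by
    by_cases h2 : (branchPrimes A L).encard = 2
    · obtain ⟨w', hw', hU'⟩ := hU h2
      exact ⟨w ^ m * w' ^ n, (hw.pow m).mul (hw'.pow n), by
        rw [map_mul, map_pow, map_pow, hT, hU']; ring⟩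
    · refine ⟨w ^ m, hw.pow m, ?_⟩
      rw [h.eq_zero h2, pow_zero, mul_one, map_pow, hT]; ring
  have hD0 : Ideal.Quotient.mk P.asIdeal (T ^ m * U ^ n) ≠ 0 := by
    rw [hD]; exact mul_ne_zero hv.ne_zero (pow_ne_zero _ ht.ne_zero)
  obtain ⟨v', hv'⟩ := hv.exists_right_inv
  refine (jump_eq_and_le hdeg hx hgen h.eq P (fun h => hD0 (Ideal.Quotient.eq_zero_iff_mem.2 h)) ht
    (u := v' * Ideal.Quotient.mk P.asIdeal c) 0 ?_).2.1
  have hinj := IsFractionRing.injective (A ⧸ P.asIdeal) (FractionRing (A ⧸ P.asIdeal))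
  rw [zero_pow hp.ne_zero, sub_zero, sub_zero, div_mul_eq_mul_div, div_eq_iff
    (fun h => hD0 (hinj (h.trans (map_zero _).symm))), ← map_pow, ← map_mul, ← map_mul, hD]
  congr 1
  linear_combination (-Ideal.Quotient.mk P.asIdeal c * t ^ (r * m + n)) * hv'

/-- Along a curve of contact `r > max 1 j`, a generator whose leading coefficient begins with the
unit multiple `l U ^ j`, up to terms removable as `p`-th powers, behaves like one with a pole of
order `r m + n - j`. -/
theorem jump_of_mem_curvesOfContact (hdim : ringKrullDim A = 2)
    (hdeg : Module.finrank K L = p) (hP₁ : P₁ ∈ branchPrimes A L) (hTU : IsAdapted L P₁ T U)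
    {x : L} {a : K} (hx : x ^ p - x = algebraMap K L a) (hgen : K⟮x⟯ = ⊤) {m n : ℕ} {c : A}
    (h : IsNormalForm L T U a m n c) {j : ℕ} {s : Finset ℕ}
    (hs : ∀ i ∈ s, i < j ∧ i ≡ n [MOD p] ∧ p ∣ m) {μ : ℕ → A} {l g : A} (hl : IsUnit l)
    (hc : c = ∑ i ∈ s, μ i ^ p * U ^ i + l * U ^ j + T * g) {P : PrimeSpectrum A} {r : ℕ}
    (hr : 1 < r) (hrj : j < r) (hP : P ∈ curvesOfContact L P₁ r) :
    (¬ p ∣ r * m + n - j → jump L p P = r * m + n - j) ∧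
      jump L p P ≤ r * m + n - j ∧ (jump L p P = 0 ∨ ¬ p ∣ jump L p P) := by
  have := uniqueFactorizationMonoid_of_ringKrullDim_eq_two hdim
  obtain ⟨hdvr, t, w, ht, hw, hT, -⟩ := exists_uniformizer_of_mem_curvesOfContact hdim hP₁ hTU hP
  have hU := irreducible_mk_of_sq_dvd hTU.1 P.asIdeal ht
    (hT ▸ (pow_dvd_pow t hr).mul_left w)
  obtain ⟨ε, hε, hT⟩ : ∃ ε, IsUnit ε ∧ Ideal.Quotient.mk P.asIdeal T =
      ε * Ideal.Quotient.mk P.asIdeal U ^ r := by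
    obtain ⟨e, he⟩ := IsDiscreteValuationRing.associated_of_irreducible _ hU ht
    refine ⟨w * e ^ r, hw.mul (e.isUnit.pow r), ?_⟩
    rw [hT, ← he]; ring
  set t := Ideal.Quotient.mk P.asIdeal U with htU
  have hinj := IsFractionRing.injective (A ⧸ P.asIdeal) (FractionRing (A ⧸ P.asIdeal))
  have ht0 : algebraMap (A ⧸ P.asIdeal) (FractionRing (A ⧸ P.asIdeal)) t ≠ 0 := fun h =>
    hU.ne_zero (hinj (h.trans (map_zero _).symm))
  have : CharP (A ⧸ P.asIdeal) p := charP_quotient P.asIdeal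
  have : CharP (FractionRing (A ⧸ P.asIdeal)) p := charP_of_injective_algebraMap hinj p
  have hD : Ideal.Quotient.mk P.asIdeal (T ^ m * U ^ n) = ε ^ m * t ^ (r * m + n) := by
    rw [map_mul, map_pow, map_pow, hT]; ring
  have hDP : T ^ m * U ^ n ∉ P.asIdeal := fun h => by
    rw [← Ideal.Quotient.eq_zero_iff_mem, hD] at h
    exact mul_ne_zero (hε.pow m).ne_zero (pow_ne_zero _ hU.ne_zero) h
  obtain ⟨y, u, hu, hy⟩ := exists_correction (E := FractionRing (A ⧸ P.asIdeal))
    (g := Ideal.Quotient.mk P.asIdeal g) (l := Ideal.Quotient.mk P.asIdeal l)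
    hU.not_isUnit ht0 hε (hl.map _) h.one_le hrj hs (fun i => Ideal.Quotient.mk P.asIdeal (μ i))
    (c := Ideal.Quotient.mk P.asIdeal c) (by
      rw [hc]
      simp only [map_add, map_sum, map_mul, map_pow, hT, ← htU]) hD
  obtain ⟨h1, h2, h3⟩ := jump_eq_and_le hdeg hx hgen h.eq P hDP hU y hy
  exact ⟨h1 hu, h2, h3⟩

/-- If `p` divides `r m + n - j`, some curve `T = ε U ^ r` attains the jump `r m + n - j - 1`. -/
theorem exists_jump_eq_of_dvd (hdim : ringKrullDim A = 2)
    (hdeg : Module.finrank K L = p) (hTU : IsAdapted L P₁ T U)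
    {x : L} {a : K} (hx : x ^ p - x = algebraMap K L a) (hgen : K⟮x⟯ = ⊤) {m n : ℕ} {c : A}
    (h : IsNormalForm L T U a m n c) (hpm : ¬ p ∣ m) {j : ℕ} {l g : A} (hl : IsUnit l)
    (hc : c = l * U ^ j + T * g) {r : ℕ} (hr : 1 < r) (hrj : j < r)
    (hdvd : p ∣ r * m + n - j) :
    ∃ P ∈ curvesOfContact L P₁ r, jump L p P = r * m + n - j - 1 := by
  have hp := (Fact.out : p.Prime)
  have := uniqueFactorizationMonoid_of_ringKrullDim_eq_two hdim
  have hUm : U ∈ maximalIdeal A := hTU.1 ▸ Ideal.subset_span (by simp)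
  obtain ⟨γ, l₁, l₂, hγ, hlγ⟩ : ∃ γ l₁ l₂, IsUnit γ ∧ l = γ ^ p + U * l₁ + T * l₂ := by
    obtain ⟨γ₀, hγ₀⟩ := IsAlgClosed.exists_pow_nat_eq (residue A l) hp.pos
    obtain ⟨γ, rfl⟩ := residue_surjective γ₀
    have h1 : l - γ ^ p ∈ Ideal.span {T, U} := by
      rw [hTU.1, ← residue_eq_zero_iff, map_sub, map_pow, hγ₀, sub_self]
    obtain ⟨l₂, l₁, h2⟩ := Ideal.mem_span_pair.1 h1
    refine ⟨γ, l₁, l₂, ?_, by linear_combination -h2⟩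
    rw [← residue_ne_zero_iff_isUnit]
    intro h0
    rw [h0, zero_pow hp.ne_zero, eq_comm] at hγ₀
    exact (residue_ne_zero_iff_isUnit l).2 hl hγ₀
  have : CharP (ResidueField A) p := charP_residueField
  obtain ⟨ε, κ, hε, hκ, hu⟩ := exists_unit_parameter (l₁ := l₁) (l₂ := l₂) (g := g) (r := r)
    (j := j) (s := r * m + n - j - (r * m + n - j) / p - 1) (p := p) hUm
    (fun h0 => hpm ((CharP.cast_eq_zero_iff (ResidueField A) p m).1 h0)) hγ
  obtain ⟨P, hP, hdvr, hU, hT⟩ := exists_mem_curvesOfContact hdim hTU hr.le hε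
  refine ⟨P, hP, ?_⟩
  rw [map_mul, map_pow] at hT
  have hinj := IsFractionRing.injective (A ⧸ P.asIdeal) (FractionRing (A ⧸ P.asIdeal))
  have hε' : IsUnit (Ideal.Quotient.mk P.asIdeal ε) := hε.map _
  have hD : Ideal.Quotient.mk P.asIdeal (T ^ m * U ^ n) =
      Ideal.Quotient.mk P.asIdeal ε ^ m * Ideal.Quotient.mk P.asIdeal U ^ (r * m + n) := by
    rw [map_mul, map_pow, map_pow, hT]; ring
  have hDP : T ^ m * U ^ n ∉ P.asIdeal := fun h => by
    rw [← Ideal.Quotient.eq_zero_iff_mem, hD] at h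
    exact mul_ne_zero (hε'.pow m).ne_zero (pow_ne_zero _ hU.ne_zero) h
  have hu' := hu.map (Ideal.Quotient.mk P.asIdeal)
  simp only [map_add, map_sub, map_mul, map_pow] at hu'
  obtain ⟨y, u, hu, hy⟩ := exists_correction_of_dvd (E := FractionRing (A ⧸ P.asIdeal))
    (fun h => hU.ne_zero (hinj (h.trans (map_zero _).symm))) hε' hrj h.one_le
    (by rw [← map_pow, hκ, map_add, map_one, map_mul]) hdvd
    (c := Ideal.Quotient.mk P.asIdeal c) (by
      rw [hc, hlγ]
      simp only [map_add, map_mul, map_pow, hT]) hD hu'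
  refine (jump_eq_and_le hdeg hx hgen h.eq P hDP hU y hy).1 hu fun h1 => ?_
  have hjN : j + 1 ≤ r * m + n := by
    have := Nat.mul_le_mul_left r h.one_le
    omega
  have h2 := (Nat.dvd_sub_iff_right (show 1 ≤ r * m + n - j by omega) hdvd).1 h1
  exact hp.one_lt.ne' (Nat.dvd_one.1 h2)

end Contact

/-! ### Existence of adapted parameters and of a leading coefficient -/

section Existence

open IsLocalRing IntermediateField

theorem exists_isAdapted {A : Type*} [CommRing A] [IsDomain A] [IsRegularLocalRing A]
    (hdim : ringKrullDim A = 2) {L : Type*} [Field L] [Algebra A L] (hnc : IsNormalCrossing A L)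
    {P₁ : PrimeSpectrum A} (hP₁ : P₁ ∈ branchPrimes A L) : ∃ T U : A, IsAdapted L P₁ T U := by
  obtain ⟨hle, hreg, hint⟩ := hnc
  obtain ⟨T, -, hT⟩ := exists_eq_span_of_mem_Spec₁ hdim hP₁.1
  by_cases h2 : (branchPrimes A L).encard = 2
  · obtain ⟨P₂, hP₂, hne⟩ := exists_ne_of_encard_eq h2 P₁
    obtain ⟨U, -, hU⟩ := exists_eq_span_of_mem_Spec₁ hdim hP₂.1
    refine ⟨T, U, ?_, hT.symm, fun P hP hPne => ?_⟩
    · have h1 := hint P₁ hP₁ P₂ hP₂ hne.symm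
      rw [intersectionNumber, Module.length_eq_one_iff, isSimpleModule_iff_isCoatom] at h1
      rw [Ideal.span_insert, ← hT, ← hU]
      exact eq_maximalIdeal ⟨h1⟩
    · rw [← hU]
      obtain ⟨x, y, hxy, hB⟩ := Set.encard_eq_two.1 h2
      rw [hB] at hP₁ hP₂ hP
      rcases hP₁ with rfl | rfl <;> rcases hP₂ with rfl | rfl <;> rcases hP with rfl | rfl <;>
        first | rfl | exact (hne rfl).elim | exact (hPne rfl).elim
  · have := hreg P₁ hP₁
    have hdvr := isDiscreteValuationRing_of_mem_Spec₁ hP₁.1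
    obtain ⟨u, hu⟩ := IsDiscreteValuationRing.exists_irreducible (A ⧸ P₁.asIdeal)
    obtain ⟨U, rfl⟩ := Ideal.Quotient.mk_surjective u
    have hTm : T ∈ maximalIdeal A :=
      le_maximalIdeal P₁.2.ne_top (hT ▸ Ideal.mem_span_singleton_self T)
    have hum := (IsDiscreteValuationRing.irreducible_iff_uniformizer _).1 hu
    have hmap := IsLocalRing.map_maximalIdeal_of_surjective _
      (Ideal.Quotient.mk_surjective (I := P₁.asIdeal))
    refine ⟨T, U, le_antisymm (Ideal.span_le.2 ?_) fun x hx => ?_, hT.symm, fun P hP hPne =>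
      (hPne (mem_branchPrimes_iff_of_encard_ne h2 hle hP₁ hP)).elim⟩
    · rintro x (rfl | rfl)
      · exact hTm
      · exact (mem_maximalIdeal _).2 fun hU => hu.not_isUnit (hU.map _)
    · have h1 : Ideal.Quotient.mk P₁.asIdeal x ∈ maximalIdeal (A ⧸ P₁.asIdeal) :=
        hmap ▸ Ideal.mem_map_of_mem _ hx
      rw [hum, Ideal.mem_span_singleton'] at h1
      obtain ⟨b, hb⟩ := h1
      obtain ⟨b, rfl⟩ := Ideal.Quotient.mk_surjective b
      rw [← map_mul, eq_comm, Ideal.Quotient.mk_eq_mk_iff_sub_mem, hT,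
        Ideal.mem_span_singleton'] at hb
      obtain ⟨d, hd⟩ := hb
      exact Ideal.mem_span_pair.2 ⟨d, b, by rw [hd]; ring⟩

/-- An element in all the ideals `(T, U ^ N)` is divisible by `T`. -/
theorem dvd_of_forall_mem_span_pair {A : Type*} [CommRing A] [IsDomain A] [IsRegularLocalRing A]
    (hdim : ringKrullDim A = 2) {T U c : A} (h : Ideal.span {T, U} = maximalIdeal A)
    (hc : ∀ N : ℕ, c ∈ Ideal.span {T, U ^ N}) : T ∣ c := by
  obtain ⟨_, hdvr, hU⟩ := isDiscreteValuationRing_quotient_of_span_pair_eq hdim h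
  by_contra hTc
  obtain ⟨k, w, hk⟩ := IsDiscreteValuationRing.eq_unit_mul_pow_irreducible
    (x := Ideal.Quotient.mk (Ideal.span {T}) c) (fun h0 => hTc
      (Ideal.mem_span_singleton.1 (Ideal.Quotient.eq_zero_iff_mem.1 h0))) hU
  obtain ⟨a, b, hab⟩ := Ideal.mem_span_pair.1 (hc (k + 1))
  have h1 := congrArg (Ideal.Quotient.mk (Ideal.span {T})) hab
  rw [hk, map_add, map_mul, map_mul, map_pow,
    Ideal.Quotient.eq_zero_iff_mem.2 (Ideal.mem_span_singleton_self T), mul_zero, zero_add] at h1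
  have h2 : (w : A ⧸ Ideal.span {T}) = Ideal.Quotient.mk (Ideal.span {T}) U *
      Ideal.Quotient.mk (Ideal.span {T}) b :=
    mul_right_cancel₀ (pow_ne_zero k hU.ne_zero) (by rw [← h1]; ring)
  exact hU.not_isUnit (isUnit_of_dvd_unit ⟨_, h2⟩ w.isUnit)

universe u

/-- For a generator with minimal pole along `T`, the expansion of its leading coefficient has a
term which cannot be removed. -/
theorem exists_ne_zero_and_not_modEq {A : Type u} [CommRing A] [IsDomain A] [IsRegularLocalRing A]
    (hdim : ringKrullDim A = 2) {p : ℕ} [Fact p.Prime] [CharP A p] [IsAlgClosed (ResidueField A)]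
    {K : Type*} [Field K] [Algebra A K] [IsFractionRing A K]
    {L : Type*} [Field L] [Algebra K L] [Algebra A L] [IsScalarTower A K L]
    [IsGalois K L] (hdeg : Module.finrank K L = p)
    {P₁ : PrimeSpectrum A} (hP₁ : P₁ ∈ branchPrimes A L)
    (hG : IsLocalGRing A) {T U : A} (hTU : IsAdapted L P₁ T U) {a : K}
    (ha : IsArtinSchreier L p T U a) {m n : ℕ} {c : A} (h : IsNormalForm L T U a m n c)
    (hmin : ∀ (a' : K) (m' n' : ℕ) (c' : A), IsArtinSchreier L p T U a' →
      IsNormalForm L T U a' m' n' c' → m ≤ m') {θ : ℕ → ResidueField A}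
    (hθ : ∀ N : ℕ,
      c - ∑ j ∈ Finset.range N, canonicalSection A p N (θ j) * U ^ j ∈ Ideal.span {T, U ^ N}) :
    ∃ i, θ i ≠ 0 ∧ (p ∣ m → ¬ i ≡ n [MOD p]) := by
  have hp := (Fact.out : p.Prime)
  by_contra! hcon
  by_cases hpm : p ∣ m
  · have h0 : ∀ i, ¬ i ≡ n [MOD p] → θ i = 0 := by
      intro i hi
      by_contra hne
      exact hi (hcon i hne).2
    obtain ⟨b, g, hbg⟩ := exists_eq_pow_add_mul hdim hG hTU.1 (exists_sub_pow_mem hTU.1 hθ h0)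
    obtain ⟨a', m', n', c', ha', h', hlt⟩ :=
      exists_lt_of_eq_pow_add_mul hdim hdeg hP₁ hTU ha h hpm hbg
    exact absurd (hmin a' m' n' c' ha' h') (not_le.2 hlt)
  · have h0 : ∀ i, θ i = 0 := by
      intro i
      by_contra hne
      exact hpm (hcon i hne).1
    refine h.not_dvd (dvd_of_forall_mem_span_pair hdim hTU.1 fun N => ?_)
    have h1 : ∑ j ∈ Finset.range N, canonicalSection A p N (θ j) * U ^ j ∈
        Ideal.span {T, U ^ N} := by
      refine Ideal.sum_mem _ fun j _ => Ideal.mul_mem_right _ _ ?_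
      rw [h0]
      exact maximalIdeal_pow_le_span_pair hTU.1 N
        (Ideal.pow_le_pow_right (Nat.lt_pow_self hp.one_lt).le (canonicalSection_zero N))
    have h2 := Ideal.add_mem _ (hθ N) h1
    rwa [sub_add_cancel] at h2

end Existence

/-! ### The suprema `h_r` -/

section SupJump

open IsLocalRing IntermediateField

theorem supJump_le {A : Type*} [CommRing A] [IsLocalRing A] {L : Type*} [Field L] [Algebra A L]
    {p : ℕ} {P₁ : PrimeSpectrum A} {r k : ℕ} (h : ∀ P ∈ curvesOfContact L P₁ r, jump L p P ≤ k) :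
    supJump L p P₁ r ≤ k :=
  iSup₂_le fun P hP => by exact_mod_cast h P hP

theorem supJump_eq {A : Type*} [CommRing A] [IsLocalRing A] {L : Type*} [Field L] [Algebra A L]
    {p : ℕ} {P₁ : PrimeSpectrum A} {r k : ℕ} (h : ∀ P ∈ curvesOfContact L P₁ r, jump L p P ≤ k)
    (h' : ∃ P ∈ curvesOfContact L P₁ r, jump L p P = k) : supJump L p P₁ r = k := by
  obtain ⟨P, hP, hk⟩ := h'
  refine le_antisymm (supJump_le h) ?_
  rw [← hk]
  exact le_iSup₂_of_le P hP le_rfl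

variable {A : Type*} [CommRing A] [IsDomain A] [IsRegularLocalRing A]
  {L : Type*} [Field L] [Algebra A L] {P₁ : PrimeSpectrum A} {T U : A}
  {p : ℕ} [Fact p.Prime] [CharP A p] [IsAlgClosed (ResidueField A)]
  {K : Type*} [Field K] [Algebra A K] [IsFractionRing A K] [Algebra K L] [IsScalarTower A K L]
  [IsGalois K L]

/-- The value of `h_r`. If `p` divides `r m + n - j`, the choice of `j` forces `p ∤ m`, so that no
terms below degree `j` occur. -/
theorem supJump_eq_of_isLeast (hdim : ringKrullDim A = 2)
    (hdeg : Module.finrank K L = p) (hP₁ : P₁ ∈ branchPrimes A L) (hTU : IsAdapted L P₁ T U)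
    {a : K} (ha : IsArtinSchreier L p T U a) {m n : ℕ} {c : A}
    (h : IsNormalForm L T U a m n c) {θ : ℕ → ResidueField A}
    (hθ : ∀ N : ℕ,
      c - ∑ j ∈ Finset.range N, canonicalSection A p N (θ j) * U ^ j ∈ Ideal.span {T, U ^ N})
    {j : ℕ} (hj : IsLeast {i : ℕ | θ i ≠ 0 ∧ (p ∣ m → ¬ i ≡ n [MOD p])} j) {r : ℕ}
    (hr : max 1 j < r) :
    (¬ p ∣ r * m + n - j → supJump L p P₁ r = (r * m + n - j : ℕ)) ∧
      (p ∣ r * m + n - j → supJump L p P₁ r = (r * m + n - j - 1 : ℕ)) := by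
  obtain ⟨hr1, hrj⟩ := max_lt_iff.1 hr
  obtain ⟨⟨hj0, hjn⟩, hmin⟩ := hj
  obtain ⟨x, hgen, hx⟩ := ha.1
  have hjN : j + 1 ≤ r * m + n := by
    have := Nat.mul_le_mul_left r h.one_le
    omega
  classical
  obtain ⟨μ, l, g, hl, hc⟩ := exists_leading_form hTU.1 hθ hj0
    (fun i => i ≡ n [MOD p] ∧ p ∣ m) (fun i hi hq => by
      by_contra hne
      exact absurd (hmin ⟨hne, fun hpm hin => hq ⟨hin, hpm⟩⟩) (not_le.2 hi))
  have hs : ∀ i ∈ (Finset.range j).filter (fun i => i ≡ n [MOD p] ∧ p ∣ m),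
      i < j ∧ i ≡ n [MOD p] ∧ p ∣ m := fun i hi => by simpa using hi
  have key := fun P (hP : P ∈ curvesOfContact L P₁ r) =>
    jump_of_mem_curvesOfContact hdim hdeg hP₁ hTU hx hgen h hs hl hc hr1 hrj hP
  refine ⟨fun hN => supJump_eq (fun P hP => (key P hP).2.1) ?_, fun hN => supJump_eq ?_ ?_⟩
  · obtain ⟨P, hP, -⟩ := exists_mem_curvesOfContact (L := L) hdim hTU hr1.le isUnit_one
    exact ⟨P, hP, (key P hP).1 hN⟩
  · intro P hP
    obtain ⟨-, h1, h2⟩ := key P hP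
    rcases h2 with h2 | h2
    · omega
    · have : jump L p P ≠ r * m + n - j := fun h3 => h2 (h3 ▸ hN)
      omega
  · have hpm : ¬ p ∣ m := by
      intro hpm
      refine hjn hpm ?_
      have h1 : j ≡ r * m + n [MOD p] := (Nat.modEq_iff_dvd' (by omega)).2 hN
      have h2 := (Nat.modEq_zero_iff_dvd.2 (hpm.mul_left r)).add_right n
      rw [zero_add] at h2
      exact h1.trans h2
    have hc' : c = l * U ^ j + T * g := by
      rw [hc, Finset.filter_false_of_mem (fun i _ hi => hpm hi.2), Finset.sum_empty, zero_add]
    exact exists_jump_eq_of_dvd hdim hdeg hTU hx hgen h hpm hl hc' hr1 hrj hN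

theorem tendsto_div_of_le_of_le {f : ℕ → ℕ} {m n k R : ℕ}
    (h : ∀ r > R, r * m ≤ f r + k ∧ f r ≤ r * m + n) :
    Tendsto (fun r : ℕ => (f r : ℝ) / r) atTop (𝓝 (m : ℝ)) := by
  have h1 : Tendsto (fun r : ℕ => (m : ℝ) - (k : ℝ) / r) atTop (𝓝 (m : ℝ)) := by
    simpa using tendsto_const_nhds.sub (tendsto_const_div_atTop_nhds_zero_nat (k : ℝ))
  have h2 : Tendsto (fun r : ℕ => (m : ℝ) + (n : ℝ) / r) atTop (𝓝 (m : ℝ)) := by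
    simpa using tendsto_const_nhds.add (tendsto_const_div_atTop_nhds_zero_nat (n : ℝ))
  refine tendsto_of_tendsto_of_tendsto_of_le_of_le' h1 h2 ?_ ?_
  all_goals
    filter_upwards [eventually_gt_atTop R] with r hr
    have hr0 : (0 : ℝ) < r := by exact_mod_cast (Nat.zero_le R).trans_lt hr
    obtain ⟨h3, h4⟩ := h r hr
  · have h3 : (r : ℝ) * m ≤ f r + k := by exact_mod_cast h3
    rw [le_div_iff₀ hr0, sub_mul, div_mul_cancel₀ _ hr0.ne']
    linarith
  · have h4 : (f r : ℝ) ≤ r * m + n := by exact_mod_cast h4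
    rw [div_le_iff₀ hr0, add_mul, div_mul_cancel₀ _ hr0.ne']
    linarith

end SupJump

end SurfaceRam

theorem theorem4 {A : Type*} [CommRing A] [IsDomain A] [IsRegularLocalRing A]
    (hdim : ringKrullDim A = 2)
    {p : ℕ} [Fact p.Prime] [CharP A p] [IsAlgClosed (IsLocalRing.ResidueField A)]
    {K : Type*} [Field K] [Algebra A K] [IsFractionRing A K]
    {L : Type*} [Field L] [Algebra K L] [Algebra A L] [IsScalarTower A K L]
    [IsGalois K L] (hdeg : Module.finrank K L = p)
    (hnc : SurfaceRam.IsNormalCrossing A L)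
    (P₁ : PrimeSpectrum A) (hP₁ : P₁ ∈ SurfaceRam.branchPrimes A L)
    (hG : SurfaceRam.IsLocalGRing A) :
    (∀ r : ℕ, 1 ≤ r → SurfaceRam.supJump L p P₁ r ≠ ⊤) ∧
    (∃ l : ℝ, Filter.Tendsto (fun r : ℕ => ((SurfaceRam.supJump L p P₁ r).toNat : ℝ) / r)
      Filter.atTop (nhds l)) ∧
    ∀ T U : A, SurfaceRam.IsAdapted L P₁ T U →
      ∃ m : ℕ,
        IsLeast {μ : ℤ | ∃ a : K, SurfaceRam.IsArtinSchreier L p T U a ∧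
          SurfaceRam.HasOrder T a (-μ)} (m : ℤ) ∧
        Filter.Tendsto (fun r : ℕ => ((SurfaceRam.supJump L p P₁ r).toNat : ℝ) / r)
          Filter.atTop (nhds (m : ℝ)) ∧
        ∀ a : K, SurfaceRam.IsArtinSchreier L p T U a → SurfaceRam.HasOrder T a (-(m : ℤ)) →
          ∃ (n : ℕ) (c : A) (θ : ℕ → IsLocalRing.ResidueField A) (j : ℕ),
            ((SurfaceRam.branchPrimes A L).encard = 1 → n = 0) ∧
            ((SurfaceRam.branchPrimes A L).encard = 2 → SurfaceRam.HasOrder U a (-(n : ℤ))) ∧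
            algebraMap A K c = algebraMap A K T ^ m * algebraMap A K U ^ n * a ∧
            SurfaceRam.IsExpansionMod T U c θ ∧
            IsLeast {i : ℕ | θ i ≠ 0 ∧ (p ∣ m → ¬ i ≡ n [MOD p])} j ∧
            ∀ r : ℕ, max 1 j < r →
              (¬ (p : ℤ) ∣ (r * m + n - j : ℤ) →
                SurfaceRam.supJump L p P₁ r + j = (r * m + n : ℕ)) ∧
              ((p : ℤ) ∣ (r * m + n - j : ℤ) →
                SurfaceRam.supJump L p P₁ r + j + 1 = (r * m + n : ℕ)) := by
  open SurfaceRam in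
  have hle := hnc.1
  -- Finiteness and convergence do not refer to parameters, but are proved with a choice of them.
  have main : ∀ T U : A, IsAdapted L P₁ T U → ∃ m : ℕ,
      IsLeast {μ : ℤ | ∃ a : K, IsArtinSchreier L p T U a ∧ HasOrder T a (-μ)} (m : ℤ) ∧
      (∀ r : ℕ, supJump L p P₁ r ≠ ⊤) ∧
      Tendsto (fun r : ℕ => ((supJump L p P₁ r).toNat : ℝ) / r) atTop (𝓝 (m : ℝ)) ∧
      ∀ a : K, IsArtinSchreier L p T U a → HasOrder T a (-(m : ℤ)) →
        ∃ (n : ℕ) (c : A) (θ : ℕ → IsLocalRing.ResidueField A) (j : ℕ),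
          IsNormalForm L T U a m n c ∧ IsExpansionMod T U c θ ∧
          IsLeast {i : ℕ | θ i ≠ 0 ∧ (p ∣ m → ¬ i ≡ n [MOD p])} j ∧
          ∀ r : ℕ, max 1 j < r → j + 1 ≤ r * m + n ∧
            (¬ p ∣ r * m + n - j → supJump L p P₁ r = (r * m + n - j : ℕ)) ∧
            (p ∣ r * m + n - j → supJump L p P₁ r = (r * m + n - j - 1 : ℕ)) := by
    classical
    intro T U hTU
    have hT := prime_of_span_pair_eq hdim hTU.1
    have hTU' := not_dvd_of_span_pair_eq hdim hTU.1
    have hex : ∃ m : ℕ, ∃ (a : K) (n : ℕ) (c : A),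
        IsArtinSchreier L p T U a ∧ IsNormalForm L T U a m n c := by
      obtain ⟨a, ha⟩ := exists_isArtinSchreier (K := K) hdim hdeg hle hP₁ hTU
      obtain ⟨m, n, c, h⟩ := exists_isNormalForm hdim hdeg hP₁ hTU ha
      exact ⟨m, a, n, c, ha, h⟩
    obtain ⟨m, ⟨a₀, n₀, c₀, ha₀, h₀⟩, hmin⟩ : ∃ m : ℕ, (∃ (a : K) (n : ℕ) (c : A),
        IsArtinSchreier L p T U a ∧ IsNormalForm L T U a m n c) ∧
        ∀ (a' : K) (m' n' : ℕ) (c' : A), IsArtinSchreier L p T U a' →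
          IsNormalForm L T U a' m' n' c' → m ≤ m' :=
      ⟨Nat.find hex, Nat.find_spec hex, fun a' m' n' c' ha' h' =>
        Nat.find_min' hex ⟨a', n', c', ha', h'⟩⟩
    have key : ∀ a : K, IsArtinSchreier L p T U a → HasOrder T a (-(m : ℤ)) →
        ∃ (n : ℕ) (c : A) (θ : ℕ → IsLocalRing.ResidueField A) (j : ℕ),
          IsNormalForm L T U a m n c ∧ IsExpansionMod T U c θ ∧
          IsLeast {i : ℕ | θ i ≠ 0 ∧ (p ∣ m → ¬ i ≡ n [MOD p])} j ∧
          ∀ r : ℕ, max 1 j < r → j + 1 ≤ r * m + n ∧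
            (¬ p ∣ r * m + n - j → supJump L p P₁ r = (r * m + n - j : ℕ)) ∧
            (p ∣ r * m + n - j → supJump L p P₁ r = (r * m + n - j - 1 : ℕ)) := by
      intro a ha hord
      obtain ⟨m', n, c, h⟩ := exists_isNormalForm hdim hdeg hP₁ hTU ha
      obtain rfl : m' = m := by
        have := (h.hasOrder hT hTU').unique hT hord
        omega
      obtain ⟨θ, hθ⟩ := exists_expansion p hTU.1 c
      have hne := exists_ne_zero_and_not_modEq hdim hdeg hP₁ hG hTU ha h hmin hθ
      have hj : IsLeast {i : ℕ | θ i ≠ 0 ∧ (p ∣ m' → ¬ i ≡ n [MOD p])} (Nat.find hne) :=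
        ⟨Nat.find_spec hne, fun i hi => Nat.find_min' hne hi⟩
      refine ⟨n, c, θ, Nat.find hne, h, fun N => ⟨_, isSection_canonicalSection N, hθ N⟩, hj,
        fun r hr => ⟨?_, supJump_eq_of_isLeast hdim hdeg hP₁ hTU ha h hθ hj hr⟩⟩
      have h1 := Nat.mul_le_mul_left r h.one_le
      have h2 := (max_lt_iff.1 hr).2
      omega
    have hfin : ∀ r : ℕ, supJump L p P₁ r ≤ (r * m + n₀ : ℕ) := by
      intro r
      obtain ⟨x, hgen, hx⟩ := ha₀.1
      exact supJump_le fun P hP =>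
        jump_le_of_mem_curvesOfContact hdim hdeg hP₁ hTU hx hgen h₀ hP
    refine ⟨m, ⟨⟨a₀, ha₀, h₀.hasOrder hT hTU'⟩, ?_⟩,
      fun r h => ENat.natCast_ne_top _ (top_le_iff.1 (h ▸ hfin r)), ?_, key⟩
    · rintro μ ⟨a, ha, hord⟩
      obtain ⟨m', n', c', h'⟩ := exists_isNormalForm hdim hdeg hP₁ hTU ha
      have h1 := (h'.hasOrder hT hTU').unique hT hord
      have h2 := hmin a m' n' c' ha h'
      omega
    · obtain ⟨n, c, θ, j, -, -, -, hr⟩ := key a₀ ha₀ (h₀.hasOrder hT hTU')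
      refine tendsto_div_of_le_of_le (n := n) (k := j + 1) (R := max 1 j) fun r hr' => ?_
      obtain ⟨h1, h2, h3⟩ := hr r hr'
      by_cases hN : p ∣ r * m + n - j
      · rw [h3 hN, ENat.toNat_natCast]
        omega
      · rw [h2 hN, ENat.toNat_natCast]
        omega
  obtain ⟨T₀, U₀, hTU₀⟩ := exists_isAdapted hdim hnc hP₁
  obtain ⟨m₀, -, hfin, hlim, -⟩ := main T₀ U₀ hTU₀
  refine ⟨fun r _ => hfin r, ⟨m₀, hlim⟩, fun T U hTU => ?_⟩
  obtain ⟨m, hleast, -, hlim, key⟩ := main T U hTU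
  have hU := prime_of_span_pair_eq hdim (by rw [Set.pair_comm, hTU.1] : Ideal.span {U, T} = _)
  have hUT := not_dvd_of_span_pair_eq hdim (by rw [Set.pair_comm, hTU.1] : Ideal.span {U, T} = _)
  refine ⟨m, hleast, hlim, fun a ha hord => ?_⟩
  obtain ⟨n, c, θ, j, h, hθ, hj, hr⟩ := key a ha hord
  refine ⟨n, c, θ, j, fun h1 => h.eq_zero fun h2 => ?_, h.hasOrder_snd hU hUT, ?_, hθ, hj,
    fun r hr' => ?_⟩
  · rw [h1] at h2
    exact absurd h2 (by norm_num)
  · rw [← h.eq, map_mul, map_pow, map_pow]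
  · obtain ⟨h1, h2, h3⟩ := hr r hr'
    have hcast : (r * m + n - j : ℤ) = ((r * m + n - j : ℕ) : ℤ) := by
      rw [Nat.cast_sub (by omega)]
      push_cast
      ring
    rw [hcast, Int.natCast_dvd_natCast]
    refine ⟨fun hN => ?_, fun hN => ?_⟩
    · rw [h2 hN]
      exact_mod_cast Nat.sub_add_cancel (by omega)
    · rw [h3 hN]
      norm_cast
      omega
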